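/- **Proposition 2.4.** For a matrix $A\in\mathbb{R}^{m\times n}$ and $C>0$ let $$\Gamma_{A,C}:=\Big\{x\in\mathbb{R}^n:\ \|x\|_\infty\le 1,\ \ \|Ax\|_\infty\le C\sqrt{n\log(m/n+2)}\Big\}.$$ There is a randomized algorithm $\operatorname{Solve}$, and there are constants $K,a,b\in\mathbb{N}$, such that the following holds for all $n\ge 100$, all $m\le n^2$, all $k\in\mathbb N$ and all real $C$ with $0<C\le\sqrt{\log n}/3$. On input $C$, - a matrix $A\in\mathbb{R}^{m\times n}$ with $\|A\|_{1\to\infty}=\max_{i,j}|A_{ij}|\le 1$ in which every column has at most $k$ nonzero entries, and - a vector $v\in\mathbb{R}^n$ with $\|v\|_2\le 2\sqrt n$, $\operatorname{Solve}$ always halts, after at most $$K\,(kn+n^2)\,\big(\max\{1,1/C\}\cdot\log n\big)^{a}$$ steps, and with probability at least $99/100$ it outputs some $z\in\Gamma_{A,C}$ such that $$\frac{\langle v,z\rangle}{\sqrt n}\ \ge\ \sup_{y\in\Gamma_{A,C}}\frac{\langle v,y\rangle}{\sqrt n}\;-\;\frac{\sqrt n}{(\log n)^2}.$$ In particular the running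 time is $\tilde O(kn+n^2)$, where $\tilde O$ hides factors polylogarithmic in $n$, with absolute constants for $C\ge1$ and with constants depending only on $c_0$ for $C\ge c_0>0$. Here an algorithm is a single program (for all $n,m,C,A,v$) of a randomized real RAM with integer words smaller than $n^b$, i.e. of $O(\log n)$ bits, and exact real numbers, both in registers and in random-access arrays. One step is one of: an operation $+,-,\times,\div$ on two words or on two reals, a conversion of a word to a real, a read or write of an array cell, a comparison, or a toss of a fair coin. There are no conversions from reals to words. The matrix $A$ is given by the lists of the nonzero entries of its columns (compressed sparse column format). -/

import Mathlib

open MeasureTheory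

/-! ### The machine model

A randomized real RAM. It holds bounded integers ("words", used for addressing and control) and
exact real numbers, in registers and in random access arrays. A unit-cost step is one arithmetic
operation, one memory access, one comparison or one toss of a fair coin. There is no rounding and no
conversion from reals to words, so that reals cannot be used to pack integers. A program is a finite
piece of code that does not depend on the size of the input. -/

namespace RealRAM

/-- A machine configuration. -/
structure State where
  /-- word registers -/
  w : ℕ → ℕ
  /-- real registers -/
  x : ℕ → ℝ
  /-- word arrays: `wm a i` is cell `i` of array `a` -/
  wm : ℕ → ℕ → ℕ
  /-- real arrays: `xm a i` is cell `i` of array `a` -/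
  xm : ℕ → ℕ → ℝ
  /-- the coins that have not been tossed yet -/
  coins : ℕ → Bool

/-- The four arithmetic operations. -/
inductive Arith
  | add | sub | mul | div

/-- On words: truncated subtraction and rounded-down division (`a / 0 = 0`). -/
def Arith.onWord : Arith → ℕ → ℕ → ℕ
  | .add, a, b => a + b
  | .sub, a, b => a - b
  | .mul, a, b => a * b
  | .div, a, b => a / b

/-- On reals: exact (with `a / 0 = 0`). -/
noncomputable def Arith.onReal : Arith → ℝ → ℝ → ℝ
  | .add, a, b => a + b
  | .sub, a, b => a - b
  | .mul, a, b => a * b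
  | .div, a, b => a / b

/-- Instructions. The number `d` is the destination, `i` and `j` are registers, `a` is an array. -/
inductive Instr
  /-- word register `d` gets the constant `c` -/
  | wconst (d c : ℕ)
  /-- word register `d` gets the result of an operation on word registers `i` and `j` -/
  | wop (o : Arith) (d i j : ℕ)
  /-- word register `d` gets the cell of word array `a` addressed by word register `i` -/
  | wload (d a i : ℕ)
  /-- the cell of word array `a` addressed by word register `i` gets word register `j` -/
  | wstore (a i j : ℕ)
  /-- real register `d` gets the value of word register `i` -/
  | xcast (d i : ℕ)
  /-- real register `d` gets the result of an operation on real registers `i` and `j` -/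
  | xop (o : Arith) (d i j : ℕ)
  /-- real register `d` gets the cell of real array `a` addressed by word register `i` -/
  | xload (d a i : ℕ)
  /-- the cell of real array `a` addressed by word register `i` gets real register `j` -/
  | xstore (a i j : ℕ)
  /-- word register `d` gets a fresh fair coin toss, 0 or 1 -/
  | coin (d : ℕ)

namespace State

/-- Write a word register. Words are below `B`: a larger value is an error (the machine is stuck). -/
def setWord (B : ℕ) (s : State) (d c : ℕ) : Option State :=
  if c < B then some { s with w := Function.update s.w d c } else none

/-- Write a real register. -/
def setReal (s : State) (d : ℕ) (c : ℝ) : State :=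
  { s with x := Function.update s.x d c }

end State

/-- The effect of an instruction on a machine whose words are bounded by `B`. -/
noncomputable def Instr.exec (B : ℕ) (s : State) : Instr → Option State
  | .wconst d c => s.setWord B d c
  | .wop o d i j => s.setWord B d (o.onWord (s.w i) (s.w j))
  | .wload d a i => s.setWord B d (s.wm a (s.w i))
  | .wstore a i j =>
      some { s with wm := Function.update s.wm a (Function.update (s.wm a) (s.w i) (s.w j)) }
  | .xcast d i => some (s.setReal d (s.w i : ℝ))
  | .xop o d i j => some (s.setReal d (o.onReal (s.x i) (s.x j)))
  | .xload d a i => some (s.setReal d (s.xm a (s.w i)))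
  | .xstore a i j =>
      some { s with xm := Function.update s.xm a (Function.update (s.xm a) (s.w i) (s.x j)) }
  | .coin d => ({ s with coins := fun l => s.coins (l + 1) } : State).setWord B d
      (if s.coins 0 then 1 else 0)

/-- Comparisons of two registers. -/
inductive Test
  | wlt (i j : ℕ)
  | weq (i j : ℕ)
  | xlt (i j : ℕ)
  | xle (i j : ℕ)

/-- The outcome of a comparison. -/
def Test.Holds (s : State) : Test → Prop
  | .wlt i j => s.w i < s.w j
  | .weq i j => s.w i = s.w j
  | .xlt i j => s.x i < s.x j
  | .xle i j => s.x i ≤ s.x j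

/-- Programs. -/
inductive Prog
  | skip
  | instr (i : Instr)
  | seq (p q : Prog)
  | ite (b : Test) (p q : Prog)
  | loop (b : Test) (p : Prog)

/-- `Exec B p s t s'`: on a machine whose words are bounded by `B`, program `p` started in `s` halts
in `s'` after `t` steps. Every instruction and every evaluated test counts as one step;
`loop b p` is "while `b` do `p`". -/
inductive Exec (B : ℕ) : Prog → State → ℕ → State → Prop
  | skip (s : State) : Exec B .skip s 1 s
  | instr {i : Instr} {s s' : State} : i.exec B s = some s' → Exec B (.instr i) s 1 s'
  | seq {p q : Prog} {s s' s'' : State} {t t' : ℕ} :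
      Exec B p s t s' → Exec B q s' t' s'' → Exec B (.seq p q) s (t + t') s''
  | ite_true {b : Test} {p q : Prog} {s s' : State} {t : ℕ} :
      b.Holds s → Exec B p s t s' → Exec B (.ite b p q) s (t + 1) s'
  | ite_false {b : Test} {p q : Prog} {s s' : State} {t : ℕ} :
      ¬ b.Holds s → Exec B q s t s' → Exec B (.ite b p q) s (t + 1) s'
  | loop_false {b : Test} {p : Prog} {s : State} :
      ¬ b.Holds s → Exec B (.loop b p) s 1 s
  | loop_true {b : Test} {p : Prog} {s s' s'' : State} {t t' : ℕ} :
      b.Holds s → Exec B p s t s' → Exec B (.loop b p) s' t' s'' →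
      Exec B (.loop b p) s (t + t' + 1) s''

/-- The law of an infinite sequence of independent fair coin tosses. -/
noncomputable def fairCoins : Measure (ℕ → Bool) :=
  Measure.infinitePi fun _ => (PMF.uniformOfFintype Bool).toMeasure

end RealRAM

/-! ### Input, output, and the linear program -/

namespace DiscrepancyLP

open RealRAM

open Classical in
/-- The positions of the nonzero entries of `A`, column by column. -/
noncomputable def nonzeros {m n : ℕ} (A : Matrix (Fin m) (Fin n) ℝ) : List (Fin m × Fin n) :=
  (List.finRange n).flatMap fun j =>
    ((List.finRange m).filter fun i => A i j ≠ 0).map fun i => (i, j)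

/-- The initial state on input `(A, v)` and parameter `C`. The words `m` and `n` are in word
registers 0 and 1, and `C` is in real register 0. The matrix `A` is given in compressed sparse column
format: the rows and the values of its nonzero entries, listed column by column, are in word array 1
and real array 0, and cell `j` of word array 0 is the number of nonzero entries in columns before `j`
(so that column `j` occupies the positions from cell `j` to cell `j + 1`). The vector `v` is in real
array 1. Everything else is 0. -/
noncomputable def input {m n : ℕ} (A : Matrix (Fin m) (Fin n) ℝ) (v : Fin n → ℝ) (C : ℝ)
    (coins : ℕ → Bool) : State where
  w r := if r = 0 then m else if r = 1 then n else 0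
  x r := if r = 0 then C else 0
  wm a p :=
    if a = 0 then (nonzeros A).countP fun e => (e.2 : ℕ) < p
    else if a = 1 then ((nonzeros A)[p]?).elim 0 fun e => (e.1 : ℕ)
    else 0
  xm a p :=
    if a = 0 then ((nonzeros A)[p]?).elim 0 fun e => A e.1 e.2
    else if a = 1 then (if h : p < n then v ⟨p, h⟩ else 0)
    else 0
  coins := coins

/-- The output: the first `n` cells of real array 2. -/
def output (n : ℕ) (s : State) : Fin n → ℝ := fun j => s.xm 2 j

/-- The feasible region `Γ_{A,C}`. The norms are sup norms. -/
def feasible {m n : ℕ} (A : Matrix (Fin m) (Fin n) ℝ) (C : ℝ) : Set (Fin n → ℝ) :=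
  {x | ‖x‖ ≤ 1 ∧ ‖A.mulVec x‖ ≤ C * √(n * Real.log ((m : ℝ) / n + 2))}

/-- The objective `⟨v, x⟩ / √n`. -/
noncomputable def objective {n : ℕ} (v x : Fin n → ℝ) : ℝ := (v ⬝ᵥ x) / √n

end DiscrepancyLP

/-! The linear program is solved by Lagrangian relaxation and multiplicative weights with sampled
columns. Let `r` be the computed radius of the row constraints and `N = 2 ^ q` the number of columns
after padding with zero columns. Exceeding `r` in a row is priced at `lam = 2 * n / r`. As `⟨v, z⟩ ≤
2n` on the cube, violations do not pay at this price. The dual player holds weights on the `2m`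
signed rows and on a constant strategy that collects `ρ = r / N` in every step, which is the option
of charging nothing. A step draws a uniform column `j`, lets the primal player add the better sign
in coordinate `j`, and multiplies the weight of each signed row by one plus `η` times its gain. It
touches only the nonzero entries of one column, so it costs `O(k + log n)`.

The total weight is estimated from both sides. It is at least the weight of any single strategy,
which is at least `exp (η * gain - η ^ 2 * time)`. Its logarithm grows at most by `η / lam` times
the surplus of the chosen signs over a fixed feasible point `y`. Played through a uniform column,
`y` has its expected value, up to a martingale `X`. This gives the regret bound `Game.Inv.regret`, a
deterministic inequality in which chance appears only through `X`. The random quantities needed are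
`X`, controlled by its second moment, and the numbers of samples of each column, controlled by an
exponential moment. One supermartingale handles both (`Game.fairCoins_bad_le`). After about `q ^ 5 *
(N ^ 2 / r ^ 2 + N)` steps all errors are `O(n / q ^ 2)`, where `q` is about `log₂ n`.

The sums of the signs are scaled by `N / T` and divided by their largest relative violation `S ≥ 1`,
so the output is always feasible. The division is harmless: if `S` comes from a row, the regret
bound contains a bonus `2n(S - 1)` that pays for it, and if it comes from a coordinate, then `S` is
close to 1 in a typical run (`Game.Tuned.value_ge`).

The machine has no logarithm and no square root. A Riemann sum and Newton's iteration yield the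
radius from below up to a factor `1 - 1 / (4n)`, which keeps the output feasible and costs at most
`1 / 2` in `⟨v, y⟩`. As real arithmetic is exact, the program follows the game without rounding
(`DiscrepancyLP.solve_spec`). -/

namespace RealRAM

/-! ### Program logic -/

/-- Program `p` started in `s` halts after at most `T` steps in a state satisfying `Q`. -/
def Runs (B : ℕ) (p : Prog) (s : State) (T : ℕ) (Q : State → Prop) : Prop :=
  ∃ t s', Exec B p s t s' ∧ t ≤ T ∧ Q s'

theorem Runs.mono {B : ℕ} {p : Prog} {s : State} {T T' : ℕ} {Q Q' : State → Prop}
    (h : Runs B p s T Q) (hT : T ≤ T') (hQ : ∀ s', Q s' → Q' s') : Runs B p s T' Q' := by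
  obtain ⟨t, s', he, ht, hq⟩ := h
  exact ⟨t, s', he, ht.trans hT, hQ _ hq⟩

theorem Runs.seq {B : ℕ} {p q : Prog} {s : State} {T₁ T₂ : ℕ} {Q Q' : State → Prop}
    (h₁ : Runs B p s T₁ Q) (h₂ : ∀ s', Q s' → Runs B q s' T₂ Q') :
    Runs B (.seq p q) s (T₁ + T₂) Q' := by
  obtain ⟨t, s', he, ht, hq⟩ := h₁
  obtain ⟨t', s'', he', ht', hq'⟩ := h₂ s' hq
  exact ⟨t + t', s'', .seq he he', add_le_add ht ht', hq'⟩

theorem Runs.ite {B : ℕ} {b : Test} {p q : Prog} {s : State} {T : ℕ} {Q : State → Prop}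
    (h₁ : b.Holds s → Runs B p s T Q) (h₂ : ¬ b.Holds s → Runs B q s T Q) :
    Runs B (.ite b p q) s (T + 1) Q := by
  by_cases hb : b.Holds s
  · obtain ⟨t, s', he, ht, hq⟩ := h₁ hb
    exact ⟨t + 1, s', .ite_true hb he, by omega, hq⟩
  · obtain ⟨t, s', he, ht, hq⟩ := h₂ hb
    exact ⟨t + 1, s', .ite_false hb he, by omega, hq⟩

/-- A loop that makes exactly `n` iterations, with invariant `I`. -/
theorem Runs.loop {B : ℕ} {b : Test} {p : Prog} {T : ℕ} (n : ℕ) (I : ℕ → State → Prop)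
    (hstep : ∀ k < n, ∀ s, I k s → b.Holds s ∧ Runs B p s T (I (k + 1)))
    (hend : ∀ s, I n s → ¬ b.Holds s) {s : State} (h0 : I 0 s) :
    Runs B (.loop b p) s (n * (T + 1) + 1) (I n) := by
  suffices H : ∀ d k, k + d = n → ∀ s, I k s → Runs B (.loop b p) s (d * (T + 1) + 1) (I n) from
    H n 0 (by omega) s h0
  intro d
  induction d with
  | zero =>
    intro k hk s hs
    obtain rfl : k = n := by omega
    exact ⟨1, s, .loop_false (hend s hs), by omega, hs⟩
  | succ d ih =>
    intro k hk s hs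
    obtain ⟨hb, t, s', he, ht, hq⟩ := hstep k (by omega) s hs
    obtain ⟨t', s'', he', ht', hq'⟩ := ih (k + 1) (by omega) s' hq
    refine ⟨t + t' + 1, s'', .loop_true hb he he', ?_, hq'⟩
    have : (d + 1) * (T + 1) = d * (T + 1) + (T + 1) := by ring
    omega

/-! ### Register and array updates, straight-line code and frames -/

namespace State

def setW (s : State) (d c : ℕ) : State := { s with w := Function.update s.w d c }

def setXM (s : State) (a i : ℕ) (c : ℝ) : State :=
  { s with xm := Function.update s.xm a (Function.update (s.xm a) i c) }

def toss (s : State) : State := { s with coins := fun l => s.coins (l + 1) }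

section
variable (s : State) (d c a i r : ℕ) (y : ℝ)

@[simp] theorem setW_w : (s.setW d c).w r = if r = d then c else s.w r := by
  simp [setW, Function.update_apply]
@[simp] theorem setW_x : (s.setW d c).x = s.x := rfl
@[simp] theorem setW_wm : (s.setW d c).wm = s.wm := rfl
@[simp] theorem setW_xm : (s.setW d c).xm = s.xm := rfl
@[simp] theorem setW_coins : (s.setW d c).coins = s.coins := rfl
@[simp] theorem setReal_w : (s.setReal d y).w = s.w := rfl
@[simp] theorem setReal_x : (s.setReal d y).x r = if r = d then y else s.x r := by
  simp [setReal, Function.update_apply]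
@[simp] theorem setReal_wm : (s.setReal d y).wm = s.wm := rfl
@[simp] theorem setReal_xm : (s.setReal d y).xm = s.xm := rfl
@[simp] theorem setReal_coins : (s.setReal d y).coins = s.coins := rfl
@[simp] theorem setXM_w : (s.setXM a i y).w = s.w := rfl
@[simp] theorem setXM_x : (s.setXM a i y).x = s.x := rfl
@[simp] theorem setXM_wm : (s.setXM a i y).wm = s.wm := rfl
@[simp] theorem setXM_xm :
    (s.setXM a i y).xm r d = if r = a ∧ d = i then y else s.xm r d := by
  by_cases h : r = a
  · subst h; simp [setXM, Function.update_apply]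
  · simp [setXM, h]
theorem setXM_xm_ne (h : r ≠ a) : (s.setXM a i y).xm r = s.xm r := by
  simp [setXM, h]
@[simp] theorem setXM_coins : (s.setXM a i y).coins = s.coins := rfl
@[simp] theorem toss_w : s.toss.w = s.w := rfl
@[simp] theorem toss_x : s.toss.x = s.x := rfl
@[simp] theorem toss_wm : s.toss.wm = s.wm := rfl
@[simp] theorem toss_xm : s.toss.xm = s.xm := rfl
@[simp] theorem toss_coins : s.toss.coins = fun l => s.coins (l + 1) := rfl

end

end State

/-- Straight-line code. -/
def block : List Instr → Prog
  | [] => .skip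
  | i :: l => .seq (.instr i) (block l)

/-- Weakest precondition of straight-line code that does not write word arrays. -/
def wp (B : ℕ) : List Instr → (State → Prop) → State → Prop
  | [], Q, s => Q s
  | .wconst d c :: l, Q, s => c < B ∧ wp B l Q (s.setW d c)
  | .wop o d i j :: l, Q, s =>
      o.onWord (s.w i) (s.w j) < B ∧ wp B l Q (s.setW d (o.onWord (s.w i) (s.w j)))
  | .wload d a i :: l, Q, s => s.wm a (s.w i) < B ∧ wp B l Q (s.setW d (s.wm a (s.w i)))
  | .wstore _ _ _ :: _, _, _ => False
  | .xcast d i :: l, Q, s => wp B l Q (s.setReal d (s.w i : ℝ))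
  | .xop o d i j :: l, Q, s => wp B l Q (s.setReal d (o.onReal (s.x i) (s.x j)))
  | .xload d a i :: l, Q, s => wp B l Q (s.setReal d (s.xm a (s.w i)))
  | .xstore a i j :: l, Q, s => wp B l Q (s.setXM a (s.w i) (s.x j))
  | .coin d :: l, Q, s => 1 < B ∧ wp B l Q (s.toss.setW d (if s.coins 0 then 1 else 0))

theorem Runs.block {B : ℕ} {l : List Instr} {s : State} {Q : State → Prop} (h : wp B l Q s) :
    Runs B (block l) s (l.length + 1) Q := by
  induction l generalizing s with
  | nil => exact ⟨1, s, .skip s, by simp, h⟩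
  | cons i l ih =>
    suffices H : ∃ s', i.exec B s = some s' ∧ wp B l Q s' by
      obtain ⟨s', h1, h2⟩ := H
      refine Runs.mono (T := 1 + (l.length + 1)) (Runs.seq (Q := (· = s')) ?_ ?_) ?_ (fun _ => id)
      · exact ⟨1, s', .instr h1, le_rfl, rfl⟩
      · rintro _ rfl
        exact ih h2
      · simp only [List.length_cons]; omega
    cases i with
    | wconst d c => exact ⟨_, if_pos h.1, h.2⟩
    | wop o d i j => exact ⟨_, if_pos h.1, h.2⟩
    | wload d a i => exact ⟨_, if_pos h.1, h.2⟩
    | wstore a i j => exact h.elim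
    | xcast d i => exact ⟨_, rfl, h⟩
    | xop o d i j => exact ⟨_, rfl, h⟩
    | xload d a i => exact ⟨_, rfl, h⟩
    | xstore a i j => exact ⟨_, rfl, h⟩
    | coin d =>
      refine ⟨_, if_pos ?_, h.2⟩
      have := h.1
      split_ifs <;> omega

/-- `s'` agrees with `s` except on the listed word registers, real registers and real arrays. -/
structure Frame (W X M : List ℕ) (s s' : State) : Prop where
  w : ∀ r, r ∉ W → s'.w r = s.w r
  x : ∀ r, r ∉ X → s'.x r = s.x r
  xm : ∀ a, a ∉ M → s'.xm a = s.xm a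
  wm : s'.wm = s.wm
  coins : s'.coins = s.coins

namespace Frame

variable {W X M W' X' M' : List ℕ} {s s' s'' : State}

theorem refl : Frame W X M s s := ⟨fun _ _ => rfl, fun _ _ => rfl, fun _ _ => rfl, rfl, rfl⟩

theorem trans (h : Frame W X M s s') (h' : Frame W X M s' s'') : Frame W X M s s'' :=
  ⟨fun r hr => (h'.w r hr).trans (h.w r hr), fun r hr => (h'.x r hr).trans (h.x r hr),
    fun r hr => (h'.xm r hr).trans (h.xm r hr), h'.wm.trans h.wm, h'.coins.trans h.coins⟩

theorem mono (h : Frame W X M s s') (hW : W ⊆ W') (hX : X ⊆ X') (hM : M ⊆ M') :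
    Frame W' X' M' s s' :=
  ⟨fun r hr => h.w r fun h' => hr (hW h'), fun r hr => h.x r fun h' => hr (hX h'),
    fun r hr => h.xm r fun h' => hr (hM h'), h.wm, h.coins⟩

theorem setW (h : Frame W X M s s') {d c : ℕ} (hd : d ∈ W) : Frame W X M s (s'.setW d c) :=
  ⟨fun r hr => by
    have : r ≠ d := fun e => hr (e ▸ hd)
    simp [this, h.w r hr], h.x, h.xm, h.wm, h.coins⟩

theorem setReal (h : Frame W X M s s') {d : ℕ} {c : ℝ} (hd : d ∈ X) :
    Frame W X M s (s'.setReal d c) :=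
  ⟨h.w, fun r hr => by
    have : r ≠ d := fun e => hr (e ▸ hd)
    simp [this, h.x r hr], h.xm, h.wm, h.coins⟩

theorem setXM (h : Frame W X M s s') {a i : ℕ} {c : ℝ} (hd : a ∈ M) :
    Frame W X M s (s'.setXM a i c) :=
  ⟨h.w, h.x, fun r hr => by
    have : r ≠ a := fun e => hr (e ▸ hd)
    rw [State.setXM_xm_ne _ _ _ _ _ this, h.xm r hr], h.wm, h.coins⟩

end Frame

end RealRAM

namespace RealRAM

/-! ### Uniform samples from coins -/

/-- Prepend a coin toss. -/
def consCoin (b : Bool) (ω : ℕ → Bool) : ℕ → Bool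
  | 0 => b
  | l + 1 => ω l

/-- Drop the first `q` tosses. -/
def dropCoins (q : ℕ) (ω : ℕ → Bool) : ℕ → Bool := fun l => ω (l + q)

theorem measurable_consCoin (b : Bool) : Measurable (consCoin b) := by
  refine measurable_pi_lambda _ fun l => ?_
  cases l with
  | zero => exact measurable_const
  | succ l => exact measurable_pi_apply l

instance : IsProbabilityMeasure fairCoins := by
  unfold fairCoins; infer_instance

theorem coin_apply (s : Set Bool) : (PMF.uniformOfFintype Bool).toMeasure s =
    2⁻¹ * (s.indicator 1 false + s.indicator 1 true) := by
  rw [PMF.toMeasure_apply_fintype]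
  by_cases h0 : false ∈ s <;> by_cases h1 : true ∈ s <;> simp [h0, h1, mul_add]

/-- Self-similarity of the coin law: a first toss followed by an independent sequence of the same
law. An infinite product measure is determined by its values on finite boxes, so these are compared.
-/
theorem fairCoins_eq : fairCoins =
    (2⁻¹ : ENNReal) • (fairCoins.map (consCoin false) + fairCoins.map (consCoin true)) := by
  symm
  refine Measure.eq_infinitePi _ fun s t ht => ?_
  classical
  -- Enlarging the index set to an initial segment lets the factor of coordinate 0 split off while
  -- the others shift by one.
  obtain ⟨M, hM⟩ : ∃ M, s ⊆ Finset.range (M + 1) :=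
    ⟨s.sup id, fun i hi => Finset.mem_range_succ_iff.2 (Finset.le_sup (f := id) hi)⟩
  set t' : ℕ → Set Bool := fun i => if i ∈ s then t i else Set.univ with ht'
  have hmeas : ∀ i, MeasurableSet (t' i) := fun i => by
    simp only [ht']; split_ifs; exacts [ht i, MeasurableSet.univ]
  have hpi : Set.pi (s : Set ℕ) t = Set.pi (Finset.range (M + 1) : Set ℕ) t' := by
    ext ω
    simp only [Set.mem_pi, Finset.mem_coe, ht']
    refine ⟨fun h i _ => ?_, fun h i hi => ?_⟩
    · split_ifs with hi
      exacts [h i hi, trivial]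
    · simpa [hi] using h i (hM hi)
  have hprod : ∏ i ∈ s, (PMF.uniformOfFintype Bool).toMeasure (t i) =
      ∏ i ∈ Finset.range (M + 1), (PMF.uniformOfFintype Bool).toMeasure (t' i) := by
    rw [← Finset.prod_subset hM]
    · refine Finset.prod_congr rfl fun i hi => by simp [ht', hi]
    · intro i _ hi
      simp only [ht', hi, if_false]
      exact measure_univ
  have hpre : ∀ b, fairCoins (consCoin b ⁻¹' Set.pi (Finset.range (M + 1) : Set ℕ) t') =
      (t' 0).indicator 1 b *
        ∏ i ∈ Finset.range M, (PMF.uniformOfFintype Bool).toMeasure (t' (i + 1)) := by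
    intro b
    by_cases hb : b ∈ t' 0
    · rw [Set.indicator_of_mem hb, Pi.one_apply, one_mul, fairCoins,
        ← Measure.infinitePi_pi (μ := fun _ : ℕ => (PMF.uniformOfFintype Bool).toMeasure)
          (t := fun i => t' (i + 1)) fun i _ => hmeas _]
      congr 1
      ext ω
      simp only [Set.mem_preimage, Set.mem_pi, Finset.mem_coe, Finset.mem_range]
      refine ⟨fun h i hi => h (i + 1) (by omega), fun h i hi => ?_⟩
      cases i with
      | zero => exact hb
      | succ i => exact h i (by omega)
    · rw [Set.indicator_of_notMem hb, zero_mul]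
      convert measure_empty (μ := fairCoins)
      ext ω
      simp only [Set.mem_preimage, Set.mem_pi, Set.mem_empty_iff_false, iff_false]
      exact fun h => hb (h 0 (by simp))
  have hms : MeasurableSet (Set.pi (Finset.range (M + 1) : Set ℕ) t') :=
    MeasurableSet.pi (Finset.countable_toSet _) fun i _ => hmeas i
  rw [hpi, hprod, Finset.prod_range_succ', coin_apply (t' 0)]
  simp only [Measure.smul_apply, Measure.add_apply, smul_eq_mul]
  rw [Measure.map_apply (measurable_consCoin _) hms, Measure.map_apply (measurable_consCoin _) hms,
    hpre, hpre]
  ring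

/-- Valid for arbitrary sets because prepending a coin is a measurable embedding. For this reason no
event below has to be shown measurable. -/
theorem fairCoins_real_cons (S : Set (ℕ → Bool)) : fairCoins.real S =
    (fairCoins.real (consCoin false ⁻¹' S) + fairCoins.real (consCoin true ⁻¹' S)) / 2 := by
  have hemb : ∀ b, MeasurableEmbedding (consCoin b) := fun b =>
    (measurable_consCoin b).measurableEmbedding fun ω ω' h => by
      funext l
      exact congrFun h (l + 1)
  have h := congrArg (fun μ : Measure (ℕ → Bool) => μ.real S) fairCoins_eq
  simp only [Measure.real, Measure.smul_apply, Measure.add_apply, smul_eq_mul,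
    (hemb _).map_apply] at h ⊢
  rw [h, ENNReal.toReal_mul, ENNReal.toReal_add (measure_ne_top _ _) (measure_ne_top _ _)]
  simp
  ring

/-- The number with the binary digits of the first `q` tosses, appended to those of `acc`. -/
def sample : ℕ → ℕ → (ℕ → Bool) → ℕ
  | 0, acc, _ => acc
  | q + 1, acc, ω => sample q (acc + acc + if ω 0 then 1 else 0) (dropCoins 1 ω)

/-- The sample is uniform and independent of the remaining coins, which are fair again. The
accumulator is general because the first toss of the induction changes it. -/
theorem fairCoins_real_sample (q : ℕ) : ∀ (acc : ℕ) (Q : ℕ → (ℕ → Bool) → Prop),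
    fairCoins.real {ω | Q (sample q acc ω) (dropCoins q ω)} =
      (∑ j ∈ Finset.range (2 ^ q), fairCoins.real {ω | Q (acc * 2 ^ q + j) ω}) / 2 ^ q := by
  induction q with
  | zero => intro acc Q; simp [sample, show ∀ ω, dropCoins 0 ω = ω from fun _ => rfl]
  | succ q ih =>
    intro acc Q
    rw [fairCoins_real_cons]
    have h1 : ∀ b : Bool, consCoin b ⁻¹' {ω | Q (sample (q + 1) acc ω) (dropCoins (q + 1) ω)} =
        {ω | Q (sample q (acc + acc + if b then 1 else 0) ω) (dropCoins q ω)} := by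
      intro b
      rfl
    rw [h1, h1, ih, ih, pow_succ, mul_two, Finset.sum_range_add]
    have h2 : ∀ j, (acc + acc + 0) * 2 ^ q + j = acc * (2 ^ q + 2 ^ q) + j := by
      intro j; ring
    have h3 : ∀ j, (acc + acc + 1) * 2 ^ q + j = acc * (2 ^ q + 2 ^ q) + (2 ^ q + j) := by
      intro j; ring
    simp only [Bool.false_eq_true, if_false, if_true, h2, h3]
    rw [pow_succ]
    field_simp

/-- Run a process that consumes a uniform sample from `2 ^ q` values at each of `T` steps. -/
def runSteps {σ : Type*} (q : ℕ) (step : σ → ℕ → σ) : ℕ → σ → (ℕ → Bool) → σ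
  | 0, s, _ => s
  | T + 1, s, ω => runSteps q step T (step s (sample q 0 ω)) (dropCoins q ω)

theorem dropCoins_dropCoins (p q : ℕ) (ω : ℕ → Bool) :
    dropCoins p (dropCoins q ω) = dropCoins (p + q) ω := by
  funext l; simp [dropCoins, add_assoc]

/-- The definition splits off the first step, as conditioning requires. Invariants and the loop of
the machine need the last step split off instead. -/
theorem runSteps_succ {σ : Type*} (q : ℕ) (step : σ → ℕ → σ) (T : ℕ) (s : σ) (ω : ℕ → Bool) :
    runSteps q step (T + 1) s ω =
      step (runSteps q step T s ω) (sample q 0 (dropCoins (T * q) ω)) := by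
  induction T generalizing s ω with
  | zero => simp [runSteps, show ∀ ω, dropCoins 0 ω = ω from fun _ => rfl]
  | succ T ih =>
    rw [runSteps, ih, dropCoins_dropCoins, ← Nat.succ_mul]
    rfl

/-- A potential argument: if `g` is a nonnegative supermartingale along the process, then the
probability of ending in a state where it is at least 1 is at most its initial value. -/
theorem fairCoins_runSteps_le {σ : Type*} (q : ℕ) (step : σ → ℕ → σ) (Inv Bad : σ → Prop)
    (g : ℕ → σ → ℝ) (hinv : ∀ s j, j < 2 ^ q → Inv s → Inv (step s j))
    (hpos : ∀ s, Inv s → 0 ≤ g 0 s) (hbad : ∀ s, Inv s → Bad s → 1 ≤ g 0 s)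
    (hstep : ∀ t s, Inv s →
      (∑ j ∈ Finset.range (2 ^ q), g t (step s j)) / 2 ^ q ≤ g (t + 1) s) (T : ℕ) :
    ∀ s, Inv s → fairCoins.real {ω | Bad (runSteps q step T s ω)} ≤ g T s := by
  induction T with
  | zero =>
    intro s hs
    by_cases h : Bad s
    · refine le_trans ?_ (hbad s hs h)
      exact measureReal_le_one
    · simpa [runSteps, h] using hpos s hs
  | succ T ih =>
    intro s hs
    refine le_trans ?_ (hstep T s hs)
    -- Conditioning on the first sample; the induction hypothesis applies to the fresh coins that
    -- remain.
    refine (fairCoins_real_sample q 0 fun j ω => Bad (runSteps q step T (step s j) ω)).trans_le ?_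
    · gcongr with j hj
      simp only [zero_mul, zero_add]
      exact ih _ (hinv s j (Finset.mem_range.1 hj) hs)

end RealRAM

open RealRAM Finset

/-! ### Multiplicative weights with sampled columns -/

/-- Turns products of factors `1 + u` into exponentials of sums, at a quadratic loss. This bounds
the weights from below. -/
theorem Real.exp_sub_sq_le_one_add {u : ℝ} (hu : |u| ≤ 1 / 2) : Real.exp (u - u ^ 2) ≤ 1 + u := by
  obtain ⟨h1, h2⟩ := abs_le.1 hu
  rcases le_or_gt 0 u with h | h
  · have hw : |u - u ^ 2| ≤ 1 := abs_le.2 ⟨by nlinarith, by nlinarith⟩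
    have := (abs_le.1 (Real.abs_exp_sub_one_sub_id_le hw)).2
    nlinarith [mul_nonneg h h, mul_nonneg (mul_nonneg h h) h]
  · have hw : 0 ≤ -(u - u ^ 2) := by nlinarith
    have h3 := Real.quadratic_le_exp_of_nonneg hw
    have h4 : 1 ≤ (1 + u) * Real.exp (-(u - u ^ 2)) := by
      have h5 : 0 ≤ 1 + u := by linarith
      refine le_trans ?_ (mul_le_mul_of_nonneg_left h3 h5)
      -- With `x = u ^ 2 - u`, the product `(1 + u) * (1 + x + x ^ 2 / 2)` exceeds 1 by `u ^ 2 / 2`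
      -- times this cubic.
      have h6 : 0 ≤ 1 + u - u ^ 2 + u ^ 3 := by nlinarith [mul_pos_of_neg_of_neg h h]
      nlinarith [mul_nonneg (sq_nonneg u) h6]
    rw [Real.exp_neg] at h4
    have h5 := Real.exp_pos (u - u ^ 2)
    rwa [← div_eq_mul_inv, le_div_iff₀ h5, one_mul] at h4

/-- The data of the saddle point problem: a matrix `a` with `m` rows and `N` columns, an objective
`v`, a comparison point `y`, the learning rate `η`, the Lagrange multiplier `lam`, and the gain `ρ`
of the constant strategy. -/
structure Game where
  (m N : ℕ)
  (a : ℕ → ℕ → ℝ)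
  (v y : ℕ → ℝ)
  (η lam ρ : ℝ)

/-- The weights of the signed rows and of the constant strategy, the sums of the chosen signs, and,
for the analysis only, the martingale `X`, the numbers of samples and the time. -/
structure Game.State where
  (up um : ℕ → ℝ)
  (w0 : ℝ)
  (zs : ℕ → ℝ)
  (X : ℝ)
  (cnt : ℕ → ℕ)
  (time : ℕ)

namespace Game

variable (G : Game)

def total (σ : Game.State) : ℝ := σ.w0 + ∑ i ∈ range G.m, (σ.up i + σ.um i)

def grad (σ : Game.State) (j : ℕ) : ℝ := ∑ i ∈ range G.m, (σ.up i - σ.um i) * G.a i j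

/-- The best response to the current Lagrangian, whose coefficient at `j` is `v j - lam * grad j /
total`; the test is multiplied by the positive total. -/
noncomputable def sgn (σ : Game.State) (j : ℕ) : ℝ :=
  if G.v j * G.total σ - G.lam * G.grad σ j < 0 then -1 else 1

/-- The contribution of coordinate `j` to the current Lagrangian at the comparison point. Only
through it does `y` enter the dynamics. -/
noncomputable def drift (σ : Game.State) (j : ℕ) : ℝ :=
  (G.v j - G.lam * G.grad σ j / G.total σ) * G.y j

/-- The increment of `X` is the drift minus its mean over all columns, hence `X` is a martingale for
uniform `j`. -/
noncomputable def step (σ : Game.State) (j : ℕ) : Game.State where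
  up i := σ.up i * (1 + G.η * G.sgn σ j * G.a i j)
  um i := σ.um i * (1 - G.η * G.sgn σ j * G.a i j)
  w0 := σ.w0 * (1 + G.η * G.ρ)
  zs := Function.update σ.zs j (σ.zs j + G.sgn σ j)
  X := σ.X + (G.drift σ j - (∑ l ∈ range G.N, G.drift σ l) / G.N)
  cnt := Function.update σ.cnt j (σ.cnt j + 1)
  time := σ.time + 1

def init : Game.State where
  up _ := 1
  um _ := 1
  w0 := 1
  zs _ := 0
  X := 0
  cnt _ := 0
  time := 0

/-- The value of row `i` at the sums of the signs. -/
def rowSum (σ : Game.State) (i : ℕ) : ℝ := ∑ j ∈ range G.N, G.a i j * σ.zs j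

/-- By `row_le`, a uniformly sampled column of `y` gives any signed row at most `ρ` on average,
which is just what the constant strategy collects. -/
structure Valid : Prop where
  N_pos : 0 < G.N
  a_le : ∀ i j, |G.a i j| ≤ 1
  y_le : ∀ j, |G.y j| ≤ 1
  row_le : ∀ i < G.m, |∑ j ∈ range G.N, G.a i j * G.y j| ≤ G.N * G.ρ
  η_pos : 0 < G.η
  η_le : G.η ≤ 1 / 2
  lam_pos : 0 < G.lam
  ρ_nonneg : 0 ≤ G.ρ
  ρ_le : G.ρ ≤ 1

/-- The two-sided control of the weights. It holds for every sequence of columns; chance is confined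
to `X` and `cnt`. -/
structure Inv (σ : Game.State) : Prop where
  up_ge : ∀ i, Real.exp (G.η * G.rowSum σ i - G.η ^ 2 * σ.time) ≤ σ.up i
  um_ge : ∀ i, Real.exp (-(G.η * G.rowSum σ i) - G.η ^ 2 * σ.time) ≤ σ.um i
  w0_ge : Real.exp (σ.time * (G.η * G.ρ - G.η ^ 2)) ≤ σ.w0
  total_le : G.total σ ≤ (2 * G.m + 1) * Real.exp (G.η / G.lam *
    (∑ j ∈ range G.N, G.v j * σ.zs j - σ.X -
      σ.time * ((∑ j ∈ range G.N, G.v j * G.y j) / G.N - G.lam * G.ρ)))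
  zs_le : ∀ j, |σ.zs j| ≤ σ.cnt j

variable {G}

theorem Inv.up_pos {σ : Game.State} (h : G.Inv σ) (i : ℕ) : 0 < σ.up i :=
  (Real.exp_pos _).trans_le (h.up_ge i)

theorem Inv.um_pos {σ : Game.State} (h : G.Inv σ) (i : ℕ) : 0 < σ.um i :=
  (Real.exp_pos _).trans_le (h.um_ge i)

theorem Inv.w0_pos {σ : Game.State} (h : G.Inv σ) : 0 < σ.w0 :=
  (Real.exp_pos _).trans_le h.w0_ge

theorem Inv.w0_le_total {σ : Game.State} (h : G.Inv σ) : σ.w0 ≤ G.total σ :=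
  le_add_of_nonneg_right (sum_nonneg fun i _ => add_nonneg (h.up_pos i).le (h.um_pos i).le)

theorem Inv.total_pos {σ : Game.State} (h : G.Inv σ) : 0 < G.total σ :=
  h.w0_pos.trans_le h.w0_le_total

theorem Inv.up_add_um_le_total {σ : Game.State} (h : G.Inv σ) {i : ℕ} (hi : i < G.m) :
    σ.up i + σ.um i ≤ G.total σ := by
  have : σ.up i + σ.um i ≤ ∑ i ∈ range G.m, (σ.up i + σ.um i) :=
    single_le_sum (f := fun i => σ.up i + σ.um i)
      (fun i _ => add_nonneg (h.up_pos i).le (h.um_pos i).le) (mem_range.2 hi)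
  have := h.w0_pos
  unfold total
  linarith

theorem sgn_eq (σ : Game.State) (j : ℕ) : G.sgn σ j = 1 ∨ G.sgn σ j = -1 := by
  by_cases h : G.v j * G.total σ - G.lam * G.grad σ j < 0
  exacts [Or.inr (if_pos h), Or.inl (if_neg h)]

theorem abs_sgn (σ : Game.State) (j : ℕ) : |G.sgn σ j| = 1 := by
  rcases sgn_eq (G := G) σ j with h | h <;> simp [h]

/-- A linear function on `[-1, 1]` is largest at the endpoint that `sgn` selects. -/
theorem Inv.drift_le {σ : Game.State} (h : G.Inv σ) (hG : G.Valid) (j : ℕ) :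
    G.drift σ j ≤ (G.v j - G.lam * G.grad σ j / G.total σ) * G.sgn σ j := by
  have hW := h.total_pos
  obtain ⟨h1, h2⟩ := abs_le.1 (hG.y_le j)
  have e : G.v j - G.lam * G.grad σ j / G.total σ =
      (G.v j * G.total σ - G.lam * G.grad σ j) / G.total σ := by field_simp
  unfold drift sgn
  rw [e]
  split_ifs with hs
  · have := div_neg_of_neg_of_pos hs hW
    nlinarith
  · have := div_nonneg (not_lt.1 hs) hW.le
    nlinarith

/-- After exchanging the sums, this is a weighted sum of the rows of `y`, each at most `N * ρ` in
absolute value, and the signed rows carry the mass `total - w0`. -/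
theorem Inv.sum_grad_le {σ : Game.State} (h : G.Inv σ) (hG : G.Valid) :
    ∑ j ∈ range G.N, G.grad σ j * G.y j ≤ G.N * G.ρ * (G.total σ - σ.w0) := by
  have e : ∑ j ∈ range G.N, G.grad σ j * G.y j =
      ∑ i ∈ range G.m, (σ.up i - σ.um i) * ∑ j ∈ range G.N, G.a i j * G.y j := by
    simp only [grad, sum_mul, mul_sum]
    rw [sum_comm]
    simp only [mul_assoc]
  rw [e, total, add_sub_cancel_left, mul_sum]
  refine sum_le_sum fun i hi => ?_
  have h1 := hG.row_le i (mem_range.1 hi)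
  have h2 := h.up_pos i
  have h3 := h.um_pos i
  refine (le_abs_self _).trans ?_
  rw [abs_mul, mul_comm]
  refine mul_le_mul h1 ?_ (abs_nonneg _) ((abs_nonneg _).trans h1)
  exact abs_le.2 ⟨by linarith, by linarith⟩

theorem Inv.abs_grad_le {σ : Game.State} (h : G.Inv σ) (hG : G.Valid) (j : ℕ) :
    |G.grad σ j| ≤ G.total σ := by
  have : |G.grad σ j| ≤ ∑ i ∈ range G.m, (σ.up i + σ.um i) := by
    refine (abs_sum_le_sum_abs _ _).trans (sum_le_sum fun i _ => ?_)
    have h2 := h.up_pos i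
    have h3 := h.um_pos i
    rw [abs_mul]
    refine (mul_le_of_le_one_right (abs_nonneg _) (hG.a_le i j)).trans ?_
    exact abs_le.2 ⟨by linarith, by linarith⟩
  have := h.w0_pos
  unfold total
  linarith

theorem sum_mul_update {f : ℕ → ℝ} {z : ℕ → ℝ} {N j : ℕ} (hj : j < N) (x : ℝ) :
    ∑ l ∈ range N, f l * Function.update z j (z j + x) l = ∑ l ∈ range N, f l * z l + f j * x := by
  have : ∀ l, f l * Function.update z j (z j + x) l = f l * z l + if l = j then f l * x else 0 := by
    intro l
    by_cases h : l = j
    · subst h; simp; ring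
    · simp [h]
  simp only [this, sum_add_distrib, sum_ite_eq', mem_range, hj, if_true]

theorem total_step (σ : Game.State) (j : ℕ) : G.total (G.step σ j) =
    G.total σ + G.η * (G.sgn σ j * G.grad σ j + G.ρ * σ.w0) := by
  have : ∑ i ∈ range G.m, (σ.up i * (1 + G.η * G.sgn σ j * G.a i j) +
      σ.um i * (1 - G.η * G.sgn σ j * G.a i j)) = ∑ i ∈ range G.m, (σ.up i + σ.um i) +
      G.η * (G.sgn σ j * G.grad σ j) := by
    simp only [grad, mul_sum, ← sum_add_distrib]
    exact sum_congr rfl fun i _ => by ring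
  simp only [total, step, this]
  ring

theorem inv_init : G.Inv Game.init where
  up_ge i := by simp [init, rowSum]
  um_ge i := by simp [init, rowSum]
  w0_ge := by simp [init]
  total_le := by simp [init, total, two_mul]; linarith
  zs_le j := by simp [init]

/-- The lower bounds follow from `exp (u - η ^ 2) ≤ 1 + u` for `|u| ≤ η`. For the upper bound the
total grows by a factor `1 + η * g ≤ exp (η * g)`, and `lam * g` is compared with the growth of the
exponent. -/
theorem Inv.step {σ : Game.State} (h : G.Inv σ) (hG : G.Valid) {j : ℕ} (hj : j < G.N) :
    G.Inv (G.step σ j) := by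
  have hN : (0 : ℝ) < G.N := by exact_mod_cast hG.N_pos
  have hrow : ∀ i, G.rowSum (G.step σ j) i = G.rowSum σ i + G.a i j * G.sgn σ j := fun i =>
    sum_mul_update hj _
  have hu : ∀ i, |G.η * G.sgn σ j * G.a i j| ≤ G.η := fun i => by
    rw [abs_mul, abs_mul, abs_sgn, mul_one, abs_of_pos hG.η_pos]
    exact mul_le_of_le_one_right hG.η_pos.le (hG.a_le i j)
  have key : ∀ u, |u| ≤ G.η → Real.exp (u - G.η ^ 2) ≤ 1 + u := fun u hu => by
    refine le_trans (Real.exp_le_exp.2 ?_) (Real.exp_sub_sq_le_one_add (hu.trans hG.η_le))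
    have := sq_le_sq' (abs_le.1 hu).1 (abs_le.1 hu).2
    linarith
  have htime : ((G.step σ j).time : ℝ) = σ.time + 1 := by simp [Game.step]
  refine ⟨fun i => ?_, fun i => ?_, ?_, ?_, fun l => ?_⟩
  · rw [hrow, htime]
    refine le_trans (le_of_eq ?_) (mul_le_mul (h.up_ge i) (key _ (hu i)) (Real.exp_pos _).le
      (h.up_pos i).le)
    rw [← Real.exp_add]
    congr 1; ring
  · rw [hrow, htime]
    refine le_trans (le_of_eq ?_) ((mul_le_mul (h.um_ge i) (key (-(G.η * G.sgn σ j * G.a i j))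
      (by rw [abs_neg]; exact hu i)) (Real.exp_pos _).le (h.um_pos i).le).trans_eq ?_)
    · rw [← Real.exp_add]
      congr 1; ring
    · simp [Game.step, sub_eq_add_neg]
  · rw [htime]
    refine le_trans (le_of_eq ?_) (mul_le_mul h.w0_ge (key (G.η * G.ρ) ?_) (Real.exp_pos _).le
      h.w0_pos.le)
    · rw [← Real.exp_add]
      congr 1; ring
    · rw [abs_of_nonneg (mul_nonneg hG.η_pos.le hG.ρ_nonneg)]
      exact mul_le_of_le_one_right hG.η_pos.le hG.ρ_le
  · have hW := h.total_pos
    set W := G.total σ with hWdef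
    have hz : ∑ l ∈ range G.N, G.v l * (G.step σ j).zs l =
        ∑ l ∈ range G.N, G.v l * σ.zs l + G.v j * G.sgn σ j := sum_mul_update hj _
    have hX : (G.step σ j).X =
        σ.X + (G.drift σ j - (∑ l ∈ range G.N, G.drift σ l) / G.N) := rfl
    have hdrift : ∑ l ∈ range G.N, G.drift σ l = ∑ l ∈ range G.N, G.v l * G.y l -
        G.lam / W * ∑ l ∈ range G.N, G.grad σ l * G.y l := by
      rw [mul_sum, ← sum_sub_distrib]
      exact sum_congr rfl fun l _ => by rw [drift]; ring
    have h1 := h.sum_grad_le hG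
    have h2 := h.drift_le hG j
    rw [← hWdef] at h1 h2
    rw [hz, hX, htime, total_step, ← hWdef]
    -- The best response is at least the drift, and the mean drift is at least the value of `y` per
    -- column minus `lam * ρ * (1 - w0 / W)`. The gain of the constant strategy supplies the missing
    -- `w0` term.
    have h3 : G.lam * ((G.sgn σ j * G.grad σ j + G.ρ * σ.w0) / W) ≤
        G.v j * G.sgn σ j - (G.drift σ j - (∑ l ∈ range G.N, G.drift σ l) / G.N) -
          ((∑ l ∈ range G.N, G.v l * G.y l) / G.N - G.lam * G.ρ) := by
      have h4 : G.lam / W * (∑ l ∈ range G.N, G.grad σ l * G.y l) / G.N ≤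
          G.lam * G.ρ - G.lam * G.ρ * σ.w0 / W := by
        rw [div_le_iff₀ hN]
        refine (mul_le_mul_of_nonneg_left h1 (div_pos hG.lam_pos hW).le).trans_eq ?_
        field_simp
      rw [hdrift, sub_div]
      have h5 : G.lam * ((G.sgn σ j * G.grad σ j + G.ρ * σ.w0) / W) =
          G.lam * G.grad σ j / W * G.sgn σ j + G.lam * G.ρ * σ.w0 / W := by ring
      rw [h5]
      linarith
    set g := (G.sgn σ j * G.grad σ j + G.ρ * σ.w0) / W with hg
    have h6 : W + G.η * (G.sgn σ j * G.grad σ j + G.ρ * σ.w0) = W * (1 + G.η * g) := by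
      rw [hg]; field_simp
    rw [h6]
    have h7 : 1 + G.η * g ≤ Real.exp (G.η * g) := by
      have := Real.add_one_le_exp (G.η * g); linarith
    have h8 : G.η * g ≤ G.η / G.lam * (G.v j * G.sgn σ j -
        (G.drift σ j - (∑ l ∈ range G.N, G.drift σ l) / G.N) -
          ((∑ l ∈ range G.N, G.v l * G.y l) / G.N - G.lam * G.ρ)) := by
      have : G.η * g = G.η / G.lam * (G.lam * g) := by
        have := hG.lam_pos.ne'
        field_simp
      rw [this]
      exact mul_le_mul_of_nonneg_left h3 (div_pos hG.η_pos hG.lam_pos).le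
    refine (mul_le_mul_of_nonneg_left (h7.trans (Real.exp_le_exp.2 h8)) hW.le).trans ?_
    refine (mul_le_mul_of_nonneg_right h.total_le (Real.exp_pos _).le).trans_eq ?_
    rw [mul_assoc, ← Real.exp_add]
    congr 2
    ring
  · by_cases hl : l = j
    · subst hl
      have h1 := h.zs_le l
      have h2 := abs_add_le (σ.zs l) (G.sgn σ l)
      rw [abs_sgn] at h2
      simp only [Game.step, Function.update_self, Nat.cast_add, Nat.cast_one]
      linarith
    · simpa [Game.step, hl] using h.zs_le l

/-! #### The random fluctuations -/

/-- A bound for the conditional second moment of the increments of the martingale. -/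
theorem Inv.sum_drift_sq_le {σ : Game.State} (h : G.Inv σ) (hG : G.Valid) {n : ℕ} (hn : n ≤ G.N)
    (hy : ∀ j, n ≤ j → G.y j = 0) (hv : ∑ j ∈ range n, G.v j ^ 2 ≤ 4 * n) :
    ∑ j ∈ range G.N, G.drift σ j ^ 2 ≤ (8 + 2 * G.lam ^ 2) * n := by
  have hW := h.total_pos
  -- Padded columns have no drift since `y` vanishes there.
  have e : ∑ j ∈ range G.N, G.drift σ j ^ 2 = ∑ j ∈ range n, G.drift σ j ^ 2 := by
    symm
    refine sum_subset (range_subset_range.2 hn) fun j _ hj => ?_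
    simp [drift, hy j (by simpa using hj)]
  rw [e]
  have h1 : ∀ j, G.drift σ j ^ 2 ≤ 2 * G.v j ^ 2 + 2 * G.lam ^ 2 := fun j => by
    have h2 : (G.grad σ j / G.total σ) ^ 2 ≤ 1 := by
      rw [sq_le_one_iff_abs_le_one, abs_div, abs_of_pos hW, div_le_one hW]
      exact h.abs_grad_le hG j
    have h3 : G.y j ^ 2 ≤ 1 := (sq_le_one_iff_abs_le_one _).2 (hG.y_le j)
    rw [drift, mul_pow, mul_div_assoc]
    set c := G.grad σ j / G.total σ
    refine (mul_le_of_le_one_right (sq_nonneg _) h3).trans ?_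
    nlinarith [sq_nonneg (G.v j + G.lam * c), mul_nonneg (sq_nonneg G.lam) (sub_nonneg.2 h2)]
  refine (sum_le_sum fun j _ => h1 j).trans ?_
  rw [sum_add_distrib, ← mul_sum]
  simp only [sum_const, card_range, nsmul_eq_mul]
  nlinarith

variable (G) in
-- Chebyshev's bound for `X` and Chernoff's bound for the counts in one function. Here `t` is the
-- number of steps still to come: each adds at most `V` to the mean of `X ^ 2` and multiplies the
-- mean of the exponential sum by `1 + (b - 1) / N`.
noncomputable def potential (V θ b Θ : ℝ) (t : ℕ) (σ : Game.State) : ℝ :=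
  (σ.X ^ 2 + t * V) / θ ^ 2 + (∑ j ∈ range G.N, b ^ σ.cnt j) * (1 + (b - 1) / G.N) ^ t / Θ

/-- The cross term vanishes by centering, and a variance is at most the second moment. -/
theorem sum_sq_add_centered_le (N : ℕ) (hN : 0 < N) (d : ℕ → ℝ) (x : ℝ) :
    ∑ j ∈ range N, (x + (d j - (∑ l ∈ range N, d l) / N)) ^ 2 ≤
      N * x ^ 2 + ∑ j ∈ range N, d j ^ 2 := by
  have hN' : (0 : ℝ) < N := by exact_mod_cast hN
  set S := ∑ l ∈ range N, d l with hS
  have e : ∑ j ∈ range N, (x + (d j - S / N)) ^ 2 =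
      N * (x - S / N) ^ 2 + 2 * (x - S / N) * S + ∑ j ∈ range N, d j ^ 2 := by
    have : ∀ j, (x + (d j - S / N)) ^ 2 = (x - S / N) ^ 2 + 2 * (x - S / N) * d j + d j ^ 2 :=
      fun j => by ring
    simp only [this, sum_add_distrib, sum_const, card_range, nsmul_eq_mul, ← mul_sum, ← hS]
  have e2 : (N : ℝ) * (x - S / N) ^ 2 + 2 * (x - S / N) * S = N * x ^ 2 - S ^ 2 / N := by
    field_simp; ring
  have : 0 ≤ S ^ 2 / N := by positivity
  linarith

/-- Each count is raised by exactly one of the `N` choices of `j`, which adds `b - 1` times its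
power. -/
theorem sum_sum_pow_update (N : ℕ) (b : ℝ) (c : ℕ → ℕ) :
    ∑ j ∈ range N, ∑ l ∈ range N, b ^ Function.update c j (c j + 1) l =
      (N + (b - 1)) * ∑ l ∈ range N, b ^ c l := by
  have h : ∀ j l, b ^ Function.update c j (c j + 1) l =
      b ^ c l + if l = j then (b - 1) * b ^ c l else 0 := by
    intro j l
    by_cases h : l = j
    · subst h; simp [pow_succ]; ring
    · simp [h]
  simp only [h, sum_add_distrib]
  rw [sum_const, card_range, nsmul_eq_mul, sum_comm]
  simp only [sum_ite_eq]
  rw [sum_congr rfl fun l hl => if_pos hl, ← mul_sum]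
  ring

theorem potential_step {V θ b Θ : ℝ} (hG : G.Valid) (t : ℕ)
    {σ : Game.State} (hV : ∑ j ∈ range G.N, G.drift σ j ^ 2 ≤ G.N * V) :
    (∑ j ∈ range G.N, G.potential V θ b Θ t (G.step σ j)) / G.N ≤ G.potential V θ b Θ (t + 1) σ := by
  have hN : (0 : ℝ) < G.N := by exact_mod_cast hG.N_pos
  have h1 := sum_sq_add_centered_le G.N hG.N_pos (G.drift σ) σ.X
  have h2 := sum_sum_pow_update G.N b σ.cnt
  rw [div_le_iff₀ hN]
  simp only [potential, sum_add_distrib, ← sum_div, ← sum_mul]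
  simp only [Game.step, h2, sum_const, card_range, nsmul_eq_mul]
  rw [add_mul (_ / θ ^ 2)]
  refine add_le_add (?_ : _ ≤ _) (le_of_eq ?_)
  · rw [div_mul_eq_mul_div]
    refine div_le_div_of_nonneg_right (?_ : _ ≤ (_ : ℝ)) (sq_nonneg θ)
    push_cast
    linarith
  · rw [pow_succ]
    field_simp

/-- With high probability the martingale and the numbers of samples stay small. -/
theorem fairCoins_bad_le {V θ b Θ : ℝ} (hθ : 0 < θ) (hΘ : 0 < Θ) (hb : 1 ≤ b)
    (hG : G.Valid) {q : ℕ} (hq : G.N = 2 ^ q)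
    (hV : ∀ σ, G.Inv σ → ∑ j ∈ range G.N, G.drift σ j ^ 2 ≤ G.N * V) (T : ℕ) :
    fairCoins.real {ω | θ ≤ |(runSteps q G.step T Game.init ω).X| ∨
      ∃ j < G.N, Θ ≤ b ^ (runSteps q G.step T Game.init ω).cnt j} ≤
    T * V / θ ^ 2 + G.N * (1 + (b - 1) / G.N) ^ T / Θ := by
  have hcast : (2 : ℝ) ^ q = G.N := by rw [hq]; simp
  have hb0 : 0 < b := by linarith
  have h2 : ∀ σ : Game.State, 0 ≤ (∑ j ∈ range G.N, b ^ σ.cnt j) / Θ := fun σ => by positivity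
  refine (fairCoins_runSteps_le q G.step G.Inv
    (fun σ => θ ≤ |σ.X| ∨ ∃ j < G.N, Θ ≤ b ^ σ.cnt j) (G.potential V θ b Θ)
    (fun σ j hj h => h.step hG (hq ▸ hj)) ?_ ?_ ?_ T _ inv_init).trans_eq ?_
  · intro σ _
    have := h2 σ
    simp only [potential, pow_zero, mul_one, Nat.cast_zero, zero_mul, add_zero]
    positivity
  · intro σ _ hbad
    simp only [potential, pow_zero, mul_one, Nat.cast_zero, zero_mul, add_zero]
    rcases hbad with h | ⟨j, hj, h⟩
    · have h3 : 1 ≤ σ.X ^ 2 / θ ^ 2 := by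
        rw [le_div_iff₀ (by positivity), one_mul, ← sq_abs σ.X]
        gcongr
      linarith [h2 σ]
    · have h3 : 1 ≤ (∑ j ∈ range G.N, b ^ σ.cnt j) / Θ := by
        rw [le_div_iff₀ hΘ, one_mul]
        refine h.trans (single_le_sum (f := fun j => b ^ σ.cnt j) (fun i _ => by positivity)
          (mem_range.2 hj))
      have : 0 ≤ σ.X ^ 2 / θ ^ 2 := by positivity
      linarith
  · intro t σ hσ
    rw [hcast, ← hq]
    exact potential_step hG t (hV σ hσ)
  · simp [potential, init]

/-- The invariant holds throughout. -/
theorem inv_runSteps (hG : G.Valid) {q : ℕ} (hq : G.N = 2 ^ q)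
    (hs : ∀ ω, sample q 0 ω < 2 ^ q) (T : ℕ) (ω : ℕ → Bool) :
    G.Inv (runSteps q G.step T Game.init ω) := by
  induction T with
  | zero => exact inv_init
  | succ T ih => rw [runSteps_succ]; exact ih.step hG (hq ▸ hs _)

theorem time_runSteps (q T : ℕ) (ω : ℕ → Bool) : (runSteps q G.step T Game.init ω).time = T := by
  induction T with
  | zero => rfl
  | succ T ih => rw [runSteps_succ]; simp [Game.step, ih]

theorem Inv.log_total_le {σ : Game.State} (h : G.Inv σ) : Real.log (G.total σ) ≤
    Real.log (2 * G.m + 1) + G.η / G.lam * (∑ j ∈ range G.N, G.v j * σ.zs j - σ.X -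
      σ.time * ((∑ j ∈ range G.N, G.v j * G.y j) / G.N - G.lam * G.ρ)) := by
  have h1 := Real.log_le_log h.total_pos h.total_le
  rwa [Real.log_mul (by positivity) (Real.exp_pos _).ne', Real.log_exp] at h1

/-- The regret bound. -/
theorem Inv.regret {σ : Game.State} (h : G.Inv σ) (hG : G.Valid) (M : ℝ)
    (hM : M = σ.time * G.ρ ∨ ∃ i < G.m, M = |G.rowSum σ i|) :
    σ.X + σ.time * ((∑ j ∈ range G.N, G.v j * G.y j) / G.N - G.lam * G.ρ) + G.lam * M -
      G.lam * (G.η * σ.time + Real.log (2 * G.m + 1) / G.η) ≤ ∑ j ∈ range G.N, G.v j * σ.zs j := by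
  have h1 := h.log_total_le
  -- `M` is the gain of one strategy, whose weight alone bounds the total from below; the sign of
  -- the row sum decides between `up` and `um`.
  have h2 : G.η * M - G.η ^ 2 * σ.time ≤ Real.log (G.total σ) := by
    rw [Real.le_log_iff_exp_le h.total_pos]
    rcases hM with rfl | ⟨i, hi, rfl⟩
    · refine le_trans (le_of_eq ?_) (h.w0_ge.trans h.w0_le_total)
      congr 1; ring
    · have h3 := h.up_add_um_le_total hi
      have h4 := h.up_pos i
      have h5 := h.um_pos i
      rcases abs_choice (G.rowSum σ i) with e | e <;> rw [e]
      · exact (h.up_ge i).trans (by linarith)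
      · refine le_trans (le_of_eq ?_) ((h.um_ge i).trans (by linarith : σ.um i ≤ G.total σ))
        congr 1; ring
  have hη := hG.η_pos
  have hl := hG.lam_pos
  set S := ∑ j ∈ range G.N, G.v j * σ.zs j
  set P := (∑ j ∈ range G.N, G.v j * G.y j) / G.N
  have h3 := mul_le_mul_of_nonneg_left (h2.trans h1) (div_pos hl hη).le
  have e1 : G.lam / G.η * (G.η * M - G.η ^ 2 * σ.time) = G.lam * M - G.lam * (G.η * σ.time) := by
    field_simp
  have e2 : G.lam / G.η * (Real.log (2 * G.m + 1) +
      G.η / G.lam * (S - σ.X - σ.time * (P - G.lam * G.ρ))) =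
      G.lam * (Real.log (2 * G.m + 1) / G.η) + (S - σ.X - σ.time * (P - G.lam * G.ρ)) := by
    field_simp
  rw [e1, e2] at h3
  linarith

end Game

/-! ### Computing logarithms and square roots -/

/-- A lower Riemann sum for the logarithm of `1 + K * d`. -/
noncomputable def logSum (d : ℝ) (K : ℕ) : ℝ := ∑ k ∈ range K, d / (1 + (k + 1) * d)

/-- Each increment of the logarithm on the grid lies between `d / (1 + (k + 1) * d)` and `d / (1 + k
* d)`. The differences of these bounds telescope to the stated error. -/
theorem logSum_bounds {d : ℝ} (hd : 0 ≤ d) (K : ℕ) :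
    logSum d K ≤ Real.log (1 + K * d) ∧
      Real.log (1 + K * d) ≤ logSum d K + d * (1 - 1 / (1 + K * d)) := by
  induction K with
  | zero => simp [logSum]
  | succ K ih =>
    have h0 : (0 : ℝ) < 1 + K * d := by positivity
    have h1 : (0 : ℝ) < 1 + (K + 1) * d := by positivity
    have e : logSum d (K + 1) = logSum d K + d / (1 + (K + 1) * d) := by
      rw [logSum, sum_range_succ, ← logSum]
    have hlog : Real.log (1 + (K + 1) * d) - Real.log (1 + K * d) =
        Real.log ((1 + (K + 1) * d) / (1 + K * d)) := (Real.log_div h1.ne' h0.ne').symm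
    have h2 := Real.log_le_sub_one_of_pos (div_pos h1 h0)
    have h3 := Real.one_sub_inv_le_log_of_pos (div_pos h1 h0)
    have e2 : (1 + (K + 1) * d) / (1 + K * d) - 1 = d / (1 + K * d) := by field_simp; ring
    have e3 : 1 - ((1 + (K + 1) * d) / (1 + K * d))⁻¹ = d / (1 + (K + 1) * d) := by
      field_simp; ring
    rw [e2] at h2
    rw [e3] at h3
    push_cast
    rw [e]
    have e4 : d * (1 - 1 / (1 + K * d)) = d - d / (1 + K * d) := by ring
    have e5 : d * (1 - 1 / (1 + (K + 1) * d)) = d - d / (1 + (K + 1) * d) := by ring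
    constructor
    · linarith [ih.1]
    · linarith [ih.2]

/-- Newton's iteration for the square root. -/
noncomputable def newtonSqrt (a : ℝ) : ℕ → ℝ
  | 0 => a + 1
  | k + 1 => (newtonSqrt a k + a / newtonSqrt a k) / 2

/-- From `(s + a / s) / 2 - √a = (s - √a) ^ 2 / (2 * s)` the iterates stay above the root and the
error is at least halved. Quadratic convergence is not needed. -/
theorem newtonSqrt_bounds {a : ℝ} (ha : 0 ≤ a) (k : ℕ) : 0 < newtonSqrt a k ∧
    √a ≤ newtonSqrt a k ∧ newtonSqrt a k ≤ √a + (a + 1) / 2 ^ k := by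
  have hs := Real.sq_sqrt ha
  have hs0 := Real.sqrt_nonneg a
  induction k with
  | zero =>
    refine ⟨by rw [newtonSqrt]; linarith, ?_, ?_⟩
    · rw [newtonSqrt]; nlinarith [sq_nonneg (√a - 1)]
    · simp [newtonSqrt]
  | succ k ih =>
    obtain ⟨h0, h1, h2⟩ := ih
    set s := newtonSqrt a k
    have e : newtonSqrt a (k + 1) = (s + a / s) / 2 := rfl
    have e2 : (s + a / s) / 2 - √a = (s - √a) ^ 2 / (2 * s) := by
      field_simp
      rw [sub_sq, hs]; ring
    have h3 : 0 ≤ (s - √a) ^ 2 / (2 * s) := by positivity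
    have h4 : (s - √a) ^ 2 / (2 * s) ≤ (s - √a) / 2 := by
      rw [div_le_div_iff₀ (by positivity) (by norm_num)]
      nlinarith [mul_nonneg hs0 (sub_nonneg.2 h1)]
    refine ⟨by rw [e]; positivity, by rw [e]; linarith, ?_⟩
    rw [e, pow_succ, ← div_div]
    linarith

/-- The computed approximation of `√(n * log (m / n + 2))`. -/
noncomputable def approxRadius (n m : ℕ) : ℝ :=
  let a := n * logSum ((m / n + 1) / ((64 * n * n : ℕ) : ℝ)) (64 * n * n)
  a / newtonSqrt a n

theorem sq_mul_two_le_two_pow {q : ℕ} (hq : 7 ≤ q) : q ^ 2 * 2 ≤ 2 ^ q := by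
  induction q, hq using Nat.le_induction with
  | base => norm_num
  | succ k hk ih => rw [pow_succ 2 k]; nlinarith

theorem pow_four_le_two_pow {n : ℕ} (hn : 16 ≤ n) : n ^ 4 ≤ 2 ^ n := by
  induction n, hn using Nat.le_induction with
  | base => norm_num
  | succ k hk ih =>
    have h : (k + 1) ^ 4 ≤ 2 * k ^ 4 := by
      have h1 : 16 * k ^ 3 ≤ k * k ^ 3 := Nat.mul_le_mul_right _ hk
      have h2 : 16 * k ^ 2 ≤ k * k ^ 2 := Nat.mul_le_mul_right _ hk
      have h3 : 16 * k ≤ k * k := Nat.mul_le_mul_right _ hk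
      nlinarith
    rw [pow_succ 2]
    omega

set_option maxHeartbeats 2000000 in
-- The approximation must be from below so that the output meets the true constraints. The Riemann
-- sum is a lower one, and dividing `a` by Newton's overestimate of `√a` gives an underestimate.
theorem approxRadius_bounds {n m : ℕ} (hn : 100 ≤ n) (hm : m ≤ n ^ 2) :
    approxRadius n m ≤ √(n * Real.log ((m : ℝ) / n + 2)) ∧
      (1 - 1 / (4 * n)) * √(n * Real.log ((m : ℝ) / n + 2)) ≤ approxRadius n m := by
  have hn' : (100 : ℝ) ≤ n := by exact_mod_cast hn
  have hm' : (m : ℝ) ≤ n ^ 2 := by exact_mod_cast hm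
  have hn0 : (0 : ℝ) < n := by linarith
  set K := 64 * n * n with hK
  set x : ℝ := (m : ℝ) / n + 2 with hx
  set d : ℝ := ((m : ℝ) / n + 1) / (K : ℕ) with hd
  have hK0 : (0 : ℝ) < (K : ℕ) := by rw [hK]; push_cast; positivity
  have hmn : (m : ℝ) / n ≤ n := by rw [div_le_iff₀ hn0]; linarith
  have hmn0 : 0 ≤ (m : ℝ) / n := by positivity
  have hd0 : 0 ≤ d := by positivity
  have hd1 : d ≤ 1 / (60 * n) := by
    rw [hd, hK, div_le_div_iff₀ (by push_cast; positivity) (by positivity)]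
    push_cast
    nlinarith
  have hKd : 1 + (K : ℝ) * d = x := by rw [hd, hx]; field_simp; ring
  obtain ⟨h1, h2⟩ := logSum_bounds hd0 K
  rw [hKd] at h1 h2
  set S := logSum d K with hS
  set L := Real.log x with hL
  have h2' : L ≤ S + d := by
    refine h2.trans ?_
    have : 0 ≤ d * (1 / x) := by positivity
    linarith
  have hL1 : (0.69 : ℝ) ≤ L := by
    have := Real.log_two_gt_d9
    have h3 : Real.log 2 ≤ L := Real.log_le_log (by norm_num) (by linarith)
    linarith
  have hLx : L ≤ n + 1 := by
    have := Real.log_le_sub_one_of_pos (show 0 < x by positivity)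
    linarith
  have hnd : d ≤ 1 / 6000 := hd1.trans (by
    rw [div_le_div_iff₀ (by positivity) (by norm_num)]; linarith)
  have hS0 : 0.68 ≤ S := by linarith
  set a : ℝ := n * S with ha
  have ha0 : 64 ≤ a := by nlinarith
  obtain ⟨g0, g1, g2⟩ := newtonSqrt_bounds (a := a) (by linarith) n
  have e : approxRadius n m = a / newtonSqrt a n := rfl
  have hss : √a * √a = a := Real.mul_self_sqrt (by linarith)
  have hsa : 8 ≤ √a := Real.le_sqrt_of_sq_le (by linarith)
  have hle : a / newtonSqrt a n ≤ √a := by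
    rw [div_le_iff₀ g0]
    calc a = √a * √a := hss.symm
      _ ≤ _ := by gcongr
  rw [e]
  refine ⟨hle.trans (Real.sqrt_le_sqrt (by rw [ha]; gcongr)), ?_⟩
  -- As `a ≤ n * (n + 1)`, the Newton error `(a + 1) / 2 ^ n` after `n` iterations is at most `√a /
  -- (10n)`.
  have hpow : (n : ℝ) ^ 4 ≤ 2 ^ n := by exact_mod_cast pow_four_le_two_pow (by omega)
  have g3 : (a + 1) / 2 ^ n ≤ √a * (1 / (10 * n)) := by
    have h3 : (a + 1) / 2 ^ n ≤ (n ^ 3 / 10) / n ^ 4 := by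
      refine div_le_div₀ (by positivity) ?_ (by positivity) hpow
      have : a ≤ n * (n + 1) := by rw [ha]; gcongr; linarith
      nlinarith [mul_nonneg (sub_nonneg.2 hn') (sq_nonneg (n : ℝ))]
    have h4 : ((n : ℝ) ^ 3 / 10) / n ^ 4 = 1 * (1 / (10 * n)) := by field_simp
    rw [h4] at h3
    refine h3.trans ?_
    gcongr
    linarith
  have g4 : newtonSqrt a n ≤ √a * (1 + 1 / (10 * n)) := by linarith
  have hSL : (1 - 1 / (10 * n)) * √(n * L) ≤ √a := by
    refine Real.le_sqrt_of_sq_le ?_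
    rw [mul_pow, Real.sq_sqrt (by positivity), ha]
    have hu : (0 : ℝ) ≤ 1 / (10 * n) ∧ 1 / (10 * (n : ℝ)) ≤ 1 := by
      refine ⟨by positivity, ?_⟩
      rw [div_le_one (by positivity)]; linarith
    have hdL : d ≤ 1 / (10 * n) * L := by
      refine hd1.trans ?_
      have : (1 : ℝ) / (60 * n) = 1 / (10 * n) * (1 / 6) := by field_simp; norm_num
      rw [this]
      gcongr
      linarith
    have hu2 : (1 - 1 / (10 * (n : ℝ))) ^ 2 ≤ 1 - 1 / (10 * n) := by nlinarith
    have : (1 - 1 / (10 * (n : ℝ))) ^ 2 * L ≤ S := by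
      have := mul_le_mul_of_nonneg_right hu2 (show 0 ≤ L by linarith)
      linarith
    calc (1 - 1 / (10 * (n : ℝ))) ^ 2 * (n * L) = n * ((1 - 1 / (10 * (n : ℝ))) ^ 2 * L) := by ring
      _ ≤ n * S := by gcongr
  rw [le_div_iff₀ g0]
  -- The Riemann sum loses a factor `1 - u`, and Newton's iteration puts `1 + u` into the
  -- denominator; `(1 - 2.5u)(1 + u) ≤ 1 - u` absorbs both.
  set u := 1 / (10 * (n : ℝ)) with hu
  have hu0 : 0 ≤ u := by positivity
  have e4 : 1 / (4 * (n : ℝ)) = 2.5 * u := by rw [hu]; field_simp; norm_num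
  have hu1 : u ≤ 1 / 1000 := by
    rw [hu, div_le_div_iff₀ (by positivity) (by norm_num)]; linarith
  rw [e4]
  have h5 : 0 ≤ √(n * L) := Real.sqrt_nonneg _
  calc (1 - 2.5 * u) * √(n * L) * newtonSqrt a n
      ≤ (1 - 2.5 * u) * √(n * L) * (√a * (1 + u)) := by
        gcongr
        nlinarith
    _ = ((1 - 2.5 * u) * (1 + u)) * (√(n * L) * √a) := by ring
    _ ≤ (1 - u) * (√(n * L) * √a) := by
        gcongr
        nlinarith
    _ = ((1 - u) * √(n * L)) * √a := by ring
    _ ≤ √a * √a := by gcongr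
    _ = a := hss

/-- The parameters of the algorithm and their relations. -/
structure Params (n m q : ℕ) (r : ℝ) : Prop where
  n_ge : 100 ≤ n
  m_le : m ≤ n ^ 2
  le_pow : n ≤ 2 ^ q
  pow_lt : 2 ^ q < 2 * n
  r_pos : 0 < r
  r_le : r ≤ n

/-! ### Numerical relations between the dimensions, `q` and `log n` -/

namespace Params

variable {n m q : ℕ} {r : ℝ}

theorem q_ge (h : Params n m q r) : 7 ≤ q := by
  by_contra hq
  have : 2 ^ q ≤ 2 ^ 6 := Nat.pow_le_pow_right (by norm_num) (by omega)
  have := h.le_pow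
  have := h.n_ge
  omega

theorem sq_le (h : Params n m q r) : q ^ 2 ≤ n := by
  have := sq_mul_two_le_two_pow h.q_ge
  have := h.pow_lt
  omega

theorem log_le (h : Params n m q r) : Real.log n ≤ 0.6932 * q := by
  have hn := h.n_ge
  have h1 : (n : ℝ) ≤ 2 ^ q := by exact_mod_cast h.le_pow
  have h2 := Real.log_le_log (by positivity) h1
  rw [Real.log_pow] at h2
  have := Real.log_two_lt_d9
  have hq : (0 : ℝ) ≤ q := by positivity
  nlinarith

theorem log_ge_four (h : Params n m q r) : 4 ≤ Real.log n := by
  have h1 : (2 : ℝ) ^ 6 ≤ n := by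
    have := h.n_ge
    exact_mod_cast (by omega : 2 ^ 6 ≤ n)
  have h2 := Real.log_le_log (by positivity) h1
  rw [Real.log_pow] at h2
  have := Real.log_two_gt_d9
  push_cast at h2
  linarith

theorem q_le (h : Params n m q r) : (q : ℝ) ≤ 2 * Real.log n := by
  have h0 := h.log_ge_four
  have h1 : (2 : ℝ) ^ q ≤ 2 * n := by exact_mod_cast h.pow_lt.le
  have h2 := Real.log_le_log (by positivity) h1
  have hn : (n : ℝ) ≠ 0 := by have := h.n_ge; positivity
  rw [Real.log_pow, Real.log_mul two_ne_zero hn] at h2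
  have := Real.log_two_gt_d9
  have := Real.log_two_lt_d9
  nlinarith

theorem log_rows_le (h : Params n m q r) : Real.log (2 * m + 1) ≤ 3 * q := by
  have hn : (100 : ℝ) ≤ n := by exact_mod_cast h.n_ge
  have hm : (m : ℝ) ≤ n ^ 2 := by exact_mod_cast h.m_le
  have h1 : (2 * m + 1 : ℝ) ≤ n ^ 3 := by nlinarith
  have h2 := Real.log_le_log (by positivity) h1
  rw [Real.log_pow] at h2
  have := h.log_le
  push_cast at h2
  have hq : (0 : ℝ) ≤ q := by positivity
  linarith

end Params

/-! ### The tuned game: typical runs and near-optimality -/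

namespace Game

/-- The number of steps that suffices. -/
noncomputable def horizon (q : ℕ) (r : ℝ) : ℝ :=
  12800 * (q : ℝ) ^ 5 * (2 ^ q * 2 ^ q / r ^ 2 + 2 ^ q)

/-- The game with the parameters of the algorithm. -/
structure Tuned (G : Game) (n q : ℕ) (r : ℝ) : Prop where
  params : Params n G.m q r
  N_eq : G.N = 2 ^ q
  η_eq : G.η = r / (8 * (q : ℝ) ^ 2 * G.N)
  lam_eq : G.lam = 2 * n / r
  ρ_eq : G.ρ = r / G.N
  a_le : ∀ i j, |G.a i j| ≤ 1
  y_le : ∀ j, |G.y j| ≤ 1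
  y_eq : ∀ j, n ≤ j → G.y j = 0
  v_le : ∑ j ∈ range n, G.v j ^ 2 ≤ 4 * n
  row_le : ∀ i < G.m, |∑ j ∈ range G.N, G.a i j * G.y j| ≤ r
  value_le : ∑ j ∈ range G.N, G.v j * G.y j ≤ 2 * n

namespace Tuned

variable {G : Game} {n q : ℕ} {r : ℝ}

theorem N_pos (h : G.Tuned n q r) : (0 : ℝ) < G.N := by
  rw [h.N_eq]; positivity

theorem n_le (h : G.Tuned n q r) : (n : ℝ) ≤ G.N := by
  rw [h.N_eq]; exact_mod_cast h.params.le_pow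

theorem valid (h : G.Tuned n q r) : G.Valid := by
  have hN := h.N_pos
  have hn : (100 : ℝ) ≤ n := by exact_mod_cast h.params.n_ge
  have hr := h.params.r_pos
  have hrn := h.params.r_le
  have hnN := h.n_le
  have hq : (7 : ℝ) ≤ q := by exact_mod_cast h.params.q_ge
  refine ⟨by exact_mod_cast hN, h.a_le, h.y_le, fun i hi => ?_, ?_, ?_, ?_, ?_, ?_⟩
  · rw [h.ρ_eq, mul_div_cancel₀ _ hN.ne']
    exact h.row_le i hi
  · rw [h.η_eq]; positivity
  · rw [h.η_eq, div_le_div_iff₀ (by positivity) (by norm_num)]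
    nlinarith [mul_nonneg (show (0 : ℝ) ≤ q ^ 2 - 1 by nlinarith) hN.le]
  · rw [h.lam_eq]; positivity
  · rw [h.ρ_eq]; positivity
  · rw [h.ρ_eq, div_le_one hN]; linarith

/-- The tolerance for the numbers of samples. -/
noncomputable def tol (q : ℕ) : ℝ := 1 / (4 * (q : ℝ) ^ 2)

/-- The random fluctuations are small. -/
def Typical (G : Game) (n q : ℕ) (T : ℕ) (σ : Game.State) : Prop :=
  |σ.X| ≤ n * T / (2 * (q : ℝ) ^ 2 * G.N) ∧ ∀ j < G.N, (σ.cnt j : ℝ) ≤ (1 + tol q) * (T / G.N)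

/-- The usual Chernoff computation with base `1 + δ`: the exponent `δ - (1 + δ) * log (1 + δ)` is at
most `-δ ^ 2 / 3` for `δ ≤ 1`. -/
theorem chernoff_aux {N T : ℕ} {δ : ℝ} (hN : 0 < N) (hδ : 0 < δ) (hδ1 : δ ≤ 1) :
    N * (1 + (1 + δ - 1) / N) ^ T / Real.exp ((1 + δ) * (T / N) * Real.log (1 + δ)) ≤
      N * Real.exp (-(δ ^ 2 / 3 * (T / N))) := by
  have hN' : (0 : ℝ) < N := by exact_mod_cast hN
  have h1 : (1 + (1 + δ - 1) / N) ^ T ≤ Real.exp (δ * (T / N)) := by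
    have : 1 + (1 + δ - 1) / N ≤ Real.exp (δ / N) := by
      have := Real.add_one_le_exp (δ / N)
      rw [add_sub_cancel_left]; linarith
    refine (pow_le_pow_left₀ (by rw [add_sub_cancel_left]; positivity) this T).trans_eq ?_
    rw [← Real.exp_nat_mul]
    congr 1; ring
  have h2 : δ + δ ^ 2 / 3 ≤ (1 + δ) * Real.log (1 + δ) := by
    have h3 := Real.le_log_one_add_of_nonneg hδ.le
    refine le_trans ?_ (mul_le_mul_of_nonneg_left h3 (by linarith))
    rw [mul_div_assoc', le_div_iff₀ (by linarith)]
    nlinarith [mul_pos hδ hδ]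
  rw [mul_div_assoc]
  refine mul_le_mul_of_nonneg_left ?_ hN'.le
  rw [div_le_iff₀ (Real.exp_pos _), ← Real.exp_add]
  refine h1.trans (Real.exp_le_exp.2 ?_)
  have : 0 ≤ (T : ℝ) / N := by positivity
  nlinarith [mul_le_mul_of_nonneg_right h2 this]

theorem fairCoins_not_typical_le (h : G.Tuned n q r) {T : ℕ} (hT : horizon q r ≤ T) :
    fairCoins.real {ω | ¬ Typical G n q T (runSteps q G.step T Game.init ω)} ≤ 1 / 100 := by
  have hN := h.N_pos
  have hn : (100 : ℝ) ≤ n := by exact_mod_cast h.params.n_ge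
  have hr := h.params.r_pos
  have hrn := h.params.r_le
  have hnN := h.n_le
  have hq : (7 : ℝ) ≤ q := by exact_mod_cast h.params.q_ge
  have hNq : (2 : ℝ) ^ q = G.N := by rw [h.N_eq]; simp
  rw [horizon, hNq] at hT
  have hT0 : (0 : ℝ) < T := lt_of_lt_of_le (by positivity) hT
  set δ := tol q with hδ
  have hδ0 : 0 < δ := by rw [hδ, tol]; positivity
  have hδ1 : δ ≤ 1 := by
    rw [hδ, tol, div_le_one (by positivity)]; nlinarith
  set θ : ℝ := n * T / (2 * (q : ℝ) ^ 2 * G.N) with hθ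
  have hθ0 : 0 < θ := by positivity
  set Θ : ℝ := Real.exp ((1 + δ) * (T / G.N) * Real.log (1 + δ)) with hΘ
  set V : ℝ := (8 + 2 * G.lam ^ 2) * n / G.N with hV
  have hVN : G.N * V = (8 + 2 * G.lam ^ 2) * n := by rw [hV]; field_simp
  have main := fairCoins_bad_le (G := G) (V := V) (θ := θ) (b := 1 + δ) (Θ := Θ) hθ0
    (Real.exp_pos _) (by linarith) h.valid h.N_eq (fun σ hσ => by
      rw [hVN]
      exact hσ.sum_drift_sq_le h.valid (by exact_mod_cast hnN) h.y_eq h.v_le) T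
  -- Chebyshev's part uses the summand `N ^ 2 / r ^ 2` of the horizon, because `V` is of order `lam
  -- ^ 2 * n / N` with `lam = 2n / r`.
  have h1 : T * V / θ ^ 2 ≤ 1 / 1000 := by
    have e : T * V / θ ^ 2 = 32 * (q : ℝ) ^ 4 * G.N * (r ^ 2 + n ^ 2) / (n * r ^ 2 * T) := by
      rw [hV, hθ, h.lam_eq]; field_simp; ring
    rw [e, div_le_div_iff₀ (by positivity) (by norm_num)]
    have h2 : 12800 * (q : ℝ) ^ 5 * (G.N * G.N) ≤ r ^ 2 * T := by
      have : 12800 * (q : ℝ) ^ 5 * (G.N * G.N) =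
          r ^ 2 * (12800 * (q : ℝ) ^ 5 * (G.N * G.N / r ^ 2)) := by field_simp
      rw [this]
      refine mul_le_mul_of_nonneg_left (le_trans ?_ hT) (by positivity)
      gcongr
      linarith
    calc 32 * (q : ℝ) ^ 4 * G.N * (r ^ 2 + n ^ 2) * 1000
        ≤ 32 * (q : ℝ) ^ 4 * G.N * (n ^ 2 + n ^ 2) * 1000 := by gcongr
      _ = n * (64000 * (q : ℝ) ^ 4 * (G.N * n)) := by ring
      _ ≤ n * (12800 * (q : ℝ) ^ 5 * (G.N * G.N)) := by
          refine mul_le_mul_of_nonneg_left ?_ (by linarith)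
          refine mul_le_mul ?_ (by gcongr) (by positivity) (by positivity)
          have : (q : ℝ) ^ 5 = q ^ 4 * q := by ring
          rw [this]
          nlinarith [show (0 : ℝ) < q ^ 4 by positivity]
      _ ≤ n * (r ^ 2 * T) := by gcongr
      _ = 1 * (n * r ^ 2 * T) := by ring
  -- Chernoff's part uses the summand `2 ^ q` of the horizon: each column is expected at least
  -- `12800 q ^ 5` times, so the exponent exceeds `200 q` and beats the union bound over `N ≤ exp q`
  -- columns.
  have h2 : G.N * (1 + (1 + δ - 1) / G.N) ^ T / Θ ≤ 1 / 1000 := by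
    refine (chernoff_aux h.valid.N_pos hδ0 hδ1).trans ?_
    have hTN : 12800 * (q : ℝ) ^ 5 ≤ T / G.N := by
      rw [le_div_iff₀ hN]
      refine le_trans ?_ hT
      gcongr
      exact le_add_of_nonneg_left (by positivity)
    have h3 : 200 * (q : ℝ) ≤ δ ^ 2 / 3 * (T / G.N) := by
      refine le_trans ?_ (mul_le_mul_of_nonneg_left hTN (by positivity))
      rw [hδ, tol]
      have : (1 / (4 * (q : ℝ) ^ 2)) ^ 2 / 3 * (12800 * (q : ℝ) ^ 5) = 12800 / 48 * q := by
        field_simp; norm_num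
      rw [this]
      nlinarith
    have h4 : (G.N : ℝ) ≤ Real.exp q := by
      rw [← hNq, ← Real.exp_one_pow]
      gcongr
      have := Real.add_one_le_exp (1 : ℝ)
      linarith
    calc (G.N : ℝ) * Real.exp (-(δ ^ 2 / 3 * (T / G.N)))
        ≤ Real.exp q * Real.exp (-(200 * q)) := by gcongr
      _ = (Real.exp (199 * q))⁻¹ := by rw [← Real.exp_add, ← Real.exp_neg]; congr 1; ring
      _ ≤ (1000 : ℝ)⁻¹ := by
          gcongr
          have := Real.add_one_le_exp (199 * (q : ℝ))
          linarith
      _ = 1 / 1000 := by norm_num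
  have hsub : {ω | ¬ Typical G n q T (runSteps q G.step T Game.init ω)} ⊆
      {ω | θ ≤ |(runSteps q G.step T Game.init ω).X| ∨
      ∃ j < G.N, Θ ≤ (1 + δ) ^ (runSteps q G.step T Game.init ω).cnt j} := by
    intro ω hω
    simp only [Set.mem_ofPred_eq, Typical, not_and_or, not_le, not_forall] at hω ⊢
    rcases hω with hω | ⟨j, hj, hω⟩
    · exact Or.inl hω.le
    · refine Or.inr ⟨j, hj, ?_⟩
      rw [hΘ, ← Real.exp_log (show (0 : ℝ) < (1 + δ) ^ _ by positivity), Real.log_pow]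
      refine Real.exp_le_exp.2 (mul_le_mul_of_nonneg_right hω.le ?_)
      exact Real.log_nonneg (by linarith)
  refine (measureReal_mono hsub).trans (main.trans ?_)
  linarith

/-- The guarantee for the normalized sums of the signs. -/
theorem value_ge (h : G.Tuned n q r) {T : ℕ} (hT : horizon q r ≤ T) {σ : Game.State}
    (hσ : G.Inv σ) (htime : σ.time = T) (hX : |σ.X| ≤ n * T / (2 * (q : ℝ) ^ 2 * G.N)) {s : ℝ}
    (hs1 : 1 ≤ s) (hs : s ≤ 1 + tol q ∨ ∃ i < G.m, s = G.N / T * |G.rowSum σ i| / r) :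
    ∑ j ∈ range G.N, G.v j * G.y j - 3 * n / (2 * (q : ℝ) ^ 2) ≤
      (∑ j ∈ range G.N, G.v j * (G.N / T * σ.zs j)) / s := by
  have hN := h.N_pos
  have hn : (100 : ℝ) ≤ n := by exact_mod_cast h.params.n_ge
  have hr := h.params.r_pos
  have hq : (7 : ℝ) ≤ q := by exact_mod_cast h.params.q_ge
  have hNq : (2 : ℝ) ^ q = G.N := by rw [h.N_eq]; simp
  rw [horizon, hNq] at hT
  have hT0 : (0 : ℝ) < T := lt_of_lt_of_le (by positivity) hT
  have hl := h.params.log_rows_le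
  set L := Real.log (2 * G.m + 1)
  set P := ∑ j ∈ range G.N, G.v j * G.y j with hP
  have hPn : P ≤ 2 * n := h.value_le
  have e : ∑ j ∈ range G.N, G.v j * (G.N / T * σ.zs j) =
      G.N / T * ∑ j ∈ range G.N, G.v j * σ.zs j := by
    rw [mul_sum]; exact sum_congr rfl fun j _ => by ring
  rw [e]
  set Z := ∑ j ∈ range G.N, G.v j * σ.zs j with hZ
  have hδ : tol q = 1 / (4 * (q : ℝ) ^ 2) := rfl
  -- The regret bound times `N / T`. The loss `n / q ^ 2` consists of `n / (2q ^ 2)` from `X`, `n /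
  -- (4q ^ 2)` from the learning rate and at most `n / (4q ^ 2)` from the logarithm of the number of
  -- strategies.
  have reg : ∀ M : ℝ, (M = σ.time * G.ρ ∨ ∃ i < G.m, M = |G.rowSum σ i|) →
      P - n / (q : ℝ) ^ 2 + 2 * n * (G.N / T * M / r - 1) ≤ G.N / T * Z := by
    intro M hM
    have h1 := mul_le_mul_of_nonneg_left (hσ.regret h.valid M hM) (div_pos hN hT0).le
    rw [htime] at h1
    refine le_trans ?_ h1
    have hX' : -(n / (2 * (q : ℝ) ^ 2)) ≤ G.N / T * σ.X := by
      have : -(n / (2 * (q : ℝ) ^ 2)) = G.N / T * -(n * T / (2 * (q : ℝ) ^ 2 * G.N)) := by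
        field_simp
      rw [this]
      exact mul_le_mul_of_nonneg_left (abs_le.1 hX).1 (div_pos hN hT0).le
    have hL : G.N / T * (G.lam * (L / G.η)) ≤ n / (4 * (q : ℝ) ^ 2) := by
      have e1 : G.N / T * (G.lam * (L / G.η)) =
          16 * n * (q : ℝ) ^ 2 * (G.N * G.N) * L / (r ^ 2 * T) := by
        rw [h.lam_eq, h.η_eq]; field_simp; ring
      have h2 : 12800 * (q : ℝ) ^ 5 * (G.N * G.N) ≤ r ^ 2 * T := by
        have : 12800 * (q : ℝ) ^ 5 * (G.N * G.N) =
            r ^ 2 * (12800 * (q : ℝ) ^ 5 * (G.N * G.N / r ^ 2)) := by field_simp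
        rw [this]
        refine mul_le_mul_of_nonneg_left (le_trans ?_ hT) (by positivity)
        gcongr
        linarith
      rw [e1, div_le_div_iff₀ (by positivity) (by positivity)]
      calc 16 * n * (q : ℝ) ^ 2 * (G.N * G.N) * L * (4 * (q : ℝ) ^ 2)
          ≤ 16 * n * (q : ℝ) ^ 2 * (G.N * G.N) * (3 * q) * (4 * (q : ℝ) ^ 2) := by gcongr
        _ = n * (192 * (q : ℝ) ^ 5 * (G.N * G.N)) := by ring
        _ ≤ n * (12800 * (q : ℝ) ^ 5 * (G.N * G.N)) := by gcongr; norm_num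
        _ ≤ n * (r ^ 2 * T) := by gcongr
    have e2 : G.N / T * (σ.X + T * (P / G.N - G.lam * G.ρ) + G.lam * M -
        G.lam * (G.η * T + L / G.η)) = G.N / T * σ.X + P - 2 * n + 2 * n * (G.N / T * M / r) -
        n / (4 * (q : ℝ) ^ 2) - G.N / T * (G.lam * (L / G.η)) := by
      have e3 : G.N / T * (G.lam * (G.η * T)) = n / (4 * (q : ℝ) ^ 2) := by
        rw [h.lam_eq, h.η_eq]; field_simp; norm_num
      have e4 : G.N / T * (T * (P / G.N - G.lam * G.ρ)) = P - 2 * n := by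
        rw [h.lam_eq, h.ρ_eq]; field_simp
      have e5 : G.N / T * (G.lam * M) = 2 * n * (G.N / T * M / r) := by
        rw [h.lam_eq]; ring
      rw [← e3, ← e5]
      linear_combination e4
    rw [e2]
    have e6 : (n : ℝ) / q ^ 2 = n / (2 * (q : ℝ) ^ 2) + n / (4 * (q : ℝ) ^ 2) +
        n / (4 * (q : ℝ) ^ 2) := by field_simp; norm_num
    rw [e6]
    linarith
  have e7 : 3 * (n : ℝ) / (2 * (q : ℝ) ^ 2) = n / (q : ℝ) ^ 2 + 2 * n * tol q := by
    rw [hδ]; field_simp; norm_num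
  have hδ0 : 0 < tol q := by rw [hδ]; positivity
  have hnq : 0 < (n : ℝ) / (q : ℝ) ^ 2 := by positivity
  have hnδ : 0 < 2 * n * tol q := by positivity
  -- If `s ≤ 1 + tol`, the constant strategy is used, whose relative gain is 1, and `2 * n * tol` is
  -- given away. If `s` comes from a row, that row is used and yields the bonus `2 * n * (s - 1)`
  -- itself.
  have key : P - 3 * n / (2 * (q : ℝ) ^ 2) + 2 * n * (s - 1) ≤ G.N / T * Z := by
    rw [e7]
    rcases hs with hs | ⟨i, hi, hs⟩
    · have h1 := reg (σ.time * G.ρ) (Or.inl rfl)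
      have e8 : G.N / T * (σ.time * G.ρ) / r = 1 := by
        rw [htime, h.ρ_eq]; field_simp
      rw [e8] at h1
      nlinarith
    · have h1 := reg _ (Or.inr ⟨i, hi, rfl⟩)
      rw [← hs] at h1
      linarith
  -- Undoing the division by `s` costs `s - 1` times the left side, which is at most `2 * n`; the
  -- bonus pays for it.
  rw [le_div_iff₀ (by linarith)]
  refine le_trans ?_ key
  nlinarith [mul_nonneg (sub_nonneg.2 hs1)
    (show 0 ≤ 2 * (n : ℝ) - (P - 3 * n / (2 * (q : ℝ) ^ 2)) by rw [e7]; linarith)]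

end Tuned

end Game

/-! ### Compressed sparse columns -/

namespace DiscrepancyLP

/-- The arrays `ptr`, `row` and `val` hold the columns of `a`; column `j < n` has its nonzero entries
in the rows `col j`. -/
structure IsCSC (m n k : ℕ) (a : ℕ → ℕ → ℝ) (col : ℕ → List ℕ) (ptr row : ℕ → ℕ) (val : ℕ → ℝ) :
    Prop where
  nodup : ∀ j, (col j).Nodup
  lt : ∀ j, ∀ i ∈ col j, i < m
  eq_zero : ∀ i j, i ∉ col j → a i j = 0
  length_le : ∀ j, (col j).length ≤ k
  ptr_le : ∀ j, ptr j ≤ n * m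
  ptr_succ : ∀ j < n, ptr (j + 1) = ptr j + (col j).length
  row_eq : ∀ j < n, ∀ l (h : l < (col j).length), row (ptr j + l) = (col j)[l]
  val_eq : ∀ j < n, ∀ l (h : l < (col j).length), val (ptr j + l) = a (col j)[l] j

/-- Sums over a column. -/
theorem IsCSC.sum_col {m n k : ℕ} {a : ℕ → ℕ → ℝ} {col : ℕ → List ℕ} {ptr row : ℕ → ℕ}
    {val : ℕ → ℝ} (h : IsCSC m n k a col ptr row val) (f : ℕ → ℝ) (j : ℕ) :
    ((col j).map fun i => f i * a i j).sum = ∑ i ∈ range m, f i * a i j := by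
  rw [← List.sum_toFinset _ (h.nodup j)]
  refine sum_subset (fun i hi => mem_range.2 (h.lt j i (by simpa using hi))) fun i _ hi => ?_
  rw [h.eq_zero i j (by simpa using hi), mul_zero]

/-- Extension of a matrix by zeros. -/
def padMatrix {m n : ℕ} (A : Matrix (Fin m) (Fin n) ℝ) (i j : ℕ) : ℝ :=
  if h : i < m ∧ j < n then A ⟨i, h.1⟩ ⟨j, h.2⟩ else 0

/-- Extension of a vector by zeros. -/
def padVec {n : ℕ} (v : Fin n → ℝ) (j : ℕ) : ℝ := if h : j < n then v ⟨j, h⟩ else 0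

open Classical in
noncomputable def colFin {m n : ℕ} (A : Matrix (Fin m) (Fin n) ℝ) (j : Fin n) : List (Fin m) :=
  (List.finRange m).filter fun i => A i j ≠ 0

noncomputable def colRows {m n : ℕ} (A : Matrix (Fin m) (Fin n) ℝ) (j : ℕ) : List ℕ :=
  if h : j < n then (colFin A ⟨j, h⟩).map Fin.val else []

variable {m n : ℕ} (A : Matrix (Fin m) (Fin n) ℝ)

/-- The nonzero positions in the columns before `j`. -/
noncomputable def nonzerosBefore (j : ℕ) : List (Fin m × Fin n) :=
  ((List.finRange n).take j).flatMap fun j => (colFin A j).map fun i => (i, j)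

theorem nonzeros_eq : nonzeros A =
    (List.finRange n).flatMap fun j => (colFin A j).map fun i => (i, j) := rfl

/-- The list is ordered by columns, so the entries counted by a pointer form a prefix, and the
pointer is the position where column `j` starts. -/
theorem countP_nonzeros (j : ℕ) :
    (nonzeros A).countP (fun e => (e.2 : ℕ) < j) = (nonzerosBefore A j).length := by
  rw [nonzeros_eq, ← List.take_append_drop j (List.finRange n), List.flatMap_append,
    List.countP_append, ← nonzerosBefore]
  have h1 : (nonzerosBefore A j).countP (fun e => (e.2 : ℕ) < j) = (nonzerosBefore A j).length := by
    rw [List.countP_eq_length]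
    intro e he
    simp only [nonzerosBefore, List.mem_flatMap, List.mem_map] at he
    obtain ⟨j', hj', i, _, rfl⟩ := he
    obtain ⟨l, hl, rfl⟩ := List.mem_take_iff_getElem.1 hj'
    simp only [List.getElem_finRange, decide_eq_true_eq]
    simp only [lt_min_iff] at hl
    simpa using hl.1
  rw [h1, List.countP_eq_zero.2, add_zero]
  intro e he
  simp only [List.mem_flatMap, List.mem_map] at he
  obtain ⟨j', hj', i, _, rfl⟩ := he
  obtain ⟨l, hl, rfl⟩ := List.mem_drop_iff_getElem.1 hj'
  simp

theorem nonzerosBefore_succ {j : ℕ} (hj : j < n) : nonzerosBefore A (j + 1) =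
    nonzerosBefore A j ++ (colFin A ⟨j, hj⟩).map fun i => (i, ⟨j, hj⟩) := by
  rw [nonzerosBefore, List.take_succ_eq_append_getElem (by simpa using hj), List.flatMap_append,
    ← nonzerosBefore]
  simp

theorem nonzeros_eq_append {j : ℕ} (hj : j < n) : ∃ l, nonzeros A =
    nonzerosBefore A j ++ ((colFin A ⟨j, hj⟩).map fun i => (i, ⟨j, hj⟩)) ++ l := by
  refine ⟨((List.finRange n).drop (j + 1)).flatMap fun j => (colFin A j).map fun i => (i, j), ?_⟩
  rw [← nonzerosBefore_succ, nonzerosBefore, ← List.flatMap_append, List.take_append_drop,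
    nonzeros_eq]

theorem getElem?_nonzeros {j : ℕ} (hj : j < n) {l : ℕ} (hl : l < (colFin A ⟨j, hj⟩).length) :
    (nonzeros A)[(nonzerosBefore A j).length + l]? = some ((colFin A ⟨j, hj⟩)[l], ⟨j, hj⟩) := by
  obtain ⟨t, ht⟩ := nonzeros_eq_append A hj
  rw [ht, List.append_assoc, List.getElem?_append_right (by omega), Nat.add_sub_cancel_left,
    List.getElem?_append_left (by simpa using hl)]
  simp [hl]

theorem length_colFin_le (j : Fin n) : (colFin A j).length ≤ m := by
  refine (List.length_filter_le _ _).trans ?_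
  simp

theorem length_nonzerosBefore_le (j : ℕ) : (nonzerosBefore A j).length ≤ n * m := by
  have h : ∀ l : List (Fin n),
      (l.flatMap fun j => (colFin A j).map fun i => (i, j)).length ≤ l.length * m := by
    intro l
    induction l with
    | nil => simp
    | cons j l ih =>
      rw [List.flatMap_cons, List.length_append, List.length_map, List.length_cons, add_mul, one_mul]
      have := length_colFin_le A j
      omega
  refine (h _).trans (Nat.mul_le_mul_right _ ?_)
  simp

theorem nodup_colFin (j : Fin n) : (colFin A j).Nodup := (List.nodup_finRange m).filter _

theorem length_colFin (j : Fin n) : (colFin A j).length = {i | A i j ≠ 0}.ncard := by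
  classical
  rw [← List.toFinset_card_of_nodup (nodup_colFin A j), ← Set.ncard_coe_finset]
  congr 1
  ext i
  simp [colFin]

theorem isCSC_input {k : ℕ} (hk : ∀ j, {i | A i j ≠ 0}.ncard ≤ k) (v : Fin n → ℝ) (C : ℝ)
    (ω : ℕ → Bool) : IsCSC m n k (padMatrix A) (colRows A) ((input A v C ω).wm 0)
      ((input A v C ω).wm 1) ((input A v C ω).xm 0) := by
  have hptr : ∀ j, (input A v C ω).wm 0 j = (nonzerosBefore A j).length := fun j => by
    simp [input, countP_nonzeros]
  have hrow : ∀ p, (input A v C ω).wm 1 p = ((nonzeros A)[p]?).elim 0 fun e => (e.1 : ℕ) :=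
    fun p => by simp [input]
  have hval : ∀ p, (input A v C ω).xm 0 p = ((nonzeros A)[p]?).elim 0 fun e => A e.1 e.2 :=
    fun p => by simp [input]
  refine ⟨fun j => ?_, fun j i hi => ?_, fun i j hi => ?_, fun j => ?_, fun j => ?_,
    fun j hj => ?_, fun j hj l hl => ?_, fun j hj l hl => ?_⟩
  · unfold colRows
    split_ifs
    · exact (nodup_colFin A _).map Fin.val_injective
    · exact List.nodup_nil
  · unfold colRows at hi
    split_ifs at hi
    · obtain ⟨i', _, rfl⟩ := List.mem_map.1 hi
      exact i'.2
    · simp at hi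
  · unfold padMatrix
    split_ifs with h
    · by_contra h0
      refine hi ?_
      rw [colRows, dif_pos h.2]
      exact List.mem_map.2 ⟨⟨i, h.1⟩, by simpa [colFin] using h0, rfl⟩
    · rfl
  · unfold colRows
    split_ifs
    · rw [List.length_map, length_colFin]; exact hk _
    · simp
  · rw [hptr]; exact length_nonzerosBefore_le A j
  · rw [hptr, hptr, nonzerosBefore_succ A hj, colRows, dif_pos hj]
    simp
  · have hl' : l < (colFin A ⟨j, hj⟩).length := by simpa [colRows, hj] using hl
    rw [hrow, hptr, getElem?_nonzeros A hj hl']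
    simp [colRows, hj]
  · have hl' : l < (colFin A ⟨j, hj⟩).length := by simpa [colRows, hj] using hl
    rw [hval, hptr, getElem?_nonzeros A hj hl']
    simp [colRows, hj, padMatrix]

end DiscrepancyLP

/-! ### The program -/

namespace RealRAM

attribute [simp] wp Arith.onWord Arith.onReal Test.Holds

/-- Loop over a counter `i` that the body increases by one. -/
theorem Runs.for_loop {B : ℕ} {p : Prog} {T : ℕ} {i j : ℕ} {start n : ℕ} (I : ℕ → State → Prop)
    (hi : ∀ k s, I k s → s.w i = start + k) (hj : ∀ k s, I k s → s.w j = start + n)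
    (hstep : ∀ k < n, ∀ s, I k s → Runs B p s T (I (k + 1))) {s : State} (h0 : I 0 s) :
    Runs B (.loop (.wlt i j) p) s (n * (T + 1) + 1) (I n) := by
  refine Runs.loop n I (fun k hk s hs => ⟨?_, hstep k hk s hs⟩) (fun s hs => ?_) h0
  · simp only [Test.Holds, hi k s hs, hj k s hs]; omega
  · simp [hi n s hs, hj n s hs]

end RealRAM

namespace DiscrepancyLP

/-! #### Setting up the parameters -/

/-- Word register 4 gets the least power of two that is at least `n`, register 5 its exponent. -/
def powProg : Prog :=
  .seq (block [.wconst 3 1, .wconst 4 1])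
    (.loop (.wlt 4 1) (block [.wop .add 4 4 4, .wop .add 5 5 3]))

theorem powProg_spec {B n q : ℕ} {s : State} (hn : s.w 1 = n) (h5 : s.w 5 = 0) (hq : n ≤ 2 ^ q)
    (hq' : 2 ^ q < 2 * n) (hB : 2 * n ≤ B) (hn2 : 2 ≤ n) :
    Runs B powProg s (5 * q + 5) fun s' => Frame [3, 4, 5] [] [] s s' ∧
      s'.w 3 = 1 ∧ s'.w 4 = 2 ^ q ∧ s'.w 5 = q := by
  refine Runs.mono (T := 3 + (q * (3 + 1) + 1)) (Runs.seq (Q := fun s' => Frame [3, 4, 5] [] [] s s' ∧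
      s'.w 3 = 1 ∧ s'.w 4 = 2 ^ 0 ∧ s'.w 5 = 0) (Runs.block ?_) fun s' hs' => ?_) (by omega)
      (fun _ => id)
  · refine ⟨by omega, by omega, (Frame.refl.setW (by decide)).setW (by decide), ?_⟩
    simp [h5]
  · refine Runs.loop q (fun k s' => Frame [3, 4, 5] [] [] s s' ∧
      s'.w 3 = 1 ∧ s'.w 4 = 2 ^ k ∧ s'.w 5 = k) ?_ ?_ hs'
    · rintro k hk s₁ ⟨hF, h3, h4, h5⟩
      have h1 : s₁.w 1 = n := by rw [hF.w 1 (by decide), hn]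
      -- From `2 ^ (k + 1) ≤ 2 ^ q < 2 * n` follows `2 ^ k < n`, so the loop does not stop before
      -- `q`.
      have hlt : 2 ^ (k + 1) ≤ 2 ^ q := Nat.pow_le_pow_right (by norm_num) hk
      have hkq : k < 2 ^ k := Nat.lt_two_pow_self
      rw [pow_succ] at hlt
      refine ⟨by simp only [Test.Holds, h4, h1]; omega, Runs.block ?_⟩
      simp only [wp, Arith.onWord, State.setW_w, h4, h3, h5, if_true, if_false,
        show (5 : ℕ) ≠ 4 by decide, show (3 : ℕ) ≠ 4 by decide]
      refine ⟨by omega, by omega, (hF.setW (by decide)).setW (by decide), ?_⟩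
      simp [pow_succ, mul_two]
    · rintro s₁ ⟨hF, h3, h4, h5⟩
      have h1 : s₁.w 1 = n := by rw [hF.w 1 (by decide), hn]
      simp only [Test.Holds, h4, h1]; omega

/-- Real register 18 gets a Riemann sum for `log (m / n + 2)`. -/
def logProg : Prog :=
  .seq (block [.xcast 1 3, .xcast 3 4, .xcast 4 5, .xcast 5 1, .wconst 12 64, .wop .mul 12 12 1,
      .wop .mul 12 12 1, .xcast 16 0, .xop .div 16 16 5, .xop .add 16 16 1, .xcast 17 12,
      .xop .div 16 16 17, .xop .add 17 1 2, .xop .sub 18 2 2, .wconst 6 0])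
    (.loop (.wlt 6 12)
      (block [.xop .add 17 17 16, .xop .div 19 16 17, .xop .add 18 18 19, .wop .add 6 6 3]))

theorem logProg_spec {B m n q : ℕ} {s : State} (h0 : s.w 0 = m) (h1 : s.w 1 = n) (h3 : s.w 3 = 1)
    (h4 : s.w 4 = 2 ^ q) (h5 : s.w 5 = q) (hx2 : s.x 2 = 0) (hB : 64 * n * n < B) (hn : 0 < n) :
    Runs B logProg s (6 * (64 * n * n) + 17) fun s' =>
      Frame [6, 12] [1, 3, 4, 5, 16, 17, 18, 19] [] s s' ∧ s'.x 1 = 1 ∧ s'.x 3 = 2 ^ q ∧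
      s'.x 4 = q ∧ s'.x 5 = n ∧
      s'.x 18 = logSum (((m : ℝ) / n + 1) / ((64 * n * n : ℕ) : ℝ)) (64 * n * n) := by
  set d := ((m : ℝ) / n + 1) / ((64 * n * n : ℕ) : ℝ) with hd
  set I : ℕ → State → Prop := fun k s' => Frame [6, 12] [1, 3, 4, 5, 16, 17, 18, 19] [] s s' ∧
    s'.x 1 = 1 ∧ s'.x 3 = 2 ^ q ∧ s'.x 4 = q ∧ s'.x 5 = n ∧ s'.w 12 = 64 * n * n ∧ s'.w 6 = k ∧
    s'.x 16 = d ∧ s'.x 17 = 1 + k * d ∧ s'.x 18 = logSum d k with hI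
  refine Runs.mono (T := 16 + ((64 * n * n) * (5 + 1) + 1)) (Runs.seq (Q := I 0) (Runs.block ?_)
    fun s' hs' => Runs.for_loop (start := 0) (n := 64 * n * n) I ?_ ?_ ?_ hs') (by omega) ?_
  · have : 64 * n ≤ 64 * n * n := Nat.le_mul_of_pos_right _ hn
    simp [h0, h1, h3, h4, h5, hx2, hI, logSum, hd]
    refine ⟨by omega, by omega, by omega, by omega, ?_⟩
    repeat (first | exact Frame.refl | refine Frame.setW ?_ (by decide) |
      refine Frame.setReal ?_ (by decide))
  · intro k s' hs'
    simp only [hI] at hs'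
    simp [hs']
  · intro k s' hs'
    simp only [hI] at hs'
    simp [hs']
  · rintro k hk s₁ ⟨hF, g1, g3, g4, g5, g12, g6, g16, g17, g18⟩
    have hw3 : s₁.w 3 = 1 := by rw [hF.w 3 (by decide), h3]
    refine Runs.block ?_
    simp [hw3, g1, g3, g4, g5, g12, g6, g16, g17, g18, hI]
    refine ⟨by omega, ?_, by ring, ?_⟩
    · repeat (first | exact hF | refine Frame.setW ?_ (by decide) |
        refine Frame.setReal ?_ (by decide))
    · rw [logSum, logSum, sum_range_succ]
      congr 2; ring
  · rintro s' ⟨hF, g1, g3, g4, g5, g12, g6, g16, g17, g18⟩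
    exact ⟨hF, g1, g3, g4, g5, g18⟩

/-- Real registers 18 and 19 get the number whose square root is wanted and its approximation. -/
def newtonProg : Prog :=
  .seq (block [.xop .mul 18 5 18, .xop .add 19 18 1, .wconst 6 0, .xop .add 20 1 1])
    (.loop (.wlt 6 1) (block [.xop .div 17 18 19, .xop .add 19 19 17, .xop .div 19 19 20,
      .wop .add 6 6 3]))

theorem newtonProg_spec {B n : ℕ} {s : State} (h1 : s.w 1 = n) (h3 : s.w 3 = 1) (hx1 : s.x 1 = 1)
    (hB : n < B) :
    Runs B newtonProg s (6 * n + 6) fun s' => Frame [6] [17, 18, 19, 20] [] s s' ∧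
      s'.x 18 = s.x 5 * s.x 18 ∧ s'.x 19 = newtonSqrt (s.x 5 * s.x 18) n := by
  set a := s.x 5 * s.x 18 with ha
  set I : ℕ → State → Prop := fun k s' => Frame [6] [17, 18, 19, 20] [] s s' ∧
    s'.w 6 = k ∧ s'.x 18 = a ∧ s'.x 19 = newtonSqrt a k ∧ s'.x 20 = 2 with hI
  refine Runs.mono (T := 5 + (n * (5 + 1) + 1)) (Runs.seq (Q := I 0) (Runs.block ?_)
    fun s' hs' => Runs.for_loop (start := 0) (n := n) I ?_ ?_ ?_ hs') (by omega) ?_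
  · simp [hI, newtonSqrt, hx1, ha, one_add_one_eq_two]
    refine ⟨by omega, ?_⟩
    repeat (first | exact Frame.refl | refine Frame.setW ?_ (by decide) |
      refine Frame.setReal ?_ (by decide))
  · intro k s' hs'
    simp only [hI] at hs'
    simp [hs']
  · rintro k s' ⟨hF, -⟩
    rw [hF.w 1 (by decide), h1, zero_add]
  · rintro k hk s₁ ⟨hF, g6, g18, g19, g20⟩
    have hw3 : s₁.w 3 = 1 := by rw [hF.w 3 (by decide), h3]
    refine Runs.block ?_
    simp [hw3, g6, g18, g19, g20, hI, newtonSqrt]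
    refine ⟨by omega, ?_⟩
    repeat (first | exact hF | refine Frame.setW ?_ (by decide) |
      refine Frame.setReal ?_ (by decide))
  · rintro s' ⟨hF, g6, g18, g19, g20⟩
    exact ⟨hF, g18, g19⟩

/-- The radius, the multiplier, the learning rate, the horizon and the initial weights. -/
def paramProg : Prog :=
  block [.xop .div 6 18 19, .xop .mul 6 0 6, .xop .add 7 5 5, .xop .div 7 7 6, .xop .div 21 6 3,
    .xop .mul 16 4 4, .xop .mul 17 16 3, .wconst 6 8, .xcast 18 6, .xop .mul 17 18 17,
    .xop .div 8 6 17, .xop .mul 17 3 3, .xop .mul 18 6 6, .xop .div 17 17 18, .xop .add 17 17 3,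
    .xop .mul 16 16 16, .xop .mul 16 16 4, .wconst 6 12800, .xcast 18 6, .xop .mul 16 18 16,
    .xop .mul 9 16 17, .xop .sub 10 2 2, .xop .add 12 1 2, .xcast 16 0, .xop .add 16 16 16,
    .xop .add 11 16 1, .wconst 6 0]

theorem paramProg_spec {B m n q : ℕ} {C ρ r : ℝ} {s : State} (h0 : s.w 0 = m) (hx0 : s.x 0 = C)
    (hx1 : s.x 1 = 1) (hx2 : s.x 2 = 0) (hx3 : s.x 3 = 2 ^ q) (hx4 : s.x 4 = q) (hx5 : s.x 5 = n)
    (hρ : s.x 18 / s.x 19 = ρ) (hr : C * ρ = r) (hB : 12800 < B) :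
    Runs B paramProg s 28 fun s' =>
      Frame [6] [6, 7, 8, 9, 10, 11, 12, 16, 17, 18, 21] [] s s' ∧
      s'.x 6 = r ∧ s'.x 7 = 2 * n / r ∧ s'.x 8 = r / (8 * (q : ℝ) ^ 2 * 2 ^ q) ∧
      s'.x 9 = Game.horizon q r ∧ s'.x 10 = 0 ∧ s'.x 11 = 2 * m + 1 ∧ s'.x 12 = 1 ∧
      s'.x 21 = r / 2 ^ q ∧ s'.w 6 = 0 := by
  refine Runs.block ?_
  simp only [wp, Arith.onReal, State.setW_w, State.setReal_x, State.setReal_w, State.setW_x,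
    h0, hx0, hx1, hx2, hx3, hx4, hx5, hρ, hr, Nat.reduceEqDiff, if_true, if_false]
  refine ⟨by omega, by omega, by omega, ?_, ?_⟩
  · repeat (first | exact Frame.refl | refine Frame.setW ?_ (by decide) |
      refine Frame.setReal ?_ (by decide))
  · simp only [Game.horizon]
    norm_num
    refine ⟨by ring, by ring, by ring, by ring⟩

/-- The weights of all signed rows are set to 1. -/
def weightsProg : Prog :=
  .loop (.wlt 6 0) (block [.xstore 3 6 1, .xstore 4 6 1, .wop .add 6 6 3])

theorem weightsProg_spec {B m : ℕ} {s : State} (h0 : s.w 0 = m) (h3 : s.w 3 = 1) (h6 : s.w 6 = 0)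
    (hx1 : s.x 1 = 1) (hB : m < B) :
    Runs B weightsProg s (5 * m + 1) fun s' => Frame [6] [] [3, 4] s s' ∧
      ∀ i < m, s'.xm 3 i = 1 ∧ s'.xm 4 i = 1 := by
  set I : ℕ → State → Prop := fun k s' => Frame [6] [] [3, 4] s s' ∧ s'.w 6 = k ∧
    ∀ i < k, s'.xm 3 i = 1 ∧ s'.xm 4 i = 1 with hI
  refine Runs.mono (T := m * (4 + 1) + 1)
    (Runs.for_loop (start := 0) (n := m) I ?_ ?_ ?_ ⟨Frame.refl, h6, by simp⟩) (by omega) ?_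
  · intro k s' hs'
    simp only [hI] at hs'
    simp [hs']
  · rintro k s' ⟨hF, -⟩
    rw [hF.w 0 (by decide), h0, zero_add]
  · rintro k hk s₁ ⟨hF, g6, g⟩
    have hw3 : s₁.w 3 = 1 := by rw [hF.w 3 (by decide), h3]
    have hx1' : s₁.x 1 = 1 := by rw [hF.x 1 (by decide), hx1]
    refine Runs.block ?_
    simp [hw3, g6, hx1', hI]
    refine ⟨by omega, ?_, fun i hi => ?_⟩
    · repeat (first | exact hF | refine Frame.setW ?_ (by decide) |
        refine Frame.setXM ?_ (by decide))
    · by_cases h : i = k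
      · simp [h]
      · simp [h, g i (by omega)]
  · rintro s' ⟨hF, -, g⟩
    exact ⟨hF, g⟩

/-! #### Sampling a column -/

/-- Word register 7 gets a uniform sample below `2 ^ q`. -/
def sampleProg : Prog :=
  .seq (block [.wconst 7 0, .wconst 6 0])
    (.loop (.wlt 6 5) (block [.coin 11, .wop .add 7 7 7, .wop .add 7 7 11, .wop .add 6 6 3]))

/-- The sample lies in the dyadic block of its accumulator. With accumulator 0 this shows that words
do not overflow and that the sampled column is below `N`. -/
theorem sample_mem (q : ℕ) : ∀ (acc : ℕ) (ω : ℕ → Bool),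
    acc * 2 ^ q ≤ sample q acc ω ∧ sample q acc ω < (acc + 1) * 2 ^ q := by
  induction q with
  | zero => intro acc ω; simp [sample]
  | succ q ih =>
    intro acc ω
    obtain ⟨h1, h2⟩ := ih (acc + acc + if ω 0 then 1 else 0) (dropCoins 1 ω)
    rw [sample, pow_succ]
    split_ifs at h1 h2 ⊢ <;> constructor <;> nlinarith

/-- The definition consumes the first toss, whereas the loop of the machine appends the latest one;
this reconciles them. -/
theorem sample_succ (q : ℕ) : ∀ (acc : ℕ) (ω : ℕ → Bool), sample (q + 1) acc ω =
    sample q acc ω + sample q acc ω + if ω q then 1 else 0 := by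
  induction q with
  | zero => intro acc ω; simp [sample]
  | succ q ih =>
    intro acc ω
    rw [sample, ih, sample]
    rfl

/-- The frame of a program that tosses coins. -/
structure CoinFrame (W X M : List ℕ) (s s' : State) : Prop where
  w : ∀ r, r ∉ W → s'.w r = s.w r
  x : ∀ r, r ∉ X → s'.x r = s.x r
  xm : ∀ a, a ∉ M → s'.xm a = s.xm a
  wm : s'.wm = s.wm

theorem _root_.RealRAM.Frame.coinFrame {W X M : List ℕ} {s s' : State} (h : Frame W X M s s') :
    CoinFrame W X M s s' := ⟨h.w, h.x, h.xm, h.wm⟩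

theorem CoinFrame.mono {W X M W' X' M' : List ℕ} {s s' : State} (h : CoinFrame W X M s s')
    (hW : W ⊆ W') (hX : X ⊆ X') (hM : M ⊆ M') : CoinFrame W' X' M' s s' :=
  ⟨fun r hr => h.w r fun h' => hr (hW h'), fun r hr => h.x r fun h' => hr (hX h'),
    fun r hr => h.xm r fun h' => hr (hM h'), h.wm⟩

theorem CoinFrame.trans {W X M : List ℕ} {s s' s'' : State} (h : CoinFrame W X M s s')
    (h' : CoinFrame W X M s' s'') : CoinFrame W X M s s'' :=
  ⟨fun r hr => (h'.w r hr).trans (h.w r hr), fun r hr => (h'.x r hr).trans (h.x r hr),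
    fun r hr => (h'.xm r hr).trans (h.xm r hr), h'.wm.trans h.wm⟩

theorem sampleProg_spec {B q : ℕ} {s : State} (h3 : s.w 3 = 1) (h5 : s.w 5 = q)
    (hB : 2 ^ q < B) :
    Runs B sampleProg s (6 * q + 4) fun s' => CoinFrame [6, 7, 11] [] [] s s' ∧
      s'.w 7 = sample q 0 s.coins ∧ s'.coins = dropCoins q s.coins := by
  have hq : q < 2 ^ q := Nat.lt_two_pow_self
  set I : ℕ → State → Prop := fun k s' => CoinFrame [6, 7, 11] [] [] s s' ∧ s'.w 6 = k ∧
    s'.w 7 = sample k 0 s.coins ∧ s'.coins = dropCoins k s.coins with hI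
  refine Runs.mono (T := 3 + (q * (5 + 1) + 1)) (Runs.seq (Q := I 0) (Runs.block ?_)
    fun s' hs' => Runs.for_loop (start := 0) (n := q) I ?_ ?_ ?_ hs') (by omega) ?_
  · simp [hI, sample]
    exact ⟨by omega, ((Frame.refl.setW (by decide)).setW (by decide)).coinFrame, rfl⟩
  · intro k s' hs'
    simp only [hI] at hs'
    simp [hs']
  · rintro k s' ⟨hF, -⟩
    rw [hF.w 5 (by decide), h5, zero_add]
  · rintro k hk s₁ ⟨hF, g6, g7, gc⟩
    have hw3 : s₁.w 3 = 1 := by rw [hF.w 3 (by decide), h3]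
    have hb := (sample_mem (k + 1) 0 s.coins).2
    have hle : 2 ^ (k + 1) ≤ 2 ^ q := Nat.pow_le_pow_right (by norm_num) hk
    rw [sample_succ] at hb
    refine Runs.block ?_
    simp only [wp, Arith.onWord, State.setW_w, State.toss_w, hw3, g6, g7, Nat.reduceEqDiff, if_true,
      if_false]
    have hbit : s₁.coins 0 = s.coins k := by rw [gc]; simp [dropCoins]
    rw [hbit]
    refine ⟨by omega, by omega, by omega, by omega, ⟨fun r hr => ?_, fun r hr => ?_, fun r hr => ?_,
      ?_⟩, ?_, ?_, ?_⟩
    · simp only [List.mem_cons, List.not_mem_nil, or_false, not_or] at hr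
      simp [hr, hF.w r (by simp [hr])]
    · simp [hF.x r hr]
    · simp [hF.xm r hr]
    · simp [hF.wm]
    · simp
    · simp [sample_succ]
    · simp only [State.setW_coins, State.toss_coins, gc]
      funext l
      simp [dropCoins]
      congr 1; ring
  · rintro s' ⟨hF, g6, g7, gc⟩
    exact ⟨hF, g7, gc⟩

/-! #### Processing a column -/

/-- Word registers 8 and 9 get the limits of the column in word register 7. -/
def limitsCode : List Instr := [.wload 8 0 7, .wop .add 11 7 3, .wload 9 0 11]

/-- Real register 13 gets the product of the column in word register 7 with the weights. -/
def gradProg : Prog :=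
  .seq (block (limitsCode ++ [.xop .sub 13 2 2]))
    (.loop (.wlt 8 9) (block [.wload 10 1 8, .xload 16 0 8, .xload 17 3 10, .xload 18 4 10,
      .xop .sub 17 17 18, .xop .mul 17 17 16, .xop .add 13 13 17, .wop .add 8 8 3]))

section
variable {B m n k : ℕ} {a : ℕ → ℕ → ℝ} {col : ℕ → List ℕ}

theorem gradProg_spec {s : State} (hcsc : IsCSC m n k a col (s.wm 0) (s.wm 1) (s.xm 0))
    (h3 : s.w 3 = 1) (hx2 : s.x 2 = 0) {j : ℕ} (h7 : s.w 7 = j) (hj : j < n) (hm : m < B)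
    (hn : n < B) (hnm : n * m < B) :
    Runs B gradProg s (10 * k + 6) fun s' => Frame [8, 9, 10, 11] [13, 16, 17, 18] [] s s' ∧
      s'.w 9 = s.wm 0 j + (col j).length ∧
      s'.x 13 = ∑ i ∈ range m, (s.xm 3 i - s.xm 4 i) * a i j := by
  set f : ℕ → ℝ := fun i => (s.xm 3 i - s.xm 4 i) * a i j with hf
  set I : ℕ → State → Prop := fun l s' => Frame [8, 9, 10, 11] [13, 16, 17, 18] [] s s' ∧
    s'.w 8 = s.wm 0 j + l ∧ s'.w 9 = s.wm 0 j + (col j).length ∧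
    s'.x 13 = (((col j).take l).map f).sum with hI
  have hlen := hcsc.length_le j
  have hp0 := hcsc.ptr_le j
  have hp1 := hcsc.ptr_le (j + 1)
  have hp := hcsc.ptr_succ j hj
  refine Runs.mono (T := 5 + ((col j).length * (9 + 1) + 1)) (Runs.seq (Q := I 0) (Runs.block ?_)
    fun s' hs' => Runs.for_loop (start := s.wm 0 j) (n := (col j).length) I ?_ ?_ ?_ hs')
      (by omega) ?_
  · simp [hI, limitsCode, h3, h7, hx2, hp]
    refine ⟨by omega, by omega, by omega, ?_⟩
    repeat (first | exact Frame.refl | refine Frame.setW ?_ (by decide) |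
      refine Frame.setReal ?_ (by decide))
  · exact fun l s' hs' => hs'.2.1
  · exact fun l s' hs' => hs'.2.2.1
  · rintro l hl s₁ ⟨hF, g8, g9, g13⟩
    have hw3 : s₁.w 3 = 1 := by rw [hF.w 3 (by decide), h3]
    have e0 := hF.xm 0 (by decide)
    have e3 := hF.xm 3 (by decide)
    have e4 := hF.xm 4 (by decide)
    have hi := hcsc.lt j _ (List.getElem_mem hl)
    refine Runs.block ?_
    simp [hI, hw3, g8, g9, g13, hF.wm, e0, e3, e4, hcsc.row_eq j hj l hl, hcsc.val_eq j hj l hl]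
    refine ⟨by omega, by omega, ?_, by ring, ?_⟩
    · repeat (first | exact hF | refine Frame.setW ?_ (by decide) |
        refine Frame.setReal ?_ (by decide))
    · rw [List.take_succ_eq_append_getElem (by simpa using hl), List.sum_append]
      simp [hf]
  · rintro s' ⟨hF, -, g9, g13⟩
    refine ⟨hF, g9, ?_⟩
    rw [g13, List.take_length, ← hcsc.sum_col (fun i => s.xm 3 i - s.xm 4 i) j]

/-- The weights are updated with the column in word register 7. -/
def updateProg : Prog :=
  .seq (block [.wload 8 0 7])
    (.loop (.wlt 8 9) (block [.wload 10 1 8, .xload 16 0 8, .xop .mul 16 14 16, .xload 17 3 10,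
      .xop .mul 18 17 16, .xop .add 11 11 18, .xop .add 17 17 18, .xstore 3 10 17, .xload 17 4 10,
      .xop .mul 18 17 16, .xop .sub 11 11 18, .xop .sub 17 17 18, .xstore 4 10 17,
      .wop .add 8 8 3]))

/-- Register 11, the total weight, is corrected along with the weights. Summing it afresh would cost
`O(m)` instead of `O(k)` per step. -/
theorem updateProg_spec {s : State} (hcsc : IsCSC m n k a col (s.wm 0) (s.wm 1) (s.xm 0))
    (h3 : s.w 3 = 1) {j : ℕ} (h7 : s.w 7 = j) (hj : j < n)
    (h9 : s.w 9 = s.wm 0 j + (col j).length) (hm : m < B) (hnm : n * m < B) :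
    Runs B updateProg s (16 * k + 3) fun s' => Frame [8, 10] [11, 16, 17, 18] [3, 4] s s' ∧
      (∀ i, s'.xm 3 i = s.xm 3 i * (1 + s.x 14 * a i j)) ∧
      (∀ i, s'.xm 4 i = s.xm 4 i * (1 - s.x 14 * a i j)) ∧
      s'.x 11 = s.x 11 + s.x 14 * ∑ i ∈ range m, (s.xm 3 i - s.xm 4 i) * a i j := by
  set f : ℕ → ℝ := fun i => (s.xm 3 i - s.xm 4 i) * a i j with hf
  set I : ℕ → State → Prop := fun l s' => Frame [8, 10] [11, 16, 17, 18] [3, 4] s s' ∧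
    s'.w 8 = s.wm 0 j + l ∧
    (∀ i, s'.xm 3 i = if i ∈ (col j).take l then s.xm 3 i * (1 + s.x 14 * a i j)
      else s.xm 3 i) ∧
    (∀ i, s'.xm 4 i = if i ∈ (col j).take l then s.xm 4 i * (1 - s.x 14 * a i j)
      else s.xm 4 i) ∧
    s'.x 11 = s.x 11 + s.x 14 * (((col j).take l).map f).sum with hI
  have hlen := hcsc.length_le j
  have hp0 := hcsc.ptr_le j
  have hp1 := hcsc.ptr_le (j + 1)
  have hp := hcsc.ptr_succ j hj
  refine Runs.mono (T := 2 + ((col j).length * (15 + 1) + 1)) (Runs.seq (Q := I 0) (Runs.block ?_)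
    fun s' hs' => Runs.for_loop (start := s.wm 0 j) (n := (col j).length) I ?_ ?_ ?_ hs')
      (by omega) ?_
  · simp [hI, h7]
    exact ⟨by omega, Frame.refl.setW (by decide)⟩
  · exact fun l s' hs' => hs'.2.1
  · exact fun l s' hs' => by rw [hs'.1.w 9 (by decide), h9]
  · rintro l hl s₁ ⟨hF, g8, g3, g4, g11⟩
    have hw3 : s₁.w 3 = 1 := by rw [hF.w 3 (by decide), h3]
    have hx14 := hF.x 14 (by decide)
    have e0 := hF.xm 0 (by decide)
    have hi := hcsc.lt j _ (List.getElem_mem hl)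
    -- The rows of a column are distinct, so the weights of row `col j [l]` are still the old ones
    -- and each is updated once.
    have hnot : (col j)[l] ∉ (col j).take l := by
      intro hmem
      obtain ⟨l', hl', he⟩ := List.mem_take_iff_getElem.1 hmem
      have := (hcsc.nodup j).getElem_inj_iff.1 he
      omega
    have hmem : ∀ i, i ∈ (col j).take (l + 1) ↔ i ∈ (col j).take l ∨ i = (col j)[l] := by
      intro i
      rw [List.take_succ_eq_append_getElem hl, List.mem_append, List.mem_singleton]
    set i₀ := (col j)[l] with hi₀
    have g3' : s₁.xm 3 i₀ = s.xm 3 i₀ := by rw [g3, if_neg hnot]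
    have g4' : s₁.xm 4 i₀ = s.xm 4 i₀ := by rw [g4, if_neg hnot]
    refine Runs.block ?_
    simp only [wp, Arith.onWord, Arith.onReal, State.setW_w, State.setReal_x, State.setReal_w,
      State.setW_x, State.setXM_w, State.setXM_x, State.setXM_xm,
      State.setW_xm, State.setReal_xm, hw3, g8, hF.wm, e0, hx14,
      hcsc.row_eq j hj l hl, hcsc.val_eq j hj l hl, Nat.reduceEqDiff, if_true, if_false, ← hi₀,
      g3', g4', false_and]
    refine ⟨by omega, by omega, ?_, ?_, fun i => ?_, fun i => ?_, ?_⟩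
    · repeat (first | exact hF | refine Frame.setW ?_ (by decide) |
        refine Frame.setReal ?_ (by decide) | refine Frame.setXM ?_ (by decide))
    · simp; ring
    · by_cases h : i = i₀
      · subst h
        simp [hmem]
        ring
      · simp [hmem, h, g3]
    · by_cases h : i = i₀
      · subst h
        simp [hmem]
        ring
      · simp [hmem, h, g4]
    · simp only [State.setW_x, State.setXM_x, State.setReal_x, Nat.reduceEqDiff, if_true, if_false,
        g11, List.take_succ_eq_append_getElem hl, List.map_append, List.sum_append, List.map_cons,
        List.map_nil, List.sum_cons, List.sum_nil, hf, ← hi₀]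
      ring
  · rintro s' ⟨hF, -, g3, g4, g11⟩
    refine ⟨hF, fun i => ?_, fun i => ?_, ?_⟩
    · rw [g3, List.take_length]
      split_ifs with h
      · rfl
      · rw [hcsc.eq_zero i j h]; ring
    · rw [g4, List.take_length]
      split_ifs with h
      · rfl
      · rw [hcsc.eq_zero i j h]; ring
    · rw [g11, List.take_length, ← hcsc.sum_col (fun i => s.xm 3 i - s.xm 4 i) j]

/-- Real register 14 gets the sign that is best for the column in word register 7. -/
def signProg : Prog :=
  .seq (block [.xload 16 1 7, .xop .mul 16 16 11, .xop .mul 17 7 13, .xop .sub 16 16 17])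
    (.ite (.xlt 16 2) (block [.xop .sub 14 2 1]) (block [.xop .add 14 2 1]))

theorem signProg_spec {s : State} (hx1 : s.x 1 = 1) (hx2 : s.x 2 = 0) :
    Runs B signProg s 8 fun s' => Frame [] [14, 16, 17] [] s s' ∧
      s'.x 14 = if s.xm 1 (s.w 7) * s.x 11 - s.x 7 * s.x 13 < 0 then -1 else 1 := by
  refine Runs.mono (T := 5 + (2 + 1)) (Runs.seq (Q := fun s' => Frame [] [14, 16, 17] [] s s' ∧
    s'.x 16 = s.xm 1 (s.w 7) * s.x 11 - s.x 7 * s.x 13) (Runs.block ?_) fun s' hs' =>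
    Runs.ite (fun h => Runs.block ?_) (fun h => Runs.block ?_)) le_rfl (fun _ => id)
  · simp
    repeat (first | exact Frame.refl | refine Frame.setW ?_ (by decide) |
      refine Frame.setReal ?_ (by decide))
  all_goals
    obtain ⟨hF, g⟩ := hs'
    have e1 : s'.x 1 = 1 := by rw [hF.x 1 (by decide), hx1]
    have e2 : s'.x 2 = 0 := by rw [hF.x 2 (by decide), hx2]
    simp only [Test.Holds, e2, g] at h
    simp [h, e1, e2]
    exact hF.setReal (by decide)

/-- One step with the column in word register 7. -/
def columnProg : Prog :=
  .seq gradProg (.seq signProg (.seq (block [.xload 16 2 7, .xop .add 16 16 14, .xstore 2 7 16,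
    .xop .mul 14 8 14]) updateProg))

theorem columnProg_spec {s : State} (hcsc : IsCSC m n k a col (s.wm 0) (s.wm 1) (s.xm 0))
    (h3 : s.w 3 = 1) (hx1 : s.x 1 = 1) (hx2 : s.x 2 = 0) {j : ℕ} (h7 : s.w 7 = j) (hj : j < n)
    (hm : m < B) (hn : n < B) (hnm : n * m < B) {g x : ℝ}
    (hg : g = ∑ i ∈ range m, (s.xm 3 i - s.xm 4 i) * a i j)
    (hx : x = if s.xm 1 j * s.x 11 - s.x 7 * g < 0 then -1 else 1) :
    Runs B columnProg s (26 * k + 22) fun s' =>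
      Frame [8, 9, 10, 11] [11, 13, 14, 16, 17, 18] [2, 3, 4] s s' ∧
      (∀ i, s'.xm 2 i = Function.update (s.xm 2) j (s.xm 2 j + x) i) ∧
      (∀ i, s'.xm 3 i = s.xm 3 i * (1 + s.x 8 * x * a i j)) ∧
      (∀ i, s'.xm 4 i = s.xm 4 i * (1 - s.x 8 * x * a i j)) ∧
      s'.x 11 = s.x 11 + s.x 8 * x * g := by
  refine Runs.mono (T := (10 * k + 6) + (8 + (5 + (16 * k + 3))))
    (Runs.seq (gradProg_spec hcsc h3 hx2 h7 hj hm hn hnm) fun s₁ ⟨hF₁, g9, g13⟩ => ?_) (by omega)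
    (fun _ => id)
  have hF₁' := hF₁.mono (W' := [8, 9, 10, 11]) (X' := [11, 13, 14, 16, 17, 18]) (M' := [2, 3, 4])
    (by decide) (by decide) (by decide)
  refine Runs.seq (signProg_spec (by rw [hF₁.x 1 (by decide), hx1])
    (by rw [hF₁.x 2 (by decide), hx2])) fun s₂ ⟨hF₂, g14⟩ => ?_
  have hF₂' := hF₁'.trans (hF₂.mono (W' := [8, 9, 10, 11]) (X' := [11, 13, 14, 16, 17, 18])
    (M' := [2, 3, 4]) (by decide) (by decide) (by decide))
  rw [hF₁.xm 1 (by decide), hF₁.w 7 (by decide), h7, hF₁.x 11 (by decide), hF₁.x 7 (by decide),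
    g13, ← hg, ← hx] at g14
  have e3 : s₂.xm 3 = s.xm 3 := by rw [hF₂.xm 3 (by decide), hF₁.xm 3 (by decide)]
  have e4 : s₂.xm 4 = s.xm 4 := by rw [hF₂.xm 4 (by decide), hF₁.xm 4 (by decide)]
  have e2 : s₂.xm 2 = s.xm 2 := by rw [hF₂.xm 2 (by decide), hF₁.xm 2 (by decide)]
  have e11 : s₂.x 11 = s.x 11 := by rw [hF₂.x 11 (by decide), hF₁.x 11 (by decide)]
  refine Runs.seq (Q := fun s' => Frame [8, 9, 10, 11] [11, 13, 14, 16, 17, 18] [2, 3, 4] s s' ∧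
    s'.w 9 = s.wm 0 j + (col j).length ∧ s'.x 14 = s.x 8 * x ∧ s'.xm 3 = s.xm 3 ∧
    s'.xm 4 = s.xm 4 ∧ s'.x 11 = s.x 11 ∧
    ∀ i, s'.xm 2 i = Function.update (s.xm 2) j (s.xm 2 j + x) i) (Runs.block ?_)
    fun s₃ ⟨hF₃, f9, f14, f3, f4, f11, f2⟩ => ?_
  · have h9 : s₂.w 9 = s.wm 0 j + (col j).length := by rw [hF₂.w 9 (by decide), g9]
    simp [hF₂'.w 7, h7, e2, g14, hF₂'.x 8, h9, State.setXM_xm_ne, e3, e4, e11,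
      Function.update_apply]
    repeat (first | exact hF₂' | refine Frame.setW ?_ (by decide) |
      refine Frame.setReal ?_ (by decide) | refine Frame.setXM ?_ (by decide))
  · have hcsc' : IsCSC m n k a col (s₃.wm 0) (s₃.wm 1) (s₃.xm 0) := by
      rw [hF₃.wm, hF₃.xm 0 (by decide)]; exact hcsc
    refine Runs.mono (updateProg_spec hcsc' (by rw [hF₃.w 3 (by decide), h3])
      (by rw [hF₃.w 7 (by decide), h7]) hj (by rw [f9, hF₃.wm]) hm hnm) le_rfl ?_
    rintro s₄ ⟨hF₄, k3, k4, k11⟩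
    rw [f14, f3, f4, f11, ← hg] at *
    refine ⟨hF₃.trans (hF₄.mono (by decide) (by decide) (by decide)), fun i => ?_, k3, k4, k11⟩
    rw [hF₄.xm 2 (by decide), f2]

end

/-! #### The main loop -/

/-- The weight of the constant strategy and the clock advance. -/
def tickProg : Prog :=
  block [.xop .mul 16 8 21, .xop .mul 17 12 16, .xop .add 11 11 17, .xop .add 12 12 17,
    .xop .add 10 10 1]

theorem tickProg_spec {B : ℕ} {s : State} (hx1 : s.x 1 = 1) :
    Runs B tickProg s 6 fun s' => Frame [] [10, 11, 12, 16, 17] [] s s' ∧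
      s'.x 11 = s.x 11 + s.x 8 * (s.x 21 * s.x 12) ∧ s'.x 12 = s.x 12 * (1 + s.x 8 * s.x 21) ∧
      s'.x 10 = s.x 10 + 1 := by
  refine Runs.block ?_
  simp [hx1]
  refine ⟨?_, by ring, by ring⟩
  repeat (first | exact Frame.refl | refine Frame.setW ?_ (by decide) |
    refine Frame.setReal ?_ (by decide))

/-- A sample of at least `n` is a padded zero column: it changes no row weight, and only the
constant strategy and the clock advance. This avoids rejection sampling. -/
def stepProg : Prog :=
  .seq sampleProg (.seq (.ite (.wlt 7 1) columnProg (block [])) tickProg)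

/-- The clock is a real register because the horizon is real and cannot be converted to a word. The
loop makes as many iterations as the ceiling of the horizon. -/
def mainProg : Prog := .loop (.xlt 10 9) stepProg

/-- The machine holds the state `σ` of the game. -/
structure Rep (G : Game) (n : ℕ) (σ : Game.State) (s : State) : Prop where
  up : ∀ i < G.m, s.xm 3 i = σ.up i
  um : ∀ i < G.m, s.xm 4 i = σ.um i
  w0 : s.x 12 = σ.w0
  total : s.x 11 = G.total σ
  zs : ∀ j < n, s.xm 2 j = σ.zs j
  time : s.x 10 = σ.time

/-- The machine holds the parameters of the game. -/
structure Setup (B n k q : ℕ) (G : Game) (col : ℕ → List ℕ) (s : State) : Prop where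
  csc : IsCSC G.m n k G.a col (s.wm 0) (s.wm 1) (s.xm 0)
  v : ∀ j < n, s.xm 1 j = G.v j
  w0 : s.w 0 = G.m
  w1 : s.w 1 = n
  w3 : s.w 3 = 1
  w5 : s.w 5 = q
  x1 : s.x 1 = 1
  x2 : s.x 2 = 0
  x7 : s.x 7 = G.lam
  x8 : s.x 8 = G.η
  x21 : s.x 21 = G.ρ
  m_lt : G.m < B
  n_lt : n < B
  nm_lt : n * G.m < B
  pow_lt : 2 ^ q < B

theorem Setup.of_frame {B n k q : ℕ} {G : Game} {col : ℕ → List ℕ} {s s' : State}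
    (h : Setup B n k q G col s)
    (hF : CoinFrame [6, 7, 8, 9, 10, 11] [10, 11, 12, 13, 14, 15, 16, 17, 18, 19] [2, 3, 4, 5] s s') :
    Setup B n k q G col s' := by
  obtain ⟨csc, v, w0, w1, w3, w5, x1, x2, x7, x8, x21, b1, b2, b3, b4⟩ := h
  refine ⟨?_, ?_, ?_, ?_, ?_, ?_, ?_, ?_, ?_, ?_, ?_, b1, b2, b3, b4⟩
  · rw [hF.wm, hF.xm 0 (by decide)]; exact csc
  · rw [hF.xm 1 (by decide)]; exact v
  · rw [hF.w 0 (by decide)]; exact w0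
  · rw [hF.w 1 (by decide)]; exact w1
  · rw [hF.w 3 (by decide)]; exact w3
  · rw [hF.w 5 (by decide)]; exact w5
  · rw [hF.x 1 (by decide)]; exact x1
  · rw [hF.x 2 (by decide)]; exact x2
  · rw [hF.x 7 (by decide)]; exact x7
  · rw [hF.x 8 (by decide)]; exact x8
  · rw [hF.x 21 (by decide)]; exact x21

variable {B n k q : ℕ} {G : Game} {col : ℕ → List ℕ}

theorem Rep.grad_eq {σ : Game.State} {s : State} (h : Rep G n σ s) (j : ℕ) :
    G.grad σ j = ∑ i ∈ range G.m, (s.xm 3 i - s.xm 4 i) * G.a i j :=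
  sum_congr rfl fun i hi => by rw [h.up i (mem_range.1 hi), h.um i (mem_range.1 hi)]

/-- The frame of the main loop. -/
abbrev StepFrame (s s' : State) : Prop :=
  CoinFrame [6, 7, 8, 9, 10, 11] [10, 11, 12, 13, 14, 16, 17, 18] [2, 3, 4] s s'

theorem StepFrame.setup {s s' : State} (hF : StepFrame s s') (h : Setup B n k q G col s) :
    Setup B n k q G col s' := h.of_frame (hF.mono (by decide) (by decide) (by decide))

theorem stepProg_spec (ha : ∀ i j, n ≤ j → G.a i j = 0) {s : State} (hs : Setup B n k q G col s)
    {σ : Game.State} (hrep : Rep G n σ s) :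
    Runs B stepProg s (26 * k + 6 * q + 33) fun s' => StepFrame s s' ∧
      Rep G n (G.step σ (sample q 0 s.coins)) s' ∧ s'.coins = dropCoins q s.coins := by
  set j := sample q 0 s.coins with hj
  refine Runs.mono (T := (6 * q + 4) + ((26 * k + 22 + 1) + 6))
    (Runs.seq (sampleProg_spec hs.w3 hs.w5 hs.pow_lt) fun s₁ ⟨hF₁, g7, gc⟩ => ?_) (by omega)
    (fun _ => id)
  have hF₁' : StepFrame s s₁ := hF₁.mono (by decide) (by decide) (by decide)
  have hs₁ := hF₁'.setup hs
  have e3 : s₁.xm 3 = s.xm 3 := hF₁.xm 3 (by decide)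
  have e4 : s₁.xm 4 = s.xm 4 := hF₁.xm 4 (by decide)
  have e2 : s₁.xm 2 = s.xm 2 := hF₁.xm 2 (by decide)
  have e11 : s₁.x 11 = G.total σ := by rw [hF₁.x 11 (by decide), hrep.total]
  have e12 : s₁.x 12 = σ.w0 := by rw [hF₁.x 12 (by decide), hrep.w0]
  have e10 : s₁.x 10 = σ.time := by rw [hF₁.x 10 (by decide), hrep.time]
  have hgrad := hrep.grad_eq j
  refine Runs.seq (Q := fun s' => StepFrame s s' ∧ s'.coins = dropCoins q s.coins ∧
    (∀ i < G.m, s'.xm 3 i = (G.step σ j).up i) ∧ (∀ i < G.m, s'.xm 4 i = (G.step σ j).um i) ∧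
    (∀ l < n, s'.xm 2 l = (G.step σ j).zs l) ∧
    s'.x 11 = G.total σ + G.η * G.sgn σ j * G.grad σ j ∧ s'.x 12 = σ.w0 ∧ s'.x 10 = σ.time)
    (Runs.ite (fun h => ?_) (fun h => ?_)) ?_
  · have hjn : j < n := by simpa [g7, hs₁.w1] using h
    have hsgn : G.sgn σ j =
        if s₁.xm 1 j * s₁.x 11 - s₁.x 7 * G.grad σ j < 0 then -1 else 1 := by
      rw [hs₁.v j hjn, e11, hs₁.x7]; rfl
    refine Runs.mono (columnProg_spec hs₁.csc hs₁.w3 hs₁.x1 hs₁.x2 g7 hjn hs₁.m_lt hs₁.n_lt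
      hs₁.nm_lt (by rw [e3, e4]; exact hgrad) hsgn) (by omega) ?_
    rintro s₂ ⟨hF₂, f2, f3, f4, f11⟩
    rw [hs₁.x8] at f3 f4 f11
    have hF₂' := (hF₂.coinFrame.mono (W' := [6, 7, 8, 9, 10, 11])
      (X' := [10, 11, 12, 13, 14, 16, 17, 18]) (M' := [2, 3, 4])
      (by decide) (by decide) (by decide))
    refine ⟨hF₁'.trans hF₂', by rw [hF₂.coins, gc], fun i hi => ?_, fun i hi => ?_, fun l hl => ?_,
      by rw [f11, e11], by rw [hF₂.x 12 (by decide), e12], by rw [hF₂.x 10 (by decide), e10]⟩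
    · rw [f3, e3, hrep.up i hi]; rfl
    · rw [f4, e4, hrep.um i hi]; rfl
    · rw [f2, e2]
      simp only [Game.step, Function.update_apply, hrep.zs l hl, ← hj, hrep.zs j hjn]
  -- In a padded column the game still changes `zs j`, but `Rep` only refers to indices below `n`.
  · have hjn : n ≤ j := by simpa [g7, hs₁.w1] using h
    have hg0 : G.grad σ j = 0 := by simp [Game.grad, ha _ j hjn]
    refine Runs.mono (Runs.block (l := []) (Q := fun s' => s' = s₁) rfl) (by simp) ?_
    rintro _ rfl
    refine ⟨hF₁', gc, fun i hi => ?_, fun i hi => ?_, fun l hl => ?_, by rw [e11, hg0, mul_zero,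
      add_zero], e12, e10⟩
    · rw [e3, hrep.up i hi]; simp [Game.step, ha i j hjn]
    · rw [e4, hrep.um i hi]; simp [Game.step, ha i j hjn]
    · have : l ≠ j := by omega
      rw [e2, hrep.zs l hl]; simp [Game.step, this]
  · rintro s₂ ⟨hF₂, gc₂, f3, f4, f2, f11, f12, f10⟩
    have hs₂ := hF₂.setup hs
    refine Runs.mono (tickProg_spec hs₂.x1) le_rfl ?_
    rintro s₃ ⟨hF₃, k11, k12, k10⟩
    refine ⟨hF₂.trans (hF₃.coinFrame.mono (by decide) (by decide) (by decide)), ⟨fun i hi => ?_,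
      fun i hi => ?_, ?_, ?_, fun l hl => ?_, ?_⟩, by rw [hF₃.coins, gc₂]⟩
    · rw [hF₃.xm 3 (by decide), f3 i hi]
    · rw [hF₃.xm 4 (by decide), f4 i hi]
    · rw [k12, f12, hs₂.x8, hs₂.x21]; rfl
    · rw [k11, f11, f12, hs₂.x8, hs₂.x21, Game.total_step]; ring
    · rw [hF₃.xm 2 (by decide), f2 l hl]
    · rw [k10, f10]; simp [Game.step]

theorem mainProg_spec (ha : ∀ i j, n ≤ j → G.a i j = 0) {s : State} (hs : Setup B n k q G col s)
    (hrep : Rep G n Game.init s) :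
    Runs B mainProg s (⌈s.x 9⌉₊ * (26 * k + 6 * q + 34) + 1) fun s' => StepFrame s s' ∧
      Rep G n (runSteps q G.step ⌈s.x 9⌉₊ Game.init s.coins) s' := by
  refine Runs.mono (Runs.loop (T := 26 * k + 6 * q + 33) ⌈s.x 9⌉₊ (fun t s' => StepFrame s s' ∧
    Rep G n (runSteps q G.step t Game.init s.coins) s' ∧ s'.coins = dropCoins (t * q) s.coins)
    ?_ ?_ ?_) le_rfl fun s' h => ⟨h.1, h.2.1⟩
  · rintro t ht s₁ ⟨hF, hr, hc⟩
    refine ⟨?_, Runs.mono (stepProg_spec ha (hF.setup hs) hr) le_rfl ?_⟩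
    · rw [Test.Holds, hr.time, Game.time_runSteps, hF.x 9 (by decide)]
      exact Nat.lt_ceil.1 ht
    · rintro s₂ ⟨hF₂, hr₂, hc₂⟩
      refine ⟨hF.trans hF₂, ?_, ?_⟩
      · rw [runSteps_succ, ← hc]; exact hr₂
      · rw [hc₂, hc, dropCoins_dropCoins, add_comm, ← Nat.succ_mul]
  · rintro s₁ ⟨hF, hr, hc⟩
    rw [Test.Holds, hr.time, Game.time_runSteps, hF.x 9 (by decide), not_lt]
    exact Nat.le_ceil _
  · refine ⟨Frame.refl.coinFrame, hrep, ?_⟩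
    funext l; simp [dropCoins]

end DiscrepancyLP

/-- The largest of `b` and the first `J` absolute values of `f`. -/
noncomputable def runMax (b : ℝ) (f : ℕ → ℝ) : ℕ → ℝ
  | 0 => b
  | J + 1 => max (runMax b f J) |f J|

theorem le_runMax (b : ℝ) (f : ℕ → ℝ) (J : ℕ) : b ≤ runMax b f J := by
  induction J with
  | zero => exact le_rfl
  | succ J ih => exact ih.trans (le_max_left _ _)

theorem abs_le_runMax (b : ℝ) (f : ℕ → ℝ) {J l : ℕ} (h : l < J) : |f l| ≤ runMax b f J := by
  induction J with
  | zero => omega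
  | succ J ih =>
    rcases Nat.lt_succ_iff_lt_or_eq.1 h with h | rfl
    · exact (ih h).trans (le_max_left _ _)
    · exact le_max_right _ _

/-- The regret bound needs to know where the maximal violation is attained, not only its size. -/
theorem runMax_eq (b : ℝ) (f : ℕ → ℝ) (J : ℕ) :
    runMax b f J = b ∨ ∃ l < J, runMax b f J = |f l| := by
  induction J with
  | zero => exact Or.inl rfl
  | succ J ih =>
    rw [runMax]
    rcases max_choice (runMax b f J) |f J| with h | h <;> rw [h]
    · rcases ih with h | ⟨l, hl, h⟩
      · exact Or.inl h
      · exact Or.inr ⟨l, by omega, h⟩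
    · exact Or.inr ⟨J, by omega, rfl⟩

namespace DiscrepancyLP

/-! #### Normalization -/

/-- Real register 15 gets its maximum with the absolute value of register 17. -/
def maxAbsProg : Prog :=
  .seq (block [.xop .sub 18 2 17]) (.seq (.ite (.xlt 18 17) (block [.xop .add 18 17 2]) (block []))
    (.ite (.xlt 15 18) (block [.xop .add 15 18 2]) (block [])))

theorem maxAbsProg_spec {B : ℕ} {s : State} (hx2 : s.x 2 = 0) :
    Runs B maxAbsProg s 8 fun s' => Frame [] [15, 18] [] s s' ∧
      s'.x 15 = max (s.x 15) |s.x 17| := by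
  refine Runs.mono (T := 2 + ((2 + 1) + (2 + 1))) (Runs.seq (Q := fun s' =>
    Frame [] [15, 18] [] s s' ∧ s'.x 18 = - s.x 17 ∧ s'.x 15 = s.x 15) (Runs.block ?_)
    fun s₁ ⟨hF₁, g₁, k₁⟩ => Runs.seq (Q := fun s' =>
    Frame [] [15, 18] [] s s' ∧ s'.x 18 = |s.x 17| ∧ s'.x 15 = s.x 15) (Runs.ite (fun h => ?_)
    fun h => ?_) fun s₂ ⟨hF₂, g₂, k₂⟩ => Runs.ite (fun h => ?_) fun h => ?_) le_rfl (fun _ => id)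
  · simp [hx2]
    exact Frame.refl.setReal (by decide)
  · have e17 := hF₁.x 17 (by decide)
    have e2 : s₁.x 2 = 0 := by rw [hF₁.x 2 (by decide), hx2]
    simp only [Test.Holds, g₁, e17] at h
    refine Runs.block ?_
    simp [e2, e17, k₁]
    exact ⟨hF₁.setReal (by decide), (abs_of_pos (by linarith)).symm⟩
  · have e17 := hF₁.x 17 (by decide)
    simp only [Test.Holds, g₁, e17] at h
    refine Runs.mono (Runs.block (l := []) (Q := fun s' => s' = s₁) rfl) (by simp) ?_
    rintro _ rfl
    exact ⟨hF₁, by rw [g₁, abs_of_nonpos (by linarith)], k₁⟩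
  · have e2 : s₂.x 2 = 0 := by rw [hF₂.x 2 (by decide), hx2]
    simp only [Test.Holds, g₂, k₂] at h
    refine Runs.block ?_
    simp [e2, g₂, max_eq_right h.le]
    exact hF₂.setReal (by decide)
  · simp only [Test.Holds, g₂, k₂] at h
    refine Runs.mono (Runs.block (l := []) (Q := fun s' => s' = s₂) rfl) (by simp) ?_
    rintro _ rfl
    exact ⟨hF₂, by rw [k₂, max_eq_left (by linarith)]⟩

/-- A multiple of the column in word register 7 is added to array 5. -/
def addColumnProg : Prog :=
  .seq (block limitsCode) (.loop (.wlt 8 9) (block [.wload 10 1 8, .xload 18 0 8,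
    .xop .mul 18 18 17, .xload 19 5 10, .xop .add 19 19 18, .xstore 5 10 19, .wop .add 8 8 3]))

section
variable {B m n k : ℕ} {a : ℕ → ℕ → ℝ} {col : ℕ → List ℕ}

theorem addColumnProg_spec {s : State} (hcsc : IsCSC m n k a col (s.wm 0) (s.wm 1) (s.xm 0))
    (h3 : s.w 3 = 1) {j : ℕ} (h7 : s.w 7 = j) (hj : j < n) (hm : m < B)
    (hn : n < B) (hnm : n * m < B) :
    Runs B addColumnProg s (9 * k + 5) fun s' => Frame [8, 9, 10, 11] [18, 19] [5] s s' ∧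
      ∀ i, s'.xm 5 i = s.xm 5 i + a i j * s.x 17 := by
  set I : ℕ → State → Prop := fun l s' => Frame [8, 9, 10, 11] [18, 19] [5] s s' ∧
    s'.w 8 = s.wm 0 j + l ∧ s'.w 9 = s.wm 0 j + (col j).length ∧
    ∀ i, s'.xm 5 i = if i ∈ (col j).take l then s.xm 5 i + a i j * s.x 17 else s.xm 5 i with hI
  have hlen := hcsc.length_le j
  have hp0 := hcsc.ptr_le j
  have hp1 := hcsc.ptr_le (j + 1)
  have hp := hcsc.ptr_succ j hj
  refine Runs.mono (T := 4 + ((col j).length * (8 + 1) + 1)) (Runs.seq (Q := I 0) (Runs.block ?_)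
    fun s' hs' => Runs.for_loop (start := s.wm 0 j) (n := (col j).length) I ?_ ?_ ?_ hs')
      (by omega) ?_
  · simp [hI, limitsCode, h3, h7, hp]
    refine ⟨by omega, by omega, by omega, ?_⟩
    repeat (first | exact Frame.refl | refine Frame.setW ?_ (by decide))
  · exact fun l s' hs' => hs'.2.1
  · exact fun l s' hs' => hs'.2.2.1
  · rintro l hl s₁ ⟨hF, g8, g9, g5⟩
    have hw3 : s₁.w 3 = 1 := by rw [hF.w 3 (by decide), h3]
    have hx17 := hF.x 17 (by decide)
    have e0 := hF.xm 0 (by decide)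
    have hi := hcsc.lt j _ (List.getElem_mem hl)
    have hnot : (col j)[l] ∉ (col j).take l := by
      intro hmem
      obtain ⟨l', hl', he⟩ := List.mem_take_iff_getElem.1 hmem
      have := (hcsc.nodup j).getElem_inj_iff.1 he
      omega
    have hmem : ∀ i, i ∈ (col j).take (l + 1) ↔ i ∈ (col j).take l ∨ i = (col j)[l] := by
      intro i
      rw [List.take_succ_eq_append_getElem hl, List.mem_append, List.mem_singleton]
    set i₀ := (col j)[l] with hi₀
    have g5' : s₁.xm 5 i₀ = s.xm 5 i₀ := by rw [g5, if_neg hnot]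
    refine Runs.block ?_
    simp [hI, hw3, g8, g9, hF.wm, e0, hx17, hcsc.row_eq j hj l hl, hcsc.val_eq j hj l hl, ← hi₀,
      g5']
    refine ⟨by omega, by omega, ?_, by ring, fun i => ?_⟩
    · repeat (first | exact hF | refine Frame.setW ?_ (by decide) |
        refine Frame.setReal ?_ (by decide) | refine Frame.setXM ?_ (by decide))
    · by_cases h : i = i₀
      · subst h
        simp [hmem]
      · simp [hmem, h, g5]
  · rintro s' ⟨hF, -, g9, g5⟩
    refine ⟨hF, fun i => ?_⟩
    rw [g5, List.take_length]
    split_ifs with h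
    · rfl
    · rw [hcsc.eq_zero i j h]; ring

/-- The sums in array 2 are scaled by register 16; array 5 gets the product with the matrix and
register 15 the largest entry. -/
def scaleProg : Prog :=
  .loop (.wlt 7 1) (.seq (block [.xload 17 2 7, .xop .mul 17 17 16, .xstore 2 7 17])
    (.seq maxAbsProg (.seq addColumnProg (block [.wop .add 7 7 3]))))

theorem scaleProg_spec {s : State} (hcsc : IsCSC m n k a col (s.wm 0) (s.wm 1) (s.xm 0))
    (h1 : s.w 1 = n) (h3 : s.w 3 = 1) (h7 : s.w 7 = 0) (hx2 : s.x 2 = 0) (hm : m < B)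
    (hn : n < B) (hnm : n * m < B) (h5 : ∀ i, s.xm 5 i = 0) {z : ℕ → ℝ}
    (hz : ∀ j < n, s.xm 2 j * s.x 16 = z j) :
    Runs B scaleProg s (n * (9 * k + 20) + 1) fun s' =>
      Frame [7, 8, 9, 10, 11] [15, 17, 18, 19] [2, 5] s s' ∧ (∀ j < n, s'.xm 2 j = z j) ∧
      (∀ i, s'.xm 5 i = ∑ j ∈ range n, a i j * z j) ∧ s'.x 15 = runMax (s.x 15) z n := by
  set I : ℕ → State → Prop := fun J s' => Frame [7, 8, 9, 10, 11] [15, 17, 18, 19] [2, 5] s s' ∧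
    s'.w 7 = J ∧ (∀ j, J ≤ j → s'.xm 2 j = s.xm 2 j) ∧ (∀ j < J, s'.xm 2 j = z j) ∧
    (∀ i, s'.xm 5 i = ∑ j ∈ range J, a i j * z j) ∧ s'.x 15 = runMax (s.x 15) z J with hI
  refine Runs.mono (T := n * (4 + (8 + ((9 * k + 5) + 2)) + 1) + 1)
    (Runs.for_loop (start := 0) (n := n) I ?_ ?_ ?_ ?_) (by
      refine Nat.succ_le_succ (Nat.mul_le_mul_left _ (by omega))) ?_
  · rintro J s' ⟨-, g7, -⟩
    rw [g7, zero_add]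
  · rintro J s' ⟨hF, -⟩
    rw [hF.w 1 (by decide), h1, zero_add]
  · rintro J hJ s₁ ⟨hF₁, g7, gold, gnew, g5, g15⟩
    have f3 : s₁.w 3 = 1 := by rw [hF₁.w 3 (by decide), h3]
    have f2 : s₁.x 2 = 0 := by rw [hF₁.x 2 (by decide), hx2]
    have f16 := hF₁.x 16 (by decide)
    refine Runs.seq (Q := fun s' => Frame [7, 8, 9, 10, 11] [15, 17, 18, 19] [2, 5] s s' ∧
      s'.w 7 = J ∧ (∀ j, J + 1 ≤ j → s'.xm 2 j = s.xm 2 j) ∧ (∀ j < J + 1, s'.xm 2 j = z j) ∧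
      s'.xm 5 = s₁.xm 5 ∧ s'.x 15 = s₁.x 15 ∧ s'.x 17 = z J ∧ s'.w 3 = 1 ∧ s'.x 2 = 0)
      (Runs.block ?_) ?_
    · simp [g7, gold J le_rfl, f16, hz J hJ, State.setXM_xm_ne, f3, f2]
      refine ⟨?_, fun j hj => ?_, fun j hj => ?_⟩
      · repeat (first | exact hF₁ | refine Frame.setW ?_ (by decide) |
          refine Frame.setReal ?_ (by decide) | refine Frame.setXM ?_ (by decide))
      · have : j ≠ J := by omega
        simp [this, gold j (by omega)]
      · by_cases h : j = J
        · simp [h]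
        · simp [h, gnew j (by omega)]
    rintro s₂ ⟨hF₂, k7, kold, knew, k5, k15, k17, k3, k2⟩
    refine Runs.seq (maxAbsProg_spec k2) ?_
    rintro s₃ ⟨hF₃, l15⟩
    have hF₃' := hF₂.trans (hF₃.mono (by decide) (by decide) (by decide))
    have hcsc₃ : IsCSC m n k a col (s₃.wm 0) (s₃.wm 1) (s₃.xm 0) := by
      rw [hF₃'.wm, hF₃'.xm 0 (by decide)]; exact hcsc
    refine Runs.seq (addColumnProg_spec hcsc₃ (by rw [hF₃.w 3 (by decide), k3])
      (by rw [hF₃.w 7 (by decide), k7]) hJ hm hn hnm) ?_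
    rintro s₄ ⟨hF₄, p5⟩
    have hF₄' := hF₃'.trans (hF₄.mono (by decide) (by decide) (by decide))
    have f7 : s₄.w 7 = J := by rw [hF₄.w 7 (by decide), hF₃.w 7 (by decide), k7]
    have f3' : s₄.w 3 = 1 := by rw [hF₄.w 3 (by decide), hF₃.w 3 (by decide), k3]
    have e2 : s₄.xm 2 = s₂.xm 2 := by rw [hF₄.xm 2 (by decide), hF₃.xm 2 (by decide)]
    refine Runs.block ?_
    simp only [wp, Arith.onWord, f7, f3', hI, State.setW_xm, State.setW_x, State.setW_w, if_true, e2]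
    refine ⟨by omega, hF₄'.setW (by decide), trivial, kold, knew, fun i => ?_, ?_⟩
    · rw [p5, hF₃.xm 5 (by decide), k5, g5, hF₃.x 17 (by decide), k17, sum_range_succ]
    · rw [hF₄.x 15 (by decide), l15, k15, k17, g15]; rfl
  · exact ⟨Frame.refl, h7, fun j _ => rfl, by simp, by simpa using h5, rfl⟩
  · rintro s' ⟨hF, g7, gold, gnew, g5, g15⟩
    exact ⟨hF, gnew, g5, g15⟩

/-- Register 15 gets its maximum with the entries of array 5 divided by register 6. -/
def rowMaxProg : Prog :=
  .seq (block [.wconst 6 0]) (.loop (.wlt 6 0) (.seq (block [.xload 17 5 6, .xop .div 17 17 6])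
    (.seq maxAbsProg (block [.wop .add 6 6 3]))))

theorem rowMaxProg_spec {s : State} (h0 : s.w 0 = m) (h3 : s.w 3 = 1) (hx2 : s.x 2 = 0)
    (hm : m < B) {y : ℕ → ℝ} (hy : ∀ i < m, s.xm 5 i / s.x 6 = y i) :
    Runs B rowMaxProg s (14 * m + 3) fun s' => Frame [6] [15, 17, 18] [] s s' ∧
      s'.x 15 = runMax (s.x 15) y m := by
  set I : ℕ → State → Prop := fun J s' => Frame [6] [15, 17, 18] [] s s' ∧
    s'.w 6 = J ∧ s'.x 15 = runMax (s.x 15) y J with hI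
  refine Runs.mono (T := 2 + (m * (3 + (8 + 2) + 1) + 1)) (Runs.seq (Q := I 0) (Runs.block ?_)
    fun s' hs' => Runs.for_loop (start := 0) (n := m) I ?_ ?_ ?_ hs') (by omega) ?_
  · simp [hI, runMax]
    exact ⟨by omega, Frame.refl.setW (by decide)⟩
  · rintro J s' ⟨-, g6, -⟩
    rw [g6, zero_add]
  · rintro J s' ⟨hF, -⟩
    rw [hF.w 0 (by decide), h0, zero_add]
  · rintro J hJ s₁ ⟨hF₁, g6, g15⟩
    refine Runs.seq (Q := fun s' => Frame [6] [15, 17, 18] [] s s' ∧ s'.w 6 = J ∧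
      s'.x 15 = s₁.x 15 ∧ s'.x 17 = y J) (Runs.block ?_) ?_
    · simp [g6, hF₁.xm 5, hF₁.x 6, hy J hJ]
      repeat (first | exact hF₁ | refine Frame.setReal ?_ (by decide))
    rintro s₂ ⟨hF₂, k6, k15, k17⟩
    refine Runs.seq (maxAbsProg_spec (by rw [hF₂.x 2 (by decide), hx2])) ?_
    rintro s₃ ⟨hF₃, l15⟩
    have hF₃' := hF₂.trans (hF₃.mono (by decide) (by decide) (by decide))
    refine Runs.block ?_
    simp only [wp, Arith.onWord, hF₃.w 6 (by decide), k6, hF₃'.w 3 (by decide), h3, hI,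
      State.setW_x, State.setW_w, if_true]
    refine ⟨by omega, hF₃'.setW (by decide), trivial, ?_⟩
    rw [l15, k15, k17, g15]; rfl
  · rintro s' ⟨hF, -, g⟩
    exact ⟨hF, g⟩

/-- Array 2 is divided by register 15. -/
def divideProg : Prog :=
  .seq (block [.wconst 7 0]) (.loop (.wlt 7 1) (block [.xload 17 2 7, .xop .div 17 17 15,
    .xstore 2 7 17, .wop .add 7 7 3]))

theorem divideProg_spec {s : State} (h1 : s.w 1 = n) (h3 : s.w 3 = 1) (hn : n < B) :
    Runs B divideProg s (6 * n + 3) fun s' => ∀ j < n, s'.xm 2 j = s.xm 2 j / s.x 15 := by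
  set I : ℕ → State → Prop := fun J s' => Frame [7] [17] [2] s s' ∧
    s'.w 7 = J ∧ (∀ j, J ≤ j → s'.xm 2 j = s.xm 2 j) ∧
    ∀ j < J, s'.xm 2 j = s.xm 2 j / s.x 15 with hI
  refine Runs.mono (T := 2 + (n * (5 + 1) + 1)) (Runs.seq (Q := I 0) (Runs.block ?_)
    fun s' hs' => Runs.for_loop (start := 0) (n := n) I ?_ ?_ ?_ hs') (by omega) ?_
  · simp [hI]
    exact ⟨by omega, Frame.refl.setW (by decide)⟩
  · rintro J s' ⟨-, g7, -⟩
    rw [g7, zero_add]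
  · rintro J s' ⟨hF, -⟩
    rw [hF.w 1 (by decide), h1, zero_add]
  · rintro J hJ s₁ ⟨hF₁, g7, gold, gnew⟩
    have f3 : s₁.w 3 = 1 := by rw [hF₁.w 3 (by decide), h3]
    have f15 := hF₁.x 15 (by decide)
    refine Runs.block ?_
    simp [g7, gold J le_rfl, f15, f3, hI]
    refine ⟨by omega, ?_, fun j hj => ?_, fun j hj => ?_⟩
    · repeat (first | exact hF₁ | refine Frame.setW ?_ (by decide) |
        refine Frame.setReal ?_ (by decide) | refine Frame.setXM ?_ (by decide))
    · have : j ≠ J := by omega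
      simp [this, gold j (by omega)]
    · by_cases h : j = J
      · simp [h]
      · simp [h, gnew j (by omega)]
  · rintro s' ⟨hF, -, -, g⟩
    exact g

end

def outputProg : Prog :=
  .seq (block [.xop .div 16 3 10, .wconst 7 0, .xop .add 15 1 2])
    (.seq scaleProg (.seq rowMaxProg divideProg))

/-- The normalized sums of the signs. -/
noncomputable def average (G : Game) (σ : Game.State) (j : ℕ) : ℝ := G.N / σ.time * σ.zs j

/-- The violation of the constraints by the normalized sums. -/
noncomputable def violation (G : Game) (n : ℕ) (r : ℝ) (σ : Game.State) : ℝ :=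
  runMax (runMax 1 (average G σ) n)
    (fun i => (∑ j ∈ range n, G.a i j * average G σ j) / r) G.m

theorem outputProg_spec {B n k q : ℕ} {G : Game} {col : ℕ → List ℕ} {r : ℝ} {σ : Game.State}
    {s : State} (hs : Setup B n k q G col s) (hrep : Rep G n σ s) (hx3 : s.x 3 = G.N)
    (hx6 : s.x 6 = r) (h5 : ∀ i, s.xm 5 i = 0) :
    Runs B outputProg s (n * (9 * k + 20) + 14 * G.m + 6 * n + 11) fun s' =>
      ∀ j < n, s'.xm 2 j = average G σ j / violation G n r σ := by
  refine Runs.mono (T := 4 + ((n * (9 * k + 20) + 1) + ((14 * G.m + 3) + (6 * n + 3))))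
    (Runs.seq (Q := fun s' => Frame [7] [15, 16] [] s s' ∧ s'.w 7 = 0 ∧ s'.x 16 = G.N / σ.time ∧
      s'.x 15 = 1) (Runs.block ?_) ?_) (by omega) (fun _ => id)
  · have := hs.n_lt
    simp [hs.x1, hs.x2, hx3, hrep.time]
    refine ⟨by omega, ?_⟩
    repeat (first | exact Frame.refl | refine Frame.setW ?_ (by decide) |
      refine Frame.setReal ?_ (by decide))
  rintro s₁ ⟨hF₁, h7, h16, h15⟩
  have hF₁' : CoinFrame [6, 7, 8, 9, 10, 11] [10, 11, 12, 13, 14, 15, 16, 17, 18, 19] [2, 3, 4, 5]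
      s s₁ := hF₁.coinFrame.mono (by decide) (by decide) (by decide)
  have hs₁ := hs.of_frame hF₁'
  refine Runs.seq (scaleProg_spec (z := average G σ) hs₁.csc hs₁.w1 hs₁.w3 h7 hs₁.x2 hs₁.m_lt
    hs₁.n_lt hs₁.nm_lt (fun i => by rw [hF₁.xm 5 (by decide), h5]) fun j hj => ?_) ?_
  · rw [hF₁.xm 2 (by decide), hrep.zs j hj, h16, average, mul_comm]
  rintro s₂ ⟨hF₂, g2, g5, g15⟩
  have hF₂' := hF₂.coinFrame.mono (W' := [6, 7, 8, 9, 10, 11])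
    (X' := [10, 11, 12, 13, 14, 15, 16, 17, 18, 19]) (M' := [2, 3, 4, 5])
    (by decide) (by decide) (by decide)
  have hs₂ := hs₁.of_frame hF₂'
  refine Runs.seq (rowMaxProg_spec
    (y := fun i => (∑ j ∈ range n, G.a i j * average G σ j) / r) hs₂.w0 hs₂.w3 hs₂.x2 hs₂.m_lt
    fun i _ => ?_) ?_
  · rw [g5, hF₂.x 6 (by decide), hF₁.x 6 (by decide), hx6]
  rintro s₃ ⟨hF₃, k15⟩
  refine Runs.mono (divideProg_spec (n := n) (by rw [hF₃.w 1 (by decide), hs₂.w1])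
    (by rw [hF₃.w 3 (by decide), hs₂.w3]) hs.n_lt) le_rfl ?_
  intro s₄ h j hj
  rw [h j hj, hF₃.xm 2 (by decide), g2 j hj, k15, g15, h15]
  rfl

/-- The algorithm. -/
def solve : Prog :=
  .seq powProg (.seq logProg (.seq newtonProg (.seq paramProg (.seq weightsProg
    (.seq mainProg outputProg)))))

/-- The game played by the algorithm, with comparison point `y`. -/
noncomputable def inputGame {m n : ℕ} (A : Matrix (Fin m) (Fin n) ℝ) (v y : Fin n → ℝ) (q : ℕ)
    (r : ℝ) : Game where
  m := m
  N := 2 ^ q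
  a := padMatrix A
  v := padVec v
  y := padVec y
  η := r / (8 * (q : ℝ) ^ 2 * 2 ^ q)
  lam := 2 * n / r
  ρ := r / 2 ^ q

def solveTime (n m k q T : ℕ) : ℕ :=
  (5 * q + 5) + ((6 * (64 * n * n) + 17) + ((6 * n + 6) + (28 + ((5 * m + 1) +
    ((T * (26 * k + 6 * q + 34) + 1) + (n * (9 * k + 20) + 14 * m + 6 * n + 11))))))

/-- The comparison point `y` is arbitrary: it influences only `X`, which the machine does not hold.
Hence the analysis may insert an unknown optimum. -/
theorem solve_spec {m n k q : ℕ} {A : Matrix (Fin m) (Fin n) ℝ} {v y : Fin n → ℝ} {C r : ℝ}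
    (hr : C * approxRadius n m = r) (hP : Params n m q r)
    (hk : ∀ j, {i | A i j ≠ 0}.ncard ≤ k) (ω : ℕ → Bool) :
    Runs (n ^ 4) solve (input A v C ω) (solveTime n m k q ⌈Game.horizon q r⌉₊) fun s' =>
      ∀ j < n, s'.xm 2 j = average (inputGame A v y q r)
        (runSteps q (inputGame A v y q r).step ⌈Game.horizon q r⌉₊ Game.init ω) j /
        violation (inputGame A v y q r) n r
          (runSteps q (inputGame A v y q r).step ⌈Game.horizon q r⌉₊ Game.init ω) := by
  set G := inputGame A v y q r with hG
  set s₀ := input A v C ω with hs₀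
  have hn := hP.n_ge
  have hm := hP.m_le
  have hpow := hP.pow_lt
  have hn2 : 10000 ≤ n ^ 2 := by nlinarith
  have hn4 : n ^ 4 = n ^ 2 * n ^ 2 := by ring
  have hn3 : n ^ 2 * n ^ 2 = n * (n ^ 2 * n) := by ring
  have hnn : n ≤ n ^ 2 := by nlinarith
  -- Room for the words: the bound `64 * n ^ 2` of the Riemann sum, the constant 12800, row indices
  -- and `2 ^ q`. The pointers, at most `n * m ≤ n ^ 3`, are treated next.
  have hB1 : 10000 * n ^ 2 ≤ n ^ 4 := by rw [hn4]; exact Nat.mul_le_mul_right _ hn2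
  have hB2 : n * m < n ^ 4 := by
    calc n * m ≤ n * n ^ 2 := Nat.mul_le_mul_left _ hm
      _ < n * n ^ 3 := by
        refine Nat.mul_lt_mul_of_pos_left ?_ (by omega)
        exact Nat.pow_lt_pow_right (by omega) (by norm_num)
      _ = n ^ 4 := by ring
  have h64 : 64 * n * n = 64 * n ^ 2 := by ring
  have csc := isCSC_input A hk v C ω
  rw [← hs₀] at csc
  have i0 : s₀.w 0 = m := by simp [hs₀, input]
  have i1 : s₀.w 1 = n := by simp [hs₀, input]
  have i5 : s₀.w 5 = 0 := by simp [hs₀, input]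
  have ix0 : s₀.x 0 = C := by simp [hs₀, input]
  have ix2 : s₀.x 2 = 0 := by simp [hs₀, input]
  have iv : ∀ j < n, s₀.xm 1 j = padVec v j := fun j hj => by simp [hs₀, input, padVec, hj]
  have iz : ∀ j, s₀.xm 2 j = 0 := fun j => by simp [hs₀, input]
  have i5' : ∀ j, s₀.xm 5 j = 0 := fun j => by simp [hs₀, input]
  have ic : s₀.coins = ω := rfl
  clear_value s₀
  unfold solve solveTime
  refine Runs.seq (powProg_spec i1 i5 hP.le_pow hpow (by omega) (by omega)) ?_
  rintro s₁ ⟨hF₁, a3, a4, a5⟩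
  have hF₁' := hF₁.mono (W' := [3, 4, 5, 6, 12]) (X' := [1, 3, 4, 5, 6, 7, 8, 9, 10, 11, 12, 16, 17,
    18, 19, 20, 21]) (M' := [3, 4]) (by decide) (by decide) (by decide)
  refine Runs.seq (logProg_spec (m := m) (n := n) (q := q) (by rw [hF₁.w 0 (by decide), i0])
    (by rw [hF₁.w 1 (by decide), i1]) a3 a4 a5 (by rw [hF₁.x 2 (by decide), ix2])
    (by rw [h64]; omega) (by omega)) ?_
  rintro s₂ ⟨hF₂, b1, b3, b4, b5, b18⟩
  have hF₂' := hF₁'.trans (hF₂.mono (by decide) (by decide) (by decide))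
  refine Runs.seq (newtonProg_spec (n := n) (by rw [hF₂'.w 1 (by decide), i1])
    (by rw [hF₂.w 3 (by decide), a3]) b1 (by omega)) ?_
  rintro s₃ ⟨hF₃, c18, c19⟩
  rw [b5, b18] at c18 c19
  have hF₃' := hF₂'.trans (hF₃.mono (by decide) (by decide) (by decide))
  have c1 : s₃.x 1 = 1 := by rw [hF₃.x 1 (by decide), b1]
  have c3 : s₃.x 3 = 2 ^ q := by rw [hF₃.x 3 (by decide), b3]
  refine Runs.seq (paramProg_spec (m := m) (n := n) (q := q) (C := C) (ρ := approxRadius n m)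
    (r := r) (by rw [hF₃'.w 0 (by decide), i0]) (by rw [hF₃'.x 0 (by decide), ix0])
    c1 (by rw [hF₃'.x 2 (by decide), ix2])
    c3 (by rw [hF₃.x 4 (by decide), b4])
    (by rw [hF₃.x 5 (by decide), b5]) (by rw [c18, c19]; rfl) hr (by omega)) ?_
  rintro s₄ ⟨hF₄, d6, d7, d8, d9, d10, d11, d12, d21, dw6⟩
  have hF₄' := hF₃'.trans (hF₄.mono (by decide) (by decide) (by decide))
  have d3 : s₄.w 3 = 1 := by
    rw [hF₄.w 3 (by decide), hF₃.w 3 (by decide), hF₂.w 3 (by decide), a3]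
  have d5 : s₄.w 5 = q := by
    rw [hF₄.w 5 (by decide), hF₃.w 5 (by decide), hF₂.w 5 (by decide), a5]
  have dx1 : s₄.x 1 = 1 := by rw [hF₄.x 1 (by decide), c1]
  have dx3 : s₄.x 3 = 2 ^ q := by rw [hF₄.x 3 (by decide), c3]
  refine Runs.seq (weightsProg_spec (m := m) (by rw [hF₄'.w 0 (by decide), i0]) d3 dw6 dx1
    (by omega)) ?_
  rintro s₅ ⟨hF₅, e⟩
  have hF₅' := hF₄'.trans (hF₅.mono (by decide) (by decide) (by decide))
  have hsetup : Setup (n ^ 4) n k q G (colRows A) s₅ := by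
    refine ⟨?_, ?_, ?_, ?_, ?_, ?_, ?_, ?_, ?_, ?_, ?_, ?_, ?_, ?_, ?_⟩
    · rw [hF₅'.wm, hF₅'.xm 0 (by decide)]; exact csc
    · rw [hF₅'.xm 1 (by decide)]; exact iv
    · rw [hF₅'.w 0 (by decide), i0]; rfl
    · rw [hF₅'.w 1 (by decide), i1]
    · rw [hF₅.w 3 (by decide), d3]
    · rw [hF₅.w 5 (by decide), d5]
    · rw [hF₅.x 1 (by decide), dx1]
    · rw [hF₅'.x 2 (by decide), ix2]
    · rw [hF₅.x 7 (by decide), d7]; rfl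
    · rw [hF₅.x 8 (by decide), d8]; rfl
    · rw [hF₅.x 21 (by decide), d21]; rfl
    · change m < n ^ 4; omega
    · omega
    · exact hB2
    · omega
  have hrep : Rep G n Game.init s₅ := by
    refine ⟨fun i hi => (e i hi).1, fun i hi => (e i hi).2, ?_, ?_, fun j _ => ?_, ?_⟩
    · rw [hF₅.x 12 (by decide), d12]; rfl
    · rw [hF₅.x 11 (by decide), d11]
      simp [Game.total, Game.init, hG, inputGame]
      ring
    · rw [hF₅'.xm 2 (by decide), iz]; rfl
    · rw [hF₅.x 10 (by decide), d10]; simp [Game.init]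
  have ha : ∀ i j, n ≤ j → G.a i j = 0 := fun i j hj =>
    dif_neg fun h => absurd h.2 (by omega)
  have hmain := mainProg_spec ha hsetup hrep
  rw [hF₅.x 9 (by decide), d9, hF₅'.coins, ic] at hmain
  refine Runs.seq hmain ?_
  rintro s₆ ⟨hF₆, hrep₆⟩
  refine outputProg_spec (hF₆.setup hsetup) hrep₆ ?_ ?_ fun i => ?_
  · rw [hF₆.x 3 (by decide), hF₅.x 3 (by decide), dx3]
    simp [hG, inputGame]
  · rw [hF₆.x 6 (by decide), hF₅.x 6 (by decide), d6]
  · rw [hF₆.xm 5 (by decide), hF₅'.xm 5 (by decide), i5']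

/-! #### The running time -/

/-- The upper bound on `C` gives a radius of at most `n`, from `log n ≤ 2 * √n`; it makes `ρ ≤ 1`
and `η ≤ 1 / 2`. The lower bound, from `log 2 > 0.69`, limits the horizon. -/
theorem radius_bounds {n m : ℕ} {C : ℝ} (hn : 100 ≤ n) (hm : m ≤ n ^ 2) (hC : 0 < C)
    (hC' : C ≤ √(Real.log n) / 3) :
    0 < C * √(n * Real.log ((m : ℝ) / n + 2)) ∧ C * √(n * Real.log ((m : ℝ) / n + 2)) ≤ n ∧
      C ^ 2 * n * 0.69 ≤ (C * √(n * Real.log ((m : ℝ) / n + 2))) ^ 2 := by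
  have hn' : (100 : ℝ) ≤ n := by exact_mod_cast hn
  have hm' : (m : ℝ) ≤ n ^ 2 := by exact_mod_cast hm
  have hmn : (m : ℝ) / n ≤ n := by rw [div_le_iff₀ (by linarith)]; linarith
  have hmn0 : 0 ≤ (m : ℝ) / n := by positivity
  set L := Real.log ((m : ℝ) / n + 2) with hL
  have hL1 : (0.69 : ℝ) ≤ L := by
    have := Real.log_two_gt_d9
    have h3 : Real.log 2 ≤ L := Real.log_le_log (by norm_num) (by linarith)
    linarith
  have hlog0 : 0 ≤ Real.log n := Real.log_nonneg (by linarith)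
  have hL2 : L ≤ 2 * Real.log n := by
    have h1 : L ≤ Real.log ((n : ℝ) ^ 2) := Real.log_le_log (by linarith) (by nlinarith)
    rwa [Real.log_pow] at h1
  have hlogn : Real.log n ≤ 2 * √n := by
    have h1 := Real.log_le_sub_one_of_pos (Real.sqrt_pos.2 (show (0 : ℝ) < n by linarith))
    rw [Real.log_sqrt (by linarith)] at h1
    linarith
  have hsq : Real.log n ^ 2 ≤ 4 * n := by
    have := Real.sq_sqrt (show (0 : ℝ) ≤ n by linarith)
    nlinarith [Real.sqrt_nonneg (n : ℝ)]
  have hC2 : C ^ 2 ≤ Real.log n / 9 := by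
    have := Real.sq_sqrt hlog0
    nlinarith [Real.sqrt_nonneg (Real.log n)]
  have e : (C * √(n * L)) ^ 2 = C ^ 2 * (n * L) := by
    rw [mul_pow, Real.sq_sqrt (by positivity)]
  refine ⟨by positivity, ?_, ?_⟩
  · refine le_of_sq_le_sq ?_ (by linarith)
    rw [e]
    calc C ^ 2 * (n * L) ≤ Real.log n / 9 * (n * (2 * Real.log n)) := by gcongr
      _ = n * (2 / 9 * Real.log n ^ 2) := by ring
      _ ≤ n * (2 / 9 * (4 * n)) := by gcongr
      _ ≤ n ^ 2 := by nlinarith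
  · rw [e, mul_assoc]
    gcongr

/-- Since `N < 2n` and `r ^ 2 ≥ C ^ 2 * n / 2`, the quotient `N ^ 2 / r ^ 2` is at most `8n / C ^
2`. Two factors from `1 / C` and five from `q ^ 5` make up the exponent 7. -/
theorem horizon_le {n m q : ℕ} {C r : ℝ} (hP : Params n m q r) (hC : 0 < C)
    (hr : C ^ 2 * n / 2 ≤ r ^ 2) :
    Game.horizon q r ≤ 4096000 * n * (max 1 C⁻¹ * Real.log n) ^ 7 := by
  have hlog := hP.log_ge_four
  have hq := hP.q_le
  have hN : (2 : ℝ) ^ q ≤ 2 * n := by exact_mod_cast hP.pow_lt.le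
  have hn : (100 : ℝ) ≤ n := by exact_mod_cast hP.n_ge
  have hr0 := hP.r_pos
  set c := max 1 C⁻¹ with hc
  have hc1 : 1 ≤ c := le_max_left _ _
  have hcC : (C ^ 2)⁻¹ ≤ c ^ 2 := by
    rw [← inv_pow]
    exact pow_le_pow_left₀ (by positivity) (le_max_right _ _) 2
  have h1 : (2 : ℝ) ^ q * 2 ^ q / r ^ 2 ≤ 8 * n * c ^ 2 := by
    calc (2 : ℝ) ^ q * 2 ^ q / r ^ 2 ≤ (2 * n) * (2 * n) / (C ^ 2 * n / 2) := by gcongr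
      _ = 8 * n * (C ^ 2)⁻¹ := by field_simp; norm_num
      _ ≤ _ := by gcongr
  calc Game.horizon q r ≤ 12800 * (2 * Real.log n) ^ 5 * (8 * n * c ^ 2 + 2 * n) := by
        unfold Game.horizon
        gcongr
    _ ≤ 12800 * (2 * Real.log n) ^ 5 * (8 * n * c ^ 2 + 2 * n * c ^ 2) := by
        have : (2 * n : ℝ) ≤ 2 * n * c ^ 2 :=
          le_mul_of_one_le_right (by positivity) (one_le_pow₀ hc1)
        exact mul_le_mul_of_nonneg_left (by linarith) (by positivity)
    _ = 4096000 * n * (c ^ 2 * Real.log n ^ 5) := by ring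
    _ ≤ 4096000 * n * (c * Real.log n) ^ 7 := by
        rw [mul_pow]
        gcongr
        · norm_num
        · linarith
        · norm_num

/-- The main loop dominates: about `n` steps up to logarithms, each costing `O(k + q)`, which raises
the exponent to 8. The Riemann sum, the row passes and the final product take `O(k * n + n ^ 2)`. -/
theorem solveTime_le {n m k q : ℕ} {C r : ℝ} (hP : Params n m q r) (hC : 0 < C)
    (hr : C ^ 2 * n / 2 ≤ r ^ 2) : (solveTime n m k q ⌈Game.horizon q r⌉₊ : ℝ) ≤
      (300000000 : ℕ) * (k * n + n ^ 2) * (max 1 C⁻¹ * Real.log n) ^ 8 := by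
  have hlog := hP.log_ge_four
  have hq := hP.q_le
  have hn : (100 : ℝ) ≤ n := by exact_mod_cast hP.n_ge
  have hm : (m : ℝ) ≤ n ^ 2 := by exact_mod_cast hP.m_le
  have hhor := horizon_le hP hC hr
  have hc1 : 1 ≤ max 1 C⁻¹ := le_max_left _ _
  set M := max 1 C⁻¹ * Real.log n with hM
  have hlM : Real.log n ≤ M := le_mul_of_one_le_left (by linarith) hc1
  have hM4 : 4 ≤ M := hlog.trans hlM
  have hT : (⌈Game.horizon q r⌉₊ : ℝ) ≤ 4096001 * n * M ^ 7 := by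
    have h0 : 0 ≤ Game.horizon q r := by unfold Game.horizon; positivity
    have h1 := (Nat.ceil_lt_add_one h0).le
    have h2 : (1 : ℝ) ≤ n * M ^ 7 := by
      have : (1 : ℝ) ≤ M ^ 7 := one_le_pow₀ (by linarith)
      nlinarith
    linarith
  have hk : (0 : ℝ) ≤ k := by positivity
  have hstep : (26 * k + 6 * q + 34 : ℝ) ≤ 46 * (k + 1) * M := by nlinarith
  have hM8 : (1 : ℝ) ≤ M ^ 8 := one_le_pow₀ (by linarith)
  have hq2 : (q : ℝ) ≤ n := by
    have h1 : q ≤ q ^ 2 := by nlinarith [hP.q_ge]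
    exact_mod_cast h1.trans hP.sq_le
  have hmain : (⌈Game.horizon q r⌉₊ : ℝ) * (26 * k + 6 * q + 34) ≤
      4096001 * 46 * (k * n + n ^ 2) * M ^ 8 := by
    calc (⌈Game.horizon q r⌉₊ : ℝ) * (26 * k + 6 * q + 34)
        ≤ (4096001 * n * M ^ 7) * (46 * (k + 1) * M) := by gcongr
      _ = 4096001 * 46 * (k * n + n) * M ^ 8 := by ring
      _ ≤ _ := by gcongr; nlinarith
  have hrest : (5 * q + 5 + (6 * (64 * n * n) + 17) + (6 * n + 6) + 28 + (5 * m + 1) + 1 +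
      (n * (9 * k + 20) + 14 * m + 6 * n + 11) : ℝ) ≤ 1000 * (k * n + n ^ 2) := by
    have : 0 ≤ (k : ℝ) * n := by positivity
    nlinarith
  have hrest' : (1000 * (k * n + n ^ 2) : ℝ) ≤ 1000 * (k * n + n ^ 2) * M ^ 8 :=
    le_mul_of_one_le_right (by positivity) hM8
  have hpos : 0 ≤ ((k : ℝ) * n + n ^ 2) * M ^ 8 := by positivity
  unfold solveTime
  push_cast
  nlinarith

/-! #### Correctness -/

theorem sum_range_pad {n N : ℕ} (h : n ≤ N) (f : ℕ → ℝ) (g : Fin n → ℝ)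
    (hf : ∀ j (hj : j < n), f j = g ⟨j, hj⟩) (h0 : ∀ j, n ≤ j → f j = 0) :
    ∑ j ∈ range N, f j = ∑ j, g j := by
  rw [← sum_subset (range_subset_range.2 h) fun j _ hj => h0 j (by simpa using hj), sum_range]
  exact sum_congr rfl fun j _ => hf j j.2

theorem mulVec_pad {m n N : ℕ} (h : n ≤ N) (A : Matrix (Fin m) (Fin n) ℝ) (y : Fin n → ℝ)
    (f : ℕ → ℝ) (hf : ∀ j : Fin n, f j = y j) (i : Fin m) :
    ∑ j ∈ range N, padMatrix A i j * f j = A.mulVec y i := by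
  refine sum_range_pad h _ (fun j => A i j * y j) (fun j hj => ?_) fun j hj => ?_
  · simp [padMatrix, hj, ← hf]
  · simp [padMatrix, hj]

theorem dotProduct_pad {n N : ℕ} (h : n ≤ N) (v y : Fin n → ℝ) (f : ℕ → ℝ)
    (hf : ∀ j : Fin n, f j = y j) : ∑ j ∈ range N, padVec v j * f j = v ⬝ᵥ y := by
  refine sum_range_pad h _ (fun j => v j * y j) (fun j hj => ?_) fun j hj => ?_
  · simp [padVec, hj, ← hf]
  · simp [padVec, hj]

theorem padVec_coe {n : ℕ} (y : Fin n → ℝ) (j : Fin n) : padVec y j = y j := by simp [padVec]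

theorem sum_sq_le {n : ℕ} {v : Fin n → ℝ} (hv : ‖WithLp.toLp 2 v‖ ≤ 2 * √n) :
    ∑ j, v j ^ 2 ≤ 4 * n := by
  have h := pow_le_pow_left₀ (norm_nonneg _) hv 2
  rw [EuclideanSpace.norm_sq_eq, mul_pow, Real.sq_sqrt (by positivity)] at h
  simp only [Real.norm_eq_abs, sq_abs] at h
  linarith

/-- This bound on the objective is the reason for the multiplier `2 * n / r`. -/
theorem dotProduct_le {n : ℕ} {v y : Fin n → ℝ} (hv : ∑ j, v j ^ 2 ≤ 4 * n)
    (hy : ∀ j, |y j| ≤ 1) : v ⬝ᵥ y ≤ 2 * n := by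
  have h : ∀ j, v j * y j ≤ v j ^ 2 / 4 + 1 := fun j => by
    have := (sq_le_one_iff_abs_le_one _).2 (hy j)
    nlinarith [sq_nonneg (v j / 2 - y j)]
  calc v ⬝ᵥ y ≤ ∑ j, (v j ^ 2 / 4 + 1) := sum_le_sum fun j _ => h j
    _ = (∑ j, v j ^ 2) / 4 + n := by rw [sum_add_distrib, ← sum_div]; simp
    _ ≤ 2 * n := by linarith

theorem isCompact_feasible {m n : ℕ} (A : Matrix (Fin m) (Fin n) ℝ) (C : ℝ) :
    IsCompact (feasible A C) := by
  refine Metric.isCompact_of_isClosed_isBounded ?_ ?_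
  · refine (isClosed_le continuous_norm continuous_const).inter
      (isClosed_le (Continuous.norm ?_) continuous_const)
    exact Continuous.matrix_mulVec continuous_const continuous_id
  · refine (Metric.isBounded_closedBall (x := (0 : Fin n → ℝ)) (r := 1)).subset fun x hx => ?_
    simpa using hx.1

theorem zero_mem_feasible {m n : ℕ} (A : Matrix (Fin m) (Fin n) ℝ) {C : ℝ} (hC : 0 ≤ C) :
    (0 : Fin n → ℝ) ∈ feasible A C := by
  refine ⟨by simp, ?_⟩
  simp only [Matrix.mulVec_zero, norm_zero]
  positivity

section
variable {m n q : ℕ} {A : Matrix (Fin m) (Fin n) ℝ} {v y : Fin n → ℝ} {r : ℝ}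

theorem tuned_inputGame (hP : Params n m q r) (hA : ∀ i j, |A i j| ≤ 1)
    (hv : ∑ j, v j ^ 2 ≤ 4 * n) (hy : ∀ j, |y j| ≤ 1) (hAy : ∀ i, |A.mulVec y i| ≤ r) :
    (inputGame A v y q r).Tuned n q r where
  params := hP
  N_eq := rfl
  η_eq := by simp [inputGame]
  lam_eq := rfl
  ρ_eq := by simp [inputGame]
  a_le i j := by
    simp only [inputGame, padMatrix]
    split_ifs
    · exact hA _ _
    · simp
  y_le j := by
    simp only [inputGame, padVec]
    split_ifs
    · exact hy _
    · simp
  y_eq j hj := by simp [inputGame, padVec, hj]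
  v_le := by
    refine (le_of_eq ?_).trans hv
    refine sum_range_pad le_rfl _ (fun j => v j ^ 2) (fun j hj => ?_) fun j hj => ?_
    · simp [inputGame, padVec, hj]
    · simp [inputGame, padVec, hj]
  row_le i hi := by
    have := mulVec_pad hP.le_pow A y (padVec y) (padVec_coe y) ⟨i, hi⟩
    simp only [inputGame]
    rw [this]
    exact hAy _
  value_le := by
    have := dotProduct_pad hP.le_pow v y (padVec y) (padVec_coe y)
    simp only [inputGame]
    rw [this]
    exact dotProduct_le hv hy

theorem one_le_violation (G : Game) (n : ℕ) (r : ℝ) (σ : Game.State) : 1 ≤ violation G n r σ :=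
  (le_runMax _ _ _).trans (le_runMax _ _ _)

theorem abs_average_le_violation (G : Game) {n : ℕ} (r : ℝ) (σ : Game.State) {j : ℕ} (hj : j < n) :
    |average G σ j| ≤ violation G n r σ :=
  (abs_le_runMax _ _ hj).trans (le_runMax _ _ _)

variable {σ : Game.State} {z : Fin n → ℝ}

/-- The output always satisfies the constraints. -/
theorem mem_feasible_of_eq {C : ℝ} (hr0 : 0 < r) (hC : r ≤ C * √(n * Real.log ((m : ℝ) / n + 2)))
    (hz : ∀ j : Fin n, z j = average (inputGame A v y q r) σ j /
      violation (inputGame A v y q r) n r σ) : z ∈ feasible A C := by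
  set G := inputGame A v y q r with hG
  set S := violation G n r σ with hS
  have hS1 : 1 ≤ S := one_le_violation G n r σ
  have hS0 : 0 < S := by linarith
  refine ⟨(pi_norm_le_iff_of_nonneg zero_le_one).2 fun j => ?_,
    (pi_norm_le_iff_of_nonneg (hr0.le.trans hC)).2 fun i => le_trans ?_ hC⟩
  · rw [Real.norm_eq_abs, hz, abs_div, abs_of_pos hS0, div_le_one hS0]
    exact abs_average_le_violation G r σ j.2
  · have h1 := mulVec_pad le_rfl A z (fun j => average G σ j / S) (fun j => (hz j).symm) i
    have h2 : ∑ j ∈ range n, padMatrix A i j * (average G σ j / S) =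
        (∑ j ∈ range n, padMatrix A i j * average G σ j) / S := by
      rw [sum_div]; exact sum_congr rfl fun j _ => by ring
    have h3 : |(∑ j ∈ range n, padMatrix A i j * average G σ j) / r| ≤ S :=
      abs_le_runMax _ (fun i => (∑ j ∈ range n, G.a i j * average G σ j) / r) i.2
    rw [abs_div, abs_of_pos hr0, div_le_iff₀ hr0] at h3
    rw [Real.norm_eq_abs, ← h1, h2, abs_div, abs_of_pos hS0, div_le_iff₀ hS0]
    linarith

/-- The output is nearly optimal if the samples are typical. -/
theorem dotProduct_ge_of_typical (hG : (inputGame A v y q r).Tuned n q r) {T : ℕ}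
    (hT : Game.horizon q r ≤ T) (hσ : (inputGame A v y q r).Inv σ) (htime : σ.time = T)
    (htyp : Game.Tuned.Typical (inputGame A v y q r) n q T σ)
    (hz : ∀ j : Fin n, z j = average (inputGame A v y q r) σ j /
      violation (inputGame A v y q r) n r σ) :
    v ⬝ᵥ y - 3 * n / (2 * (q : ℝ) ^ 2) ≤ v ⬝ᵥ z := by
  have hN := hG.N_pos
  have hT0 : (0 : ℝ) ≤ T := by positivity
  have hr0 := hG.params.r_pos
  have hle := hG.params.le_pow
  set G := inputGame A v y q r with hGdef
  set S := violation G n r σ with hS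
  have havg : ∀ j, average G σ j = G.N / T * σ.zs j := fun j => by rw [average, htime]
  have hc0 : 0 ≤ (G.N : ℝ) / T := by positivity
  -- If the violation comes from a coordinate, the typical bound on the counts limits it to `1 +
  -- tol`; otherwise it is 1 or comes from a row.
  have hSle : S ≤ 1 + Game.Tuned.tol q ∨ ∃ i < G.m, S = G.N / T * |G.rowSum σ i| / r := by
    have htol : 0 ≤ Game.Tuned.tol q := by unfold Game.Tuned.tol; positivity
    rcases runMax_eq (runMax 1 (average G σ) n)
      (fun i => (∑ j ∈ range n, G.a i j * average G σ j) / r) G.m with h | ⟨i, hi, h⟩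
    · left
      rw [hS, violation, h]
      rcases runMax_eq 1 (average G σ) n with h | ⟨j, hj, h⟩
      · linarith
      · have hT1 : (0 : ℝ) < T := lt_of_lt_of_le (by
          have : (7 : ℝ) ≤ q := by exact_mod_cast hG.params.q_ge
          unfold Game.horizon; positivity) hT
        rw [h, havg, abs_mul, abs_of_nonneg hc0]
        have h1 := (hσ.zs_le j).trans (htyp.2 j (hj.trans_le hle))
        calc (G.N : ℝ) / T * |σ.zs j| ≤ G.N / T * ((1 + Game.Tuned.tol q) * (T / G.N)) := by gcongr
          _ = 1 + Game.Tuned.tol q := by field_simp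
    · refine Or.inr ⟨i, hi, ?_⟩
      have e : ∑ j ∈ range n, G.a i j * average G σ j = G.N / T * G.rowSum σ i := by
        rw [Game.rowSum, mul_sum, sum_subset (range_subset_range.2 hle) fun j _ hj => ?_]
        · exact sum_congr rfl fun j _ => by rw [havg]; ring
        · have : n ≤ j := by simpa using hj
          simp [hGdef, inputGame, padMatrix, this]
      rw [hS, violation, h, e, abs_div, abs_of_pos hr0, abs_mul, abs_of_nonneg hc0]
  have h := hG.value_ge hT hσ htime htyp.1 (one_le_violation G n r σ) hSle
  have e1 : ∑ j ∈ range G.N, G.v j * G.y j = v ⬝ᵥ y := dotProduct_pad hle v y _ (padVec_coe y)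
  have e2 : (∑ j ∈ range G.N, G.v j * (G.N / T * σ.zs j)) / S = v ⬝ᵥ z := by
    rw [← dotProduct_pad hle v z (fun j => average G σ j / S) fun j => (hz j).symm, sum_div]
    exact sum_congr rfl fun j _ => by rw [havg, mul_div_assoc]; rfl
  rw [e1, e2] at h
  exact h

end

theorem exists_pow_two {n : ℕ} (hn : 2 ≤ n) : ∃ q, n ≤ 2 ^ q ∧ 2 ^ q < 2 * n := by
  refine ⟨Nat.clog 2 n, Nat.le_pow_clog (by norm_num) n, ?_⟩
  have h := Nat.pow_pred_clog_lt_self (b := 2) (by norm_num) (x := n) (by omega)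
  have h0 : 0 < Nat.clog 2 n := Nat.clog_pos (by norm_num) hn
  obtain ⟨c, hc⟩ : ∃ c, Nat.clog 2 n = c + 1 := ⟨_, (Nat.succ_pred_eq_of_pos h0).symm⟩
  rw [hc] at h ⊢
  simp only [Nat.pred_succ] at h
  rw [pow_succ]
  omega

/-- Everything that holds of the run on one input, together with the probability of success. -/
theorem solve_correct {n m k : ℕ} {C : ℝ} {A : Matrix (Fin m) (Fin n) ℝ} {v : Fin n → ℝ}
    (hn : 100 ≤ n) (hm : m ≤ n ^ 2) (hC : 0 < C) (hC' : C ≤ √(Real.log n) / 3)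
    (hA : ∀ i j, |A i j| ≤ 1) (hk : ∀ j, {i | A i j ≠ 0}.ncard ≤ k)
    (hv : ‖WithLp.toLp 2 v‖ ≤ 2 * √n) :
    ∃ good : Set (ℕ → Bool), 99 / 100 ≤ fairCoins.real good ∧
      ∀ ω, ∃ (t : ℕ) (s : State), Exec (n ^ 4) solve (input A v C ω) t s ∧
        (t : ℝ) ≤ (300000000 : ℕ) * (k * n + n ^ 2) * (max 1 C⁻¹ * Real.log n) ^ 8 ∧
        output n s ∈ feasible A C ∧ (ω ∈ good → objective v (output n s) ≥
          sSup (objective v '' feasible A C) - 1 / Real.log n ^ 2 * √n) := by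
  have hn' : (100 : ℝ) ≤ n := by exact_mod_cast hn
  have hn0 : (0 : ℝ) < n := by linarith
  obtain ⟨q, hq1, hq2⟩ := exists_pow_two (by omega : 2 ≤ n)
  obtain ⟨hR0, hRn, hR2⟩ := radius_bounds hn hm hC hC'
  obtain ⟨hr1, hr2⟩ := approxRadius_bounds hn hm
  set R := C * √(n * Real.log ((m : ℝ) / n + 2)) with hR
  set r := C * approxRadius n m with hr
  have hrR : r ≤ R := mul_le_mul_of_nonneg_left hr1 hC.le
  have hRr : (1 - 1 / (4 * n)) * R ≤ r := by
    have := mul_le_mul_of_nonneg_left hr2 hC.le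
    rw [hR, hr]; linarith
  have hu : 1 / (4 * (n : ℝ)) ≤ 1 / 400 := by
    rw [div_le_div_iff₀ (by positivity) (by norm_num)]; linarith
  have hr9 : 0.9 * R ≤ r := by nlinarith
  have hr0 : 0 < r := by linarith
  have hP : Params n m q r := ⟨hn, hm, hq1, hq2, hr0, hrR.trans hRn⟩
  have hrC : C ^ 2 * n / 2 ≤ r ^ 2 := by
    have h1 : (0.9 * R) ^ 2 ≤ r ^ 2 := pow_le_pow_left₀ (by positivity) hr9 2
    have h2 : 0 ≤ C ^ 2 * n := by positivity
    nlinarith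
  have hv2 := sum_sq_le hv
  obtain ⟨y, hy, hymax⟩ := (isCompact_feasible A C).exists_isMaxOn ⟨0, zero_mem_feasible A hC.le⟩
    (f := fun x => v ⬝ᵥ x) (Continuous.continuousOn (by fun_prop))
  have hy1 : ∀ j, |y j| ≤ 1 := fun j => (norm_le_pi_norm y j).trans hy.1
  have hy2 : ∀ i, |A.mulVec y i| ≤ R := fun i => (norm_le_pi_norm (A.mulVec y) i).trans hy.2
  have hyn : v ⬝ᵥ y ≤ 2 * n := dotProduct_le hv2 hy1
  have hy0 : 0 ≤ v ⬝ᵥ y := by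
    have : v ⬝ᵥ 0 ≤ v ⬝ᵥ y := hymax (zero_mem_feasible A hC.le)
    simpa using this
  have hrR0 : 0 ≤ r / R := by positivity
  have hrR1 : r / R ≤ 1 := (div_le_one hR0).2 hrR
  -- The maximizer meets the constraints with the true radius `R`; scaled by `r / R` it meets them
  -- with the computed one.
  have hG : (inputGame A v ((r / R) • y) q r).Tuned n q r := by
    refine tuned_inputGame hP hA hv2 (fun j => ?_) fun i => ?_
    · rw [Pi.smul_apply, smul_eq_mul, abs_mul, abs_of_nonneg hrR0]
      exact mul_le_one₀ hrR1 (abs_nonneg _) (hy1 j)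
    · rw [Matrix.mulVec_smul, Pi.smul_apply, smul_eq_mul, abs_mul, abs_of_nonneg hrR0]
      calc r / R * |A.mulVec y i| ≤ r / R * R := by gcongr; exact hy2 i
        _ = r := by field_simp
  set G := inputGame A v ((r / R) • y) q r with hGdef
  set T := ⌈Game.horizon q r⌉₊ with hTdef
  have hT : Game.horizon q r ≤ T := Nat.le_ceil _
  refine ⟨{ω | Game.Tuned.Typical G n q T (runSteps q G.step T Game.init ω)}, ?_, fun ω => ?_⟩
  · have h1 := hG.fairCoins_not_typical_le hT
    -- Subadditivity instead of the complement rule, which would require measurability.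
    have h2 := measureReal_union_le (μ := fairCoins)
      {ω | Game.Tuned.Typical G n q T (runSteps q G.step T Game.init ω)}
      {ω | ¬ Game.Tuned.Typical G n q T (runSteps q G.step T Game.init ω)}
    have h3 : {ω | Game.Tuned.Typical G n q T (runSteps q G.step T Game.init ω)} ∪
      {ω | ¬ Game.Tuned.Typical G n q T (runSteps q G.step T Game.init ω)} = Set.univ := by
      ext ω; simp [em]
    rw [h3, probReal_univ] at h2
    linarith
  · obtain ⟨t, s, hex, ht, hout⟩ := solve_spec (y := (r / R) • y) hr.symm hP hk (v := v) ω
    have hout' : ∀ j : Fin n, output n s j =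
        average G (runSteps q G.step T Game.init ω) j /
          violation G n r (runSteps q G.step T Game.init ω) := fun j => hout j j.2
    refine ⟨t, s, hex, le_trans (by exact_mod_cast ht) (solveTime_le hP hC hrC),
      mem_feasible_of_eq hr0 hrR hout', fun hω => ?_⟩
    have h1 := dotProduct_ge_of_typical hG hT (Game.inv_runSteps hG.valid rfl
      (fun ω => by simpa using (sample_mem q 0 ω).2) T ω) (Game.time_runSteps q T ω) hω hout'
    -- The relative error `1 / (4n)` of the radius, times `⟨v, y⟩ ≤ 2n`.
    have h2 : v ⬝ᵥ y - 1 / 2 ≤ v ⬝ᵥ ((r / R) • y) := by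
      rw [dotProduct_smul, smul_eq_mul]
      have h3 : 1 - 1 / (4 * n) ≤ r / R := (le_div_iff₀ hR0).2 hRr
      have h4 : 1 / (4 * (n : ℝ)) * (v ⬝ᵥ y) ≤ 1 / 2 := by
        calc 1 / (4 * (n : ℝ)) * (v ⬝ᵥ y) ≤ 1 / (4 * n) * (2 * n) := by gcongr
          _ = 1 / 2 := by field_simp; norm_num
      have := mul_le_mul_of_nonneg_right h3 hy0
      linarith
    have hq7 : (7 : ℝ) ≤ q := by exact_mod_cast hP.q_ge
    have hqn : (q : ℝ) ^ 2 ≤ n := by exact_mod_cast hP.sq_le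
    have hlog := hP.log_le
    have hlog4 := hP.log_ge_four
    have h5 : (1 : ℝ) / 2 + 3 * n / (2 * (q : ℝ) ^ 2) ≤ 1 / Real.log n ^ 2 * n := by
      have h6 : (1 : ℝ) / 2 ≤ n / (2 * (q : ℝ) ^ 2) := by
        rw [div_le_div_iff₀ (by norm_num) (by positivity)]; linarith
      -- As `log n ≤ 0.6932 * q` and `2 * 0.6932 ^ 2 < 1`. The total error `2n / q ^ 2` thus fits
      -- the claim; its part `n / (2q ^ 2)` covers the `1 / 2` because `q ^ 2 ≤ n`.
      have h7 : 2 / (q : ℝ) ^ 2 ≤ 1 / Real.log n ^ 2 := by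
        rw [div_le_div_iff₀ (by positivity) (by positivity)]
        nlinarith
      have h8 := mul_le_mul_of_nonneg_right h7 hn0.le
      have h9 : 2 / (q : ℝ) ^ 2 * n = n / (2 * (q : ℝ) ^ 2) + 3 * n / (2 * (q : ℝ) ^ 2) := by
        field_simp; norm_num
      linarith
    have hsup : sSup (objective v '' feasible A C) ≤ (v ⬝ᵥ y) / √n := by
      refine csSup_le ⟨_, Set.mem_image_of_mem _ hy⟩ ?_
      rintro _ ⟨x, hx, rfl⟩
      exact div_le_div_of_nonneg_right (hymax hx) (Real.sqrt_nonneg _)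
    have hs0 : 0 < √(n : ℝ) := Real.sqrt_pos.2 hn0
    have h6 : (v ⬝ᵥ y - 1 / Real.log n ^ 2 * n) / √n ≤ objective v (output n s) :=
      div_le_div_of_nonneg_right (by linarith) hs0.le
    have h7 : (v ⬝ᵥ y - 1 / Real.log n ^ 2 * n) / √n =
        (v ⬝ᵥ y) / √n - 1 / Real.log n ^ 2 * √n := by
      rw [sub_div, mul_div_assoc, Real.div_sqrt]
    linarith

end DiscrepancyLP

/-! ### The proposition -/

open RealRAM DiscrepancyLP in
theorem proposition2p4 :
    ∃ (P : Prog) (K a b : ℕ),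
      ∀ (n m k : ℕ) (C : ℝ) (A : Matrix (Fin m) (Fin n) ℝ) (v : Fin n → ℝ),
        100 ≤ n → m ≤ n ^ 2 → 0 < C → C ≤ √(Real.log n) / 3 →
        (∀ i j, |A i j| ≤ 1) →
        (∀ j, {i | A i j ≠ 0}.ncard ≤ k) →
        ‖WithLp.toLp 2 v‖ ≤ 2 * √n →
        (∀ ω : ℕ → Bool, ∃ (t : ℕ) (s : State),
          Exec (n ^ b) P (input A v C ω) t s ∧
          (t : ℝ) ≤ K * (k * n + n ^ 2) * (max 1 C⁻¹ * Real.log n) ^ a) ∧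
        99 / 100 ≤ fairCoins {ω | ∃ (t : ℕ) (s : State),
          Exec (n ^ b) P (input A v C ω) t s ∧
          output n s ∈ feasible A C ∧
          objective v (output n s) ≥
            sSup (objective v '' feasible A C) - 1 / Real.log n ^ 2 * √n} := by
  refine ⟨solve, 300000000, 8, 4, fun n m k C A v hn hm hC hC' hA hk hv => ?_⟩
  obtain ⟨good, hgood, h⟩ := solve_correct hn hm hC hC' hA hk hv
  refine ⟨fun ω => ?_, ?_⟩
  · obtain ⟨t, s, hex, ht, -⟩ := h ω
    exact ⟨t, s, hex, ht⟩
  · have hsub : good ⊆ {ω | ∃ (t : ℕ) (s : State),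
        Exec (n ^ 4) solve (input A v C ω) t s ∧ output n s ∈ feasible A C ∧
        objective v (output n s) ≥
          sSup (objective v '' feasible A C) - 1 / Real.log n ^ 2 * √n} := fun ω hω => by
      obtain ⟨t, s, hex, -, hf, ho⟩ := h ω
      exact ⟨t, s, hex, hf, ho hω⟩
    refine le_trans ?_ (measure_mono hsub)
    have h1 := ENNReal.ofReal_le_of_le_toReal hgood
    refine le_trans (le_of_eq ?_) h1
    rw [ENNReal.ofReal_div_of_pos (by norm_num)]
    norm_num
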